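/- **Theorem C.** There is a finitely generated group $G\notin\mathcal C$ such that $G$ is amenable if and only if Thompson's group $F$ is amenable. Here $\mathcal C$ is the class of countable groups $G$ for which the conjugacy relation, by orientation-preserving homeomorphisms of $\mathbb R$, on the space $\mathrm{Rep}_{\min}(G,\mathbb R)\subseteq \mathrm{Hom}(G,\mathrm{Homeo}_0(\mathbb R))$ of minimal actions of $G$ on $\mathbb R$ (actions all of whose orbits are dense, with the topology induced from the product of compact-open topologies) is smooth, i.e. there is a Borel map $e$ from this space to a standard Borel space such that two minimal actions are conjugate if and only if they have the same image under $e$. More precisely, for an open interval $I$ let $F_I$ be the group of homeomorphisms $f\colon I\to I$ that, outside a finite subset of $I\cap\mathbb Z[\frac12]$, are locally of the form $t\mapsto 2^kt+c$ with $k\in\mathbb Z$, $c\in\mathbb Z[\frac12]$; so $F=F_{(0,1)}$. Let $\varphi$ be a minimal homeomorphism of a Cantor space $X$, let $Y=(X\times\mathbb R)/\mathbb Z$ be its suspension, where $n\cdot(x,t)=(\varphi^n(x),t-n)$, with projection $\pi\colon X\times\mathbb R\to Y$ and flow $\Phi^t(\pi(x,s))=\pi(x,s+t)$, and let $\mathsf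 H(\varphi)$ be the group of homeomorphisms $g$ of $Y$ of the form $g(y)=\Phi^{\tau(y)}(y)$ with $\tau\colon Y\to\mathbb R$ continuous. Let $I=(-\frac14,\frac14)$ and $J=(\frac1{16},1-\frac1{16})$, and let $F_{X,J}\le\mathsf H(\varphi)$ be the group of all elements given by $\pi(x,t)\mapsto\pi(x,g(t))$ on $\pi(X\times J)$ for some $g\in F_J$, and by the identity elsewhere. Let $x_0\in X$ and $z=\pi(x_0,0)$, let $(C_n)_{n\ge0}$ be disjoint clopen sets with union $X\setminus\{x_0\}$, and let $f_n\in F_I$ $(n\ge 0)$ be such that 1. $f_n(t)>t$ for all $t\in I$ and all $n$; 2. $f_n(t)=f_m(t)$ for all $n\ge m$ and all $t\in I\setminus(-4^{-(m+1)},4^{-(m+1)})$; 3. $f_n(0)\to0$; 4. $(f_n)$ converges pointwise to a homeomorphism $f_\infty$ of $I$. Minimal homeomorphisms $\varphi$ of the Cantor space, such sets $C_n$ for every $x_0\in X$, and such sequences $(f_n)$ exist. For all such choices, the map $f\colon Y\to Y$ given by $f(\pi(x,t))=\pi(x,f_n(t))$ for $(x,t)\in C_n\times I$, $f(\pi(x_0,t))=\pi(x_0,f_\infty(t))$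 for $t\in I$, and $f(y)=y$ for $y\notin\pi(X\times I)$, is an element of $\mathsf H(\varphi)$; the group $F_{X,J}$ is isomorphic to $F$; and the group $G=\langle f,F_{X,J}\rangle\le\mathsf H(\varphi)$ has the following properties. 1. $G$ is finitely generated. 2. $G$ splits as a semidirect product $G=G^0\rtimes\langle f\rangle$, where $\langle f\rangle\cong\mathbb Z$ and $G^0$ is the normal subgroup of the elements of $G$ that fix pointwise a neighbourhood of $z$. Every finitely generated subgroup of $G^0$ is isomorphic to a subgroup of $F$. In particular, $G$ is amenable if and only if $F$ is amenable. 3. $G\notin\mathcal C$. -/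

import Mathlib

open Set Filter Topology

universe u

noncomputable section

/-! ## Amenability of discrete groups -/

/-- A (discrete) group `G` is amenable if there is a left-invariant mean on `ℓ^∞(G)`: a positive
normalised linear functional invariant under left translations. -/
def IsAmenable (G : Type u) [Group G] : Prop :=
  ∃ m : lp (fun _ : G => ℝ) ⊤ →ₗ[ℝ] ℝ,
    (∀ v : lp (fun _ : G => ℝ) ⊤, (∀ x, 0 ≤ v x) → 0 ≤ m v) ∧
    (∀ v : lp (fun _ : G => ℝ) ⊤, (∀ x, v x = 1) → m v = 1) ∧
    ∀ (g : G) (v w : lp (fun _ : G => ℝ) ⊤), (∀ x, w x = v (g⁻¹ * x)) → m w = m v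

/-! ## Minimal actions on the line and the class of groups with smooth conjugacy relation -/

/-- The group of orientation-preserving homeomorphisms of the real line. -/
def HomeoPlus : Subgroup (ℝ ≃ₜ ℝ) where
  carrier := {f | StrictMono f}
  one_mem' := strictMono_id
  mul_mem' := fun {f g} (hf : StrictMono f) (hg : StrictMono g) => hf.comp hg
  inv_mem' := fun {f} (hf : StrictMono f) a b hab => by
    rw [← hf.lt_iff_lt]
    change f (f.symm a) < f (f.symm b)
    simpa using hab

/-- The compact-open topology on `HomeoPlus`. -/
instance : TopologicalSpace HomeoPlus :=
  TopologicalSpace.induced (fun f => (⟨f.1, f.1.continuous⟩ : C(ℝ, ℝ))) inferInstance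

/-- The action `ρ` of `G` on the line is minimal: every orbit is dense. -/
def IsMinimalAction {G : Type u} [Group G] (ρ : G →* HomeoPlus) : Prop :=
  ∀ x : ℝ, Dense (range fun g : G => (ρ g).1 x)

/-- The space of minimal actions of `G` on the line. -/
def RepMin (G : Type u) [Group G] : Type u := {ρ : G →* HomeoPlus // IsMinimalAction ρ}

/-- The topology of pointwise convergence, induced by the inclusion in the product of copies of
`HomeoPlus` indexed by `G`. -/
instance (G : Type u) [Group G] : TopologicalSpace (RepMin G) :=
  TopologicalSpace.induced (fun ρ : RepMin G => (fun g : G => ρ.1 g : G → HomeoPlus))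
    inferInstance

instance (G : Type u) [Group G] : MeasurableSpace (RepMin G) := borel _

/-- Conjugacy of minimal actions by an orientation-preserving homeomorphism. -/
def RepMin.Conj {G : Type u} [Group G] (ρ σ : RepMin G) : Prop :=
  ∃ h : HomeoPlus, ∀ g : G, h * ρ.1 g * h⁻¹ = σ.1 g

/-- An equivalence relation on a measurable space is smooth if it is Borel reducible to equality
on a standard Borel space. -/
def IsSmoothRel {A : Type u} [MeasurableSpace A] (E : A → A → Prop) : Prop :=
  ∃ (Z : Type) (_ : MeasurableSpace Z) (_ : StandardBorelSpace Z) (e : A → Z),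
    Measurable e ∧ ∀ a b, E a b ↔ e a = e b

/-- The class of countable groups whose conjugacy relation on minimal actions on the line is
smooth. -/
def InClassC (G : Type u) [Group G] : Prop :=
  Countable G ∧ IsSmoothRel (RepMin.Conj (G := G))

/-! ## Dyadic piecewise linear homeomorphisms and Thompson's group -/

/-- The ring `ℤ[1/2]` of dyadic rationals, inside `ℝ`. -/
def dyadicRing : Subring ℝ := Subring.closure {(2 : ℝ)⁻¹}

theorem two_zpow_mem_dyadicRing (k : ℤ) : (2 : ℝ) ^ k ∈ dyadicRing := by
  have h : (2 : ℝ)⁻¹ ∈ dyadicRing := Subring.subset_closure rfl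
  have h2 : (2 : ℝ) ∈ dyadicRing := ofNat_mem dyadicRing 2
  cases k with
  | ofNat n => simpa using pow_mem h2 n
  | negSucc n => simpa [zpow_negSucc] using pow_mem h (n + 1)

/-- A self-homeomorphism of the interval `(a, b)` is PL dyadic if outside a finite set of dyadic
points it is locally of the form `x ↦ 2 ^ k * x + c` with `k` an integer and `c` dyadic. -/
def IsPLDyadic {a b : ℝ} (f : Ioo a b ≃ₜ Ioo a b) : Prop :=
  ∃ S : Finset (Ioo a b), (∀ s ∈ S, (s : ℝ) ∈ dyadicRing) ∧
    ∀ x, x ∉ S → ∃ k : ℤ, ∃ c ∈ dyadicRing, ∀ᶠ y in 𝓝 x, (f y : ℝ) = 2 ^ k * (y : ℝ) + c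

theorem affine_germ_unique {a b : ℝ} (x : Ioo a b) {k l : ℤ} {c d : ℝ}
    (h : ∀ᶠ y : Ioo a b in 𝓝 x, (2 : ℝ) ^ k * (y : ℝ) + c = 2 ^ l * (y : ℝ) + d) : k = l ∧ c = d := by
  have hx := h.self_of_nhds
  have h' : ∀ᶠ y : Ioo a b in 𝓝[>] x, (2 : ℝ) ^ k * (y : ℝ) + c = 2 ^ l * (y : ℝ) + d :=
    h.filter_mono nhdsWithin_le_nhds
  obtain ⟨y, hy, hlt⟩ := (h'.and (eventually_mem_nhdsWithin (a := x) (s := Ioi x))).exists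
  have hne' : (y : ℝ) - x ≠ 0 := sub_ne_zero.2 fun e => (ne_of_gt hlt) (Subtype.ext e)
  have h1 : (2 : ℝ) ^ k = 2 ^ l := mul_right_cancel₀ hne' (by linarith)
  refine ⟨zpow_right_injective₀ two_pos (by norm_num) h1, ?_⟩
  rw [h1] at hx
  linarith

theorem exists_right_germ {a b : ℝ} {f : Ioo a b → ℝ} (S : Finset (Ioo a b))
    (hf : ∀ x, x ∉ S → ∃ k : ℤ, ∃ c ∈ dyadicRing, ∀ᶠ y in 𝓝 x, f y = 2 ^ k * (y : ℝ) + c)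
    (s : Ioo a b) : ∃ k : ℤ, ∃ c ∈ dyadicRing, ∀ᶠ y in 𝓝[>] s, f y = 2 ^ k * (y : ℝ) + c := by
  classical
  have : Inhabited (Ioo a b) := ⟨s⟩
  have hS : ∀ᶠ y in 𝓝 s, y ∉ S.erase s :=
    (S.erase s).finite_toSet.isClosed.isOpen_compl.mem_nhds (by simp)
  obtain ⟨t, hst, ht⟩ := (mem_nhdsGT_iff_exists_Ioo_subset (a := s)).1
    (hS.filter_mono (nhdsWithin_le_nhds (s := Ioi s)))
  have hU : ∀ x ∈ Ioo s t, x ∉ S := fun x hx hxS =>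
    ht hx (Finset.mem_erase.2 ⟨ne_of_gt hx.1, hxS⟩)
  obtain ⟨x₀, hx₀⟩ := exists_between (show s < t from hst)
  obtain ⟨k, c, hc, h⟩ := hf x₀ (hU x₀ hx₀)
  refine ⟨k, c, hc, ?_⟩
  have hpre : IsPreconnected (Ioo s t) := isPreconnected_Ioo
  let A : Set (Ioo a b) := {x | ∀ᶠ y in 𝓝 x, f y = 2 ^ k * (y : ℝ) + c}
  let B : Set (Ioo a b) := {x | ∃ (l : ℤ) (d : ℝ), (l ≠ k ∨ d ≠ c) ∧
    ∀ᶠ y in 𝓝 x, f y = 2 ^ l * (y : ℝ) + d}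
  have hA : IsOpen A := isOpen_setOfPred_eventually_nhds
  have hB : IsOpen B := by
    have : B = ⋃ (l : ℤ) (d : ℝ) (_ : l ≠ k ∨ d ≠ c),
      {x | ∀ᶠ y in 𝓝 x, f y = 2 ^ l * (y : ℝ) + d} := by
      ext x; simp [B]
    rw [this]
    exact isOpen_iUnion fun l => isOpen_iUnion fun d => isOpen_iUnion fun _ =>
      isOpen_setOfPred_eventually_nhds
  have hdisj : ∀ x, x ∈ A → x ∈ B → False := by
    rintro x hxA ⟨l, d, hne, hxB⟩
    obtain ⟨h1, h2⟩ := affine_germ_unique x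
      ((hxA.and hxB).mono fun y hy => hy.1.symm.trans hy.2)
    rcases hne with h | h
    · exact h h1.symm
    · exact h h2.symm
  have hcov : Ioo s t ⊆ A ∪ B := by
    intro x hx
    obtain ⟨l, d, -, hl⟩ := hf x (hU x hx)
    by_cases e : l = k ∧ d = c
    · obtain ⟨rfl, rfl⟩ := e
      exact Or.inl hl
    · exact Or.inr ⟨l, d, by tauto, hl⟩
  have hsub : Ioo s t ⊆ A := by
    refine hpre.subset_left_of_subset_union hA hB
      (Set.disjoint_left.2 fun x h1 h2 => hdisj x h1 h2) hcov ⟨x₀, hx₀, h⟩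
  filter_upwards [Ioo_mem_nhdsGT hst] with y hy
  exact (hsub hy).self_of_nhds

theorem IsPLDyadic.apply_mem {a b : ℝ} {f : Ioo a b ≃ₜ Ioo a b} (hf : IsPLDyadic f)
    {s : Ioo a b} (hs : (s : ℝ) ∈ dyadicRing) : (f s : ℝ) ∈ dyadicRing := by
  obtain ⟨S, -, h⟩ := hf
  obtain ⟨k, c, hc, hk⟩ := exists_right_germ (f := fun y => (f y : ℝ)) S h s
  have hne : (𝓝[>] s).NeBot := inferInstance
  have h1 : Tendsto (fun y : Ioo a b => (f y : ℝ)) (𝓝[>] s) (𝓝 (f s : ℝ)) :=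
    ((continuous_subtype_val.comp f.continuous).tendsto s).mono_left nhdsWithin_le_nhds
  have h2 : Tendsto (fun y : Ioo a b => (2 : ℝ) ^ k * (y : ℝ) + c) (𝓝[>] s)
      (𝓝 (2 ^ k * (s : ℝ) + c)) :=
    ((Continuous.tendsto (by fun_prop) s)).mono_left nhdsWithin_le_nhds
  rw [tendsto_nhds_unique (h1.congr' hk) h2]
  exact add_mem (mul_mem (two_zpow_mem_dyadicRing _) hs) hc

/-- The group `F_I` of PL dyadic homeomorphisms of the interval `I = (a, b)`. -/
def PLDyadic (a b : ℝ) : Subgroup (Ioo a b ≃ₜ Ioo a b) where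
  carrier := {f | IsPLDyadic f}
  one_mem' := ⟨∅, by simp, fun x _ => ⟨0, 0, zero_mem _, Eventually.of_forall fun y => by simp⟩⟩
  mul_mem' := by
    classical
    rintro f g ⟨S, hS, hf⟩ ⟨T, hT, hg⟩
    have key : ∀ x, x ∉ T → g x ∈ S → (x : ℝ) ∈ dyadicRing := by
      intro x hx hgx
      obtain ⟨k, c, hc, h⟩ := hg x hx
      have h1 : (x : ℝ) = 2 ^ (-k) * ((g x : ℝ) - c) := by
        rw [h.self_of_nhds, zpow_neg]
        field_simp
        ring
      rw [h1]
      exact mul_mem (two_zpow_mem_dyadicRing _) (sub_mem (hS _ hgx) hc)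
    refine ⟨T ∪ S.image g.symm, ?_, ?_⟩
    · intro s hs
      by_cases hT' : s ∈ T
      · exact hT s hT'
      · rcases Finset.mem_union.1 hs with h | h
        · exact absurd h hT'
        · obtain ⟨r, hr, rfl⟩ := Finset.mem_image.1 h
          exact key _ hT' (by simpa using hr)
    · intro x hx
      have hxT : x ∉ T := fun h => hx (Finset.mem_union_left _ h)
      have hxS : g x ∉ S := fun h => hx (Finset.mem_union_right _
        (Finset.mem_image.2 ⟨g x, h, by simp⟩))
      obtain ⟨k, c, hc, h⟩ := hg x hxT
      obtain ⟨l, d, hd, h'⟩ := hf (g x) hxS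
      refine ⟨l + k, 2 ^ l * c + d,
        add_mem (mul_mem (two_zpow_mem_dyadicRing _) hc) hd, ?_⟩
      filter_upwards [h, g.continuous.continuousAt.eventually h'] with y hy hy'
      change (f (g y) : ℝ) = _
      rw [hy', hy, zpow_add₀ two_ne_zero]
      ring
  inv_mem' := by
    classical
    rintro f hpl
    obtain ⟨S, hS, hf⟩ := id hpl
    refine ⟨S.image f, ?_, ?_⟩
    · intro s hs
      obtain ⟨r, hr, rfl⟩ := Finset.mem_image.1 hs
      exact hpl.apply_mem (hS r hr)
    · intro x hx
      have hxS : f.symm x ∉ S := fun h => hx (Finset.mem_image.2 ⟨_, h, by simp⟩)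
      obtain ⟨k, c, hc, h⟩ := hf _ hxS
      refine ⟨-k, -(2 ^ (-k) * c), neg_mem (mul_mem (two_zpow_mem_dyadicRing _) hc), ?_⟩
      filter_upwards [f.symm.continuous.continuousAt.eventually h] with y hy
      rw [Homeomorph.apply_symm_apply] at hy
      change (f.symm y : ℝ) = _
      rw [hy, zpow_neg]
      field_simp
      ring

/-- Thompson's group `F`: the PL dyadic homeomorphisms of `(0, 1)`. -/
abbrev ThompsonF : Type := PLDyadic 0 1

/-! ## Suspension of a homeomorphism -/

/-- A minimal homeomorphism: every orbit is dense. -/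
def IsMinimalHomeo {X : Type u} [TopologicalSpace X] (φ : X ≃ₜ X) : Prop :=
  ∀ x : X, Dense (range fun n : ℤ => (φ ^ n) x)

/-- The orbit relation of the action of `ℤ` on `X × ℝ` given by
`n • (x, t) = (φ ^ n x, t - n)`. -/
def suspensionSetoid {X : Type u} [TopologicalSpace X] (φ : X ≃ₜ X) : Setoid (X × ℝ) where
  r p q := ∃ n : ℤ, q = ((φ ^ n) p.1, p.2 - n)
  iseqv :=
    { refl := fun p => ⟨0, by simp⟩
      symm := by
        rintro p q ⟨n, rfl⟩
        refine ⟨-n, ?_⟩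
        ext1
        · change p.1 = (φ ^ (-n) * φ ^ n) p.1
          simp
        · simp
      trans := by
        rintro p q r ⟨n, rfl⟩ ⟨m, rfl⟩
        refine ⟨m + n, ?_⟩
        ext1
        · rw [zpow_add]
          rfl
        · push_cast
          ring }

/-- The suspension (mapping torus) `Y = (X × ℝ) / ℤ` of `φ`. -/
def Suspension {X : Type u} [TopologicalSpace X] (φ : X ≃ₜ X) : Type u :=
  Quotient (suspensionSetoid φ)

namespace Suspension

variable {X : Type u} [TopologicalSpace X] (φ : X ≃ₜ X)

instance : TopologicalSpace (Suspension φ) :=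
  inferInstanceAs (TopologicalSpace (Quotient (suspensionSetoid φ)))

/-- The quotient projection `X × ℝ → Y`. -/
def proj (x : X) (t : ℝ) : Suspension φ := Quotient.mk (suspensionSetoid φ) (x, t)

/-- The suspension flow `Φ ^ t (π (x, s)) = π (x, s + t)`. -/
def flow (t : ℝ) : Suspension φ → Suspension φ :=
  Quotient.map (fun p : X × ℝ => (p.1, p.2 + t)) (by
    rintro p q ⟨n, rfl⟩
    exact ⟨n, Prod.ext rfl (by simp only; ring)⟩)

theorem flow_zero (y : Suspension φ) : flow φ 0 y = y := by
  induction y using Quotient.inductionOn with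
  | h p => exact congrArg (Quotient.mk _) (Prod.ext rfl (add_zero p.2))

theorem flow_flow (s t : ℝ) (y : Suspension φ) : flow φ s (flow φ t y) = flow φ (t + s) y := by
  induction y using Quotient.inductionOn with
  | h p => exact congrArg (Quotient.mk _) (Prod.ext rfl (add_assoc p.2 t s))

/-- The group `H(φ)` of homeomorphisms of `Y` that displace points along the flow by a continuous
amount. -/
def flowGroup : Subgroup (Suspension φ ≃ₜ Suspension φ) where
  carrier := {f | ∃ τ : C(Suspension φ, ℝ), ∀ y, f y = flow φ (τ y) y}
  one_mem' := ⟨0, fun y => (flow_zero φ y).symm⟩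
  mul_mem' := by
    rintro f g ⟨σ, hf⟩ ⟨τ, hg⟩
    refine ⟨⟨fun y => τ y + σ (g y), by fun_prop⟩, fun y => ?_⟩
    change f (g y) = _
    have h := flow_flow φ (σ (g y)) (τ y) y
    rw [← hg y] at h
    exact (hf (g y)).trans h
  inv_mem' := by
    rintro f ⟨τ, hf⟩
    refine ⟨⟨fun y => -τ (f.symm y), by fun_prop⟩, fun y => ?_⟩
    change f.symm y = _
    conv_rhs => rw [← f.apply_symm_apply y, hf (f.symm y)]
    rw [flow_flow, ← hf]
    simp [flow_zero]

/-- The image `Y_{C,I}` of `C × I` in the suspension, for the interval `I = (a, b)`. -/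
def chart (C : Set X) (a b : ℝ) : Set (Suspension φ) :=
  {y | ∃ x ∈ C, ∃ t ∈ Ioo a b, proj φ x t = y}

/-- The group `F_{C,I}`, for the interval `I = (a, b)`: the elements of `H(φ)` that are given by
`(x, t) ↦ (x, g t)` in the chart `C × I`, for some `g` in `F_I`, and are the identity outside the
chart. -/
def chartGroup (C : Set X) (a b : ℝ) : Subgroup (flowGroup φ) where
  carrier := {h | (∃ g ∈ PLDyadic a b, ∀ x ∈ C, ∀ t : Ioo a b, h.1 (proj φ x t) = proj φ x (g t)) ∧
    ∀ y, y ∉ chart φ C a b → h.1 y = y}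
  one_mem' := ⟨⟨1, one_mem _, fun _ _ _ => rfl⟩, fun _ _ => rfl⟩
  mul_mem' := by
    rintro h₁ h₂ ⟨⟨g₁, hg₁, e₁⟩, o₁⟩ ⟨⟨g₂, hg₂, e₂⟩, o₂⟩
    refine ⟨⟨g₁ * g₂, mul_mem hg₁ hg₂, fun x hx t => ?_⟩, fun y hy => ?_⟩
    · change h₁.1 (h₂.1 _) = _
      rw [e₂ x hx, e₁ x hx]
      rfl
    · change h₁.1 (h₂.1 _) = _
      rw [o₂ y hy, o₁ y hy]
  inv_mem' := by
    rintro h ⟨⟨g, hg, e⟩, o⟩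
    refine ⟨⟨g⁻¹, inv_mem hg, fun x hx t => ?_⟩, fun y hy => ?_⟩
    · change h.1.symm _ = _
      rw [Homeomorph.symm_apply_eq, e x hx]
      change _ = proj φ x (g (g.symm t))
      simp
    · change h.1.symm _ = _
      rw [Homeomorph.symm_apply_eq, o y hy]

/-- The germ stabiliser of `z` in a group of homeomorphisms `G ≤ H(φ)`: the elements of `G` that
fix pointwise some neighbourhood of `z`. -/
def germStabilizer (G : Subgroup (flowGroup φ)) (z : Suspension φ) : Subgroup G where
  carrier := {g | ∀ᶠ y in 𝓝 z, g.1.1 y = y}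
  one_mem' := Eventually.of_forall fun _ => rfl
  mul_mem' := by
    intro g h hg hh
    filter_upwards [hg, hh] with y hy hy'
    change g.1.1 (h.1.1 y) = y
    rw [hy', hy]
  inv_mem' := by
    intro g hg
    filter_upwards [hg] with y hy
    change g.1.1.symm y = y
    rw [Homeomorph.symm_apply_eq, hy]

end Suspension

/-! ## The construction -/

/-- A sequence of PL dyadic homeomorphisms `s n` of `I = (-1/4, 1/4)` without fixed points that
stabilises away from `0` and converges to a homeomorphism `s∞` of `I` fixing `0`. -/
structure IsApproxSequence (s : ℕ → PLDyadic (-1 / 4) (1 / 4))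
    (sInf : Ioo (-1 / 4 : ℝ) (1 / 4) ≃ₜ Ioo (-1 / 4 : ℝ) (1 / 4)) : Prop where
  lt_apply : ∀ n (t : Ioo (-1 / 4 : ℝ) (1 / 4)), t < (s n).1 t
  eq_of_le : ∀ m n, m ≤ n → ∀ t : Ioo (-1 / 4 : ℝ) (1 / 4),
    (t : ℝ) ∉ Ioo (-(1 / 4 ^ (m + 1)) : ℝ) (1 / 4 ^ (m + 1)) → (s n).1 t = (s m).1 t
  tendsto_zero : Tendsto (fun n => ((s n).1 ⟨0, by norm_num⟩ : ℝ)) atTop (𝓝 0)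
  tendsto : ∀ t, Tendsto (fun n => (s n).1 t) atTop (𝓝 (sInf t))

/-- The sets `C n` are clopen and form a partition of `X ∖ {x₀}`. -/
structure IsClopenPartition {X : Type u} [TopologicalSpace X] (x₀ : X) (C : ℕ → Set X) : Prop where
  isClopen : ∀ n, IsClopen (C n)
  pairwise_disjoint : Pairwise fun m n => Disjoint (C m) (C n)
  iUnion_eq : ⋃ n, C n = {x₀}ᶜ

/-- The element `f` of `H(φ)` supported in the chart `X × I`, `I = (-1/4, 1/4)`, which acts as
`s n` on the fibres over `C n`, and as `s∞` on the fibre over `x₀`. -/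
structure IsTwist {X : Type u} [TopologicalSpace X] (φ : X ≃ₜ X) (x₀ : X) (C : ℕ → Set X)
    (s : ℕ → PLDyadic (-1 / 4) (1 / 4))
    (sInf : Ioo (-1 / 4 : ℝ) (1 / 4) ≃ₜ Ioo (-1 / 4 : ℝ) (1 / 4))
    (f : Suspension.flowGroup φ) : Prop where
  apply_of_mem : ∀ n, ∀ x ∈ C n, ∀ t : Ioo (-1 / 4 : ℝ) (1 / 4),
    f.1 (Suspension.proj φ x t) = Suspension.proj φ x ((s n).1 t)
  apply_base : ∀ t : Ioo (-1 / 4 : ℝ) (1 / 4),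
    f.1 (Suspension.proj φ x₀ t) = Suspension.proj φ x₀ (sInf t)
  apply_of_notMem : ∀ y, y ∉ Suspension.chart φ univ (-1 / 4) (1 / 4) → f.1 y = y

/-- The group `G = ⟨f, F_{X,J}⟩` with `J = (1/16, 1 - 1/16)`. -/
def twistGroup {X : Type u} [TopologicalSpace X] (φ : X ≃ₜ X) (f : Suspension.flowGroup φ) :
    Subgroup (Suspension.flowGroup φ) :=
  Subgroup.closure ({f} ∪ (Suspension.chartGroup φ univ (1 / 16) (1 - 1 / 16) :
    Set (Suspension.flowGroup φ)))

/-- The generator `f`, as an element of `G`. -/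
def twistGen {X : Type u} [TopologicalSpace X] (φ : X ≃ₜ X) (f : Suspension.flowGroup φ) :
    twistGroup φ f := ⟨f, Subgroup.subset_closure (Or.inl rfl)⟩

end

/-! Everything is read on the cover `X × ℝ`. An element of the group is represented by a family of
increasing homeomorphisms of the fibres, equivariant under `ℤ` (`liftGroup`). A minimal
homeomorphism of an infinite `T1` space has no periodic points, so `descendHom` is injective and
`groupEquiv` identifies `G` with a group of lifts. Each `x : X` then gives an action of `G` on the
line, and points of one `φ`-orbit give actions conjugate by an integer translation.

Germs at `z`. The limit homeomorphism fixes `0` and the chart group is trivial near the integers, so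
every element coincides near `z` with a power of `f` (`exists_zpow_near_base`). As `f` moves the
points just to the right of `0` in the base fibre, this power is unique; this gives the splitting
over the germ stabiliser.

Embedding in `F`. Away from the orbit of `(x₀, 0)` every element is locally independent of the
fibre, and an element trivial near `z` is so everywhere. A finite set of such elements fixes the
integers of a fibre that correspond to visits to a neighbourhood of `x₀`. By compactness finitely
many local patterns describe these elements, and by minimality all patterns occur along a bounded
interval of one fibre off the orbit of `x₀`. Restriction to that interval is faithful and lands in a
group of dyadic PL homeomorphisms, hence in `F` (`exists_injective_of_fixesGerm`). Amenability
passes to subgroups, to directed unions and to extensions by a cyclic group, while `G` contains a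
copy of `F`; this gives the equivalence.

Non-smoothness. On a fibre off the orbit of `x₀` the twist has no fixed points in the translates of
`I`, so orbits cross from each translate of `J` to the next and the action is minimal
(`reaches_of_generic`). The translates of `J` are the components of the set of points moved by the
chart group, so a conjugacy permutes them by a shift and preserves the numbers of iterations of `f`
which suffice to cross from one to the next. Prescribing such a number at every place is a closed
condition on the fibre, with empty interior because crossing is impossible at the base point, whose
orbit is dense. Hence conjugacy classes are meagre (`isMeagre_conj`). Since a minimal homeomorphism
is generically ergodic, a Borel invariant would be constant on a comeagre set, which would then lie
in a single class (`IsMinimalHomeo.not_isSmoothRel`).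

Finite generation reduces to that of `F`. It is proved on the line, for the dyadic PL homeomorphisms
that are integer translations near `±∞`: subdivide until all cells are standard, then merge pairs of
sibling dyadic intervals one at a time (`IsExpansion.mem_lineGroup`). The coordinate `coordFun`
transports the result to `(0, 1)`. -/

/-! ## Means on bounded functions -/

/-- Bounded real functions. -/
def IsBddFun {α : Type*} (u : α → ℝ) : Prop := ∃ C, ∀ x, |u x| ≤ C

/-- A functional on real functions which restricts to a mean on the bounded ones. -/
structure IsMean {α : Type*} (m : (α → ℝ) → ℝ) : Prop where
  add : ∀ u v, IsBddFun u → IsBddFun v → m (fun x => u x + v x) = m u + m v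
  smul : ∀ (c : ℝ) u, IsBddFun u → m (fun x => c * u x) = c * m u
  nonneg : ∀ u, IsBddFun u → (∀ x, 0 ≤ u x) → 0 ≤ m u
  one : m (fun _ => 1) = 1

theorem IsBddFun.comp {α β : Type*} {u : β → ℝ} (h : IsBddFun u) (p : α → β) :
    IsBddFun (fun x => u (p x)) := by
  obtain ⟨C, hC⟩ := h
  exact ⟨C, fun x => hC _⟩

theorem isBddFun_const {α : Type*} (c : ℝ) : IsBddFun (fun _ : α => c) := ⟨|c|, fun _ => le_rfl⟩

theorem IsBddFun.add {α : Type*} {u v : α → ℝ} (hu : IsBddFun u) (hv : IsBddFun v) :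
    IsBddFun (fun x => u x + v x) := by
  obtain ⟨C, hC⟩ := hu
  obtain ⟨D, hD⟩ := hv
  exact ⟨C + D, fun x => (abs_add_le _ _).trans (add_le_add (hC x) (hD x))⟩

theorem IsBddFun.smul {α : Type*} {u : α → ℝ} (c : ℝ) (hu : IsBddFun u) :
    IsBddFun (fun x => c * u x) := by
  obtain ⟨C, hC⟩ := hu
  exact ⟨|c| * C, fun x => by rw [abs_mul]; exact mul_le_mul_of_nonneg_left (hC x) (abs_nonneg _)⟩

namespace IsMean

variable {α β : Type*} {m : (α → ℝ) → ℝ}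

theorem const (hm : IsMean m) (c : ℝ) : m (fun _ => c) = c := by
  have := hm.smul c (fun _ => 1) (isBddFun_const 1)
  simpa [hm.one] using this

theorem mono (hm : IsMean m) {u v : α → ℝ} (hu : IsBddFun u) (hv : IsBddFun v)
    (h : ∀ x, u x ≤ v x) : m u ≤ m v := by
  have h1 := hm.nonneg (fun x => v x + (-1) * u x) (hv.add (hu.smul _))
    (fun x => by linarith [h x])
  rw [hm.add _ _ hv (hu.smul _), hm.smul _ _ hu] at h1
  linarith

theorem abs_le (hm : IsMean m) {u : α → ℝ} {C : ℝ} (hu : ∀ x, |u x| ≤ C) : |m u| ≤ C := by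
  have hb : IsBddFun u := ⟨C, hu⟩
  rw [_root_.abs_le]
  constructor
  · rw [← hm.const (-C)]
    exact hm.mono (isBddFun_const _) hb fun x => (_root_.abs_le.1 (hu x)).1
  · rw [← hm.const C]
    exact hm.mono hb (isBddFun_const _) fun x => (_root_.abs_le.1 (hu x)).2

theorem map (hm : IsMean m) (p : α → β) : IsMean (fun u : β → ℝ => m (fun x => u (p x))) where
  add u v hu hv := hm.add _ _ (hu.comp p) (hv.comp p)
  smul c u hu := hm.smul c _ (hu.comp p)
  nonneg u hu h := hm.nonneg _ (hu.comp p) fun x => h _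
  one := hm.one

theorem isBddFun_apply {k : α → (β → ℝ) → ℝ} (hk : ∀ a, IsMean (k a)) {u : β → ℝ}
    (hu : IsBddFun u) : IsBddFun (fun a => k a u) := by
  obtain ⟨C, hC⟩ := hu
  exact ⟨C, fun a => (hk a).abs_le hC⟩

theorem bind (hm : IsMean m) {k : α → (β → ℝ) → ℝ} (hk : ∀ a, IsMean (k a)) :
    IsMean (fun u : β → ℝ => m (fun a => k a u)) where
  add u v hu hv := by
    simp only [fun a => (hk a).add u v hu hv]
    exact hm.add _ _ (isBddFun_apply hk hu) (isBddFun_apply hk hv)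
  smul c u hu := by
    simp only [fun a => (hk a).smul c u hu]
    exact hm.smul _ _ (isBddFun_apply hk hu)
  nonneg u hu h := hm.nonneg _ (isBddFun_apply hk hu) fun a => (hk a).nonneg u hu h
  one := by simp only [fun a => (hk a).one, hm.one]

end IsMean

theorem tendsto_ultrafilter_limUnder {α : Type*} (U : Ultrafilter α) {u : α → ℝ}
    (hu : IsBddFun u) : Tendsto u U (𝓝 (limUnder (U : Filter α) u)) := by
  obtain ⟨C, hC⟩ := hu
  have hcomp : IsCompact (Icc (-C) C) := isCompact_Icc
  obtain ⟨L, -, hL⟩ := hcomp.ultrafilter_le_nhds (U.map u) (by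
    rw [le_principal_iff]
    exact univ_mem' (f := (U : Filter α)) fun x => _root_.abs_le.1 (hC x))
  exact tendsto_nhds_limUnder ⟨L, hL⟩

theorem isMean_ultrafilter {α : Type*} (U : Ultrafilter α) :
    IsMean (fun u : α → ℝ => limUnder (U : Filter α) u) where
  add u v hu hv := ((tendsto_ultrafilter_limUnder U hu).add
    (tendsto_ultrafilter_limUnder U hv)).limUnder_eq
  smul c u hu := ((tendsto_ultrafilter_limUnder U hu).const_mul c).limUnder_eq
  nonneg u hu h := ge_of_tendsto' (tendsto_ultrafilter_limUnder U hu) h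
  one := tendsto_const_nhds.limUnder_eq

/-- Existence of an invariant mean on bounded functions. -/
def HasInvariantMean (G : Type*) [Group G] : Prop :=
  ∃ m : (G → ℝ) → ℝ, IsMean m ∧ ∀ (g : G) u, IsBddFun u → m (fun x => u (g * x)) = m u

theorem memlp_top_iff_isBddFun {α : Type*} {u : α → ℝ} :
    Memℓp (E := fun _ : α => ℝ) u ⊤ ↔ IsBddFun u := by
  rw [memℓp_infty_iff]
  constructor
  · rintro ⟨C, hC⟩
    exact ⟨C, fun x => hC ⟨x, rfl⟩⟩
  · rintro ⟨C, hC⟩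
    exact ⟨C, by rintro _ ⟨x, rfl⟩; exact hC x⟩

/-- Functionals on all real functions, constrained only on the bounded ones, can be pushed forward
and composed without carrying proofs of boundedness. -/
theorem isAmenable_iff_hasInvariantMean (G : Type u) [Group G] :
    IsAmenable G ↔ HasInvariantMean G := by
  classical
  constructor
  · rintro ⟨M, hpos, hone, hinv⟩
    have key : ∀ u : G → ℝ, IsBddFun u → ∃ v : lp (fun _ : G => ℝ) ⊤, ⇑v = u :=
      fun u hu => ⟨⟨u, memlp_top_iff_isBddFun.2 hu⟩, rfl⟩
    -- The value `0` on unbounded functions is a mere default.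
    let m : (G → ℝ) → ℝ := fun u =>
      if h : Memℓp (E := fun _ : G => ℝ) u ⊤ then M ⟨u, h⟩ else 0
    have hm : ∀ v : lp (fun _ : G => ℝ) ⊤, m ⇑v = M v := fun v => dif_pos v.2
    refine ⟨m, ⟨?_, ?_, ?_, ?_⟩, ?_⟩
    · intro u v hu hv
      obtain ⟨u, rfl⟩ := key u hu
      obtain ⟨v, rfl⟩ := key v hv
      rw [hm, hm, ← map_add, ← hm]
      rfl
    · intro c u hu
      obtain ⟨u, rfl⟩ := key u hu
      rw [hm, ← smul_eq_mul, ← map_smul, ← hm]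
      rfl
    · intro u hu h
      obtain ⟨u, rfl⟩ := key u hu
      rw [hm]
      exact hpos u h
    · obtain ⟨v, hv⟩ := key _ (isBddFun_const (α := G) 1)
      rw [← hv, hm]
      exact hone v fun x => congrFun hv x
    · intro g u hu
      obtain ⟨v, hv⟩ := key _ (hu.comp (g * ·))
      obtain ⟨u, rfl⟩ := key u hu
      rw [← hv, hm, hm]
      exact hinv g⁻¹ _ _ fun x => by simpa using congrFun hv x
  · rintro ⟨m, hm, hinv⟩
    have key : ∀ v : lp (fun _ : G => ℝ) ⊤, IsBddFun ⇑v :=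
      fun v => memlp_top_iff_isBddFun.1 v.2
    refine ⟨{ toFun := fun v => m ⇑v, map_add' := fun u v => hm.add _ _ (key u) (key v),
              map_smul' := fun c u => hm.smul c _ (key u) }, fun v hv => hm.nonneg _ (key v) hv,
            fun v hv => ?_, fun g v w h => ?_⟩
    · change m ⇑v = 1
      rw [show ⇑v = fun _ => (1 : ℝ) from funext hv, hm.one]
    · change m ⇑w = m ⇑v
      rw [show ⇑w = fun x => v (g⁻¹ * x) from funext h]
      exact hinv g⁻¹ _ (key v)

/-! ### Permanence properties of amenability -/

namespace HasInvariantMean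

/-- A choice of representatives of the right cosets of `H` gives an `H`-equivariant map `p : G → H`,
along which the mean is pushed forward. -/
theorem of_injective {H G : Type*} [Group H] [Group G] (i : H →* G)
    (hi : Function.Injective i) (hG : HasInvariantMean G) : HasInvariantMean H := by
  obtain ⟨m, hm, hinv⟩ := hG
  let r : G → G := fun g => (Quotient.mk (QuotientGroup.rightRel i.range) g).out
  have hr : ∀ g, ∃ h, i h = g * (r g)⁻¹ := fun g => by
    have h : (QuotientGroup.rightRel i.range) (r g) g := Quotient.mk_out g
    rw [QuotientGroup.rightRel_apply] at h
    exact h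
  choose p hp using hr
  have hmul : ∀ h g, p (i h * g) = h * p g := fun h g => by
    apply hi
    have : r (i h * g) = r g := by
      refine congrArg Quotient.out (Quotient.sound ?_)
      change (QuotientGroup.rightRel i.range) _ _
      rw [QuotientGroup.rightRel_apply]
      refine ⟨h⁻¹, ?_⟩
      simp
    rw [hp, map_mul, hp, this, mul_assoc]
  refine ⟨_, hm.map p, fun h u hu => ?_⟩
  simp only [← hmul]
  exact hinv (i h) (fun x => u (p x)) (hu.comp p)

/-- The means of the subgroups generated by finite sets converge along an ultrafilter finer than
`atTop`; a given element lies in eventually all of these subgroups. -/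
theorem of_fg {G : Type*} [Group G] (h : ∀ K : Subgroup G, K.FG → HasInvariantMean K) :
    HasInvariantMean G := by
  classical
  choose k hk hinv using fun S : Finset G => h (Subgroup.closure (S : Set G)) ⟨S, rfl⟩
  let U : Ultrafilter (Finset G) := Ultrafilter.of atTop
  have hU : (U : Filter (Finset G)) ≤ atTop := Ultrafilter.of_le _
  refine ⟨_, (isMean_ultrafilter U).bind (fun S => (hk S).map Subtype.val), fun g u hu => ?_⟩
  have hev : (fun S => k S fun x => u (g * x)) =ᶠ[(U : Filter (Finset G))]
      fun S => k S fun x => u x := by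
    filter_upwards [hU (eventually_ge_atTop {g})] with S hS
    have hg : g ∈ Subgroup.closure (S : Set G) := Subgroup.subset_closure (hS (by simp))
    exact hinv S ⟨g, hg⟩ (fun x => u x) (hu.comp _)
  simp only [limUnder, map_congr hev]

end HasInvariantMean

/-- Averages over `{0, …, n}` change under a unit translation only by the boundary term `(u (n + 1)
- u 0) / (n + 1)`, which vanishes in the limit. -/
theorem exists_invariant_mean_int : ∃ m : (ℤ → ℝ) → ℝ, IsMean m ∧
    ∀ (j : ℤ) u, IsBddFun u → m (fun x => u (j + x)) = m u := by
  let U : Ultrafilter ℕ := hyperfilter ℕ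
  have hU : (U : Filter ℕ) ≤ atTop := by
    rw [← Nat.cofinite_eq_atTop]
    exact hyperfilter_le_cofinite
  let k : ℕ → (ℤ → ℝ) → ℝ := fun n u => (n + 1 : ℝ)⁻¹ * ∑ i ∈ Finset.range (n + 1), u i
  have hk : ∀ n, IsMean (k n) := fun n =>
    { add := fun u v _ _ => by simp only [k, Finset.sum_add_distrib, mul_add]
      smul := fun c u _ => by simp only [k, ← Finset.mul_sum]; ring
      nonneg := fun u _ h => mul_nonneg (by positivity) (Finset.sum_nonneg fun i _ => h _)
      one := by
        have : (n + 1 : ℝ) ≠ 0 := by positivity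
        simp [k, this] }
  let m : (ℤ → ℝ) → ℝ := fun u => limUnder (U : Filter ℕ) fun n => k n u
  have hm : IsMean m := (isMean_ultrafilter U).bind hk
  have h1 : ∀ u, IsBddFun u → m (fun x => u (1 + x)) = m u := by
    intro u hu
    have hlim := tendsto_ultrafilter_limUnder U (IsMean.isBddFun_apply hk hu)
    obtain ⟨C, hC⟩ := hu
    have h0 : Tendsto (fun n : ℕ => (n + 1 : ℝ)⁻¹ * (u (n + 1) - u 0)) U (𝓝 0) := by
      refine Tendsto.mono_left ?_ hU
      have h2 : Tendsto (fun n : ℕ => (n + 1 : ℝ)⁻¹ * (C + C)) atTop (𝓝 0) := by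
        simpa using (tendsto_one_div_add_atTop_nhds_zero_nat (𝕜 := ℝ)).mul_const (C + C)
      refine squeeze_zero_norm (fun n => ?_) h2
      rw [norm_mul, Real.norm_of_nonneg (by positivity)]
      refine mul_le_mul_of_nonneg_left ?_ (by positivity)
      exact (norm_sub_le _ _).trans (add_le_add (hC _) (hC _))
    have h3 : ∀ n : ℕ, k n (fun x => u (1 + x)) = k n u + (n + 1 : ℝ)⁻¹ * (u (n + 1) - u 0) := by
      intro n
      simp only [k, ← mul_add]
      congr 1
      have e1 := Finset.sum_range_succ (fun i : ℕ => u i) (n + 1)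
      have e2 := Finset.sum_range_succ' (fun i : ℕ => u i) (n + 1)
      have e3 : ∀ i : ℕ, u (1 + (i : ℤ)) = u ((i + 1 : ℕ) : ℤ) := fun i => by
        push_cast; rw [add_comm]
      simp only [e3]
      push_cast at e1 e2 ⊢
      linarith
    have := (hlim.add h0).limUnder_eq
    simp only [← h3, add_zero] at this
    exact this
  clear_value m
  have hnat : ∀ (n : ℕ) u, IsBddFun u → m (fun x => u (n + x)) = m u := by
    intro n
    induction n with
    | zero => intro u _; simp
    | succ n ih =>
      intro u hu
      rw [← ih u hu, ← h1 (fun x => u (n + x)) (hu.comp _)]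
      congr 1
      funext x
      push_cast
      rw [add_assoc]
  refine ⟨m, hm, fun j u hu => ?_⟩
  obtain ⟨n, rfl | rfl⟩ := j.eq_nat_or_neg
  · exact hnat n u hu
  · rw [← hnat n (fun x => u (-n + x)) (hu.comp _)]
    simp

/-- The mean averages first over each coset `f ^ k * N`, then over `k`. -/
theorem HasInvariantMean.of_cyclic_extension {G : Type*} [Group G] (N : Subgroup G) [N.Normal]
    (f : G) (hf : ∀ g, ∃ k : ℤ, ∃ n ∈ N, g = f ^ k * n) (hN : HasInvariantMean N) :
    HasInvariantMean G := by
  obtain ⟨mZ, hZ, iZ⟩ := exists_invariant_mean_int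
  obtain ⟨mN, hmN, iN⟩ := hN
  have hk : ∀ k : ℤ, IsMean fun u : G → ℝ => mN fun n => u (f ^ k * n) := fun k =>
    hmN.map fun n : N => f ^ k * n
  refine ⟨_, hZ.bind hk, fun g u hu => ?_⟩
  obtain ⟨j, n₀, hn₀, rfl⟩ := hf g
  -- Normality moves `n₀` across `f ^ k`, where the invariance of the mean on `N` absorbs it.
  have e1 : ∀ v : G → ℝ, IsBddFun v → ∀ k : ℤ,
      mN (fun n => v (n₀ * (f ^ k * n))) = mN fun n => v (f ^ k * n) := by
    intro v hv k
    have hmem : (f ^ k)⁻¹ * n₀ * f ^ k ∈ N := by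
      simpa using ‹N.Normal›.conj_mem n₀ hn₀ (f ^ k)⁻¹
    have := iN ⟨_, hmem⟩ (fun n => v (f ^ k * n)) (hv.comp _)
    rw [← this]
    congr 1
    funext n
    simp [mul_assoc]
  have e2 := fun k => e1 (fun x => u (f ^ j * x)) (hu.comp _) k
  simp only [mul_assoc]
  simp only [e2]
  have := iZ j (fun k => mN fun n => u (f ^ k * n)) (IsMean.isBddFun_apply hk hu)
  rw [← this]
  simp only [zpow_add, mul_assoc]

/-! ## Piecewise linear dyadic homeomorphisms of the line -/

/-- Along the filter `l`, the function `u` is of the form `y ↦ 2 ^ k * y + c` with `c` dyadic. -/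
def DyAff (u : ℝ → ℝ) (l : Filter ℝ) : Prop :=
  ∃ k : ℤ, ∃ c ∈ dyadicRing, ∀ᶠ y in l, u y = 2 ^ k * y + c

theorem DyAff.mono {u : ℝ → ℝ} {l l' : Filter ℝ} (h : DyAff u l) (hl : l' ≤ l) : DyAff u l' := by
  obtain ⟨k, c, hc, h⟩ := h
  exact ⟨k, c, hc, h.filter_mono hl⟩

theorem DyAff.congr {u v : ℝ → ℝ} {l : Filter ℝ} (h : DyAff u l) (huv : u =ᶠ[l] v) :
    DyAff v l := by
  obtain ⟨k, c, hc, h⟩ := h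
  refine ⟨k, c, hc, ?_⟩
  filter_upwards [h, huv] with y h1 h2
  rw [← h2, h1]

theorem dyAff_id (l : Filter ℝ) : DyAff (fun y => y) l :=
  ⟨0, 0, zero_mem _, Eventually.of_forall fun y => by simp⟩

theorem DyAff.comp {u v : ℝ → ℝ} {l l' : Filter ℝ} (hv : DyAff v l') (hu : DyAff u l)
    (h : Tendsto u l l') : DyAff (fun y => v (u y)) l := by
  obtain ⟨k, c, hc, hk⟩ := hu
  obtain ⟨m, d, hd, hm⟩ := hv
  refine ⟨m + k, 2 ^ m * c + d, add_mem (mul_mem (two_zpow_mem_dyadicRing _) hc) hd, ?_⟩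
  filter_upwards [hk, h.eventually hm] with y h1 h2
  rw [h2, h1, zpow_add₀ two_ne_zero]
  ring

/-- Left division. It treats inverses, where `v ∘ u` is the identity, and maps expressed through a
PL coordinate. -/
theorem DyAff.cancel {u v : ℝ → ℝ} {l l' : Filter ℝ} (hvu : DyAff (fun y => v (u y)) l)
    (hv : DyAff v l') (h : Tendsto u l l') : DyAff u l := by
  obtain ⟨k, c, hc, hk⟩ := hvu
  obtain ⟨m, d, hd, hm⟩ := hv
  refine ⟨-m + k, 2 ^ (-m) * (c - d),
    mul_mem (two_zpow_mem_dyadicRing _) (sub_mem hc hd), ?_⟩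
  filter_upwards [hk, h.eventually hm] with y h1 h2
  rw [h2] at h1
  rw [zpow_add₀ two_ne_zero, zpow_neg]
  field_simp
  linarith

theorem mem_dyadicRing_affine_iff {k : ℤ} {c t : ℝ} (hc : c ∈ dyadicRing) :
    2 ^ k * t + c ∈ dyadicRing ↔ t ∈ dyadicRing := by
  constructor
  · intro h
    have h1 : t = 2 ^ (-k) * ((2 ^ k * t + c) - c) := by
      rw [zpow_neg]
      field_simp
      ring
    rw [h1]
    exact mul_mem (two_zpow_mem_dyadicRing _) (sub_mem h hc)
  · intro h
    exact add_mem (mul_mem (two_zpow_mem_dyadicRing _) h) hc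

theorem DyAff.apply_mem_iff {u : ℝ → ℝ} {t : ℝ} {l : Filter ℝ} (h : DyAff u l) (ht : pure t ≤ l) :
    u t ∈ dyadicRing ↔ t ∈ dyadicRing := by
  obtain ⟨k, c, hc, hk⟩ := h
  have : u t = 2 ^ k * t + c := ht hk
  rw [this, mem_dyadicRing_affine_iff hc]

/-- The function `u` is piecewise linear dyadic around `t`. -/
structure LocPL (u : ℝ → ℝ) (t : ℝ) : Prop where
  right : DyAff u (𝓝[≥] t)
  left : DyAff u (𝓝[≤] t)
  -- Breakpoints are allowed at dyadic points only.
  full : t ∉ dyadicRing → DyAff u (𝓝 t)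

theorem DyAff.locPL {u : ℝ → ℝ} {t : ℝ} (h : DyAff u (𝓝 t)) : LocPL u t :=
  ⟨h.mono nhdsWithin_le_nhds, h.mono nhdsWithin_le_nhds, fun _ => h⟩

theorem LocPL.congr {u v : ℝ → ℝ} {t : ℝ} (h : LocPL u t) (huv : u =ᶠ[𝓝 t] v) : LocPL v t :=
  ⟨h.right.congr (huv.filter_mono nhdsWithin_le_nhds),
    h.left.congr (huv.filter_mono nhdsWithin_le_nhds), fun ht => (h.full ht).congr huv⟩

theorem LocPL.apply_mem_iff {u : ℝ → ℝ} {t : ℝ} (h : LocPL u t) :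
    u t ∈ dyadicRing ↔ t ∈ dyadicRing :=
  h.right.apply_mem_iff (pure_le_nhdsWithin self_mem_Ici)

theorem tendsto_nhdsGE_of_monotone {u : ℝ → ℝ} {t : ℝ} (hm : Monotone u)
    (hc : ContinuousAt u t) : Tendsto u (𝓝[≥] t) (𝓝[≥] (u t)) :=
  tendsto_nhdsWithin_of_tendsto_nhds_of_eventually_within _ (hc.mono_left nhdsWithin_le_nhds)
    (by filter_upwards [self_mem_nhdsWithin] with y hy using hm hy)

theorem tendsto_nhdsLE_of_monotone {u : ℝ → ℝ} {t : ℝ} (hm : Monotone u)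
    (hc : ContinuousAt u t) : Tendsto u (𝓝[≤] t) (𝓝[≤] (u t)) :=
  tendsto_nhdsWithin_of_tendsto_nhds_of_eventually_within _ (hc.mono_left nhdsWithin_le_nhds)
    (by filter_upwards [self_mem_nhdsWithin] with y hy using hm hy)

theorem LocPL.comp {u v : ℝ → ℝ} {t : ℝ} (hv : LocPL v (u t)) (hu : LocPL u t)
    (hm : Monotone u) (hc : ContinuousAt u t) : LocPL (fun y => v (u y)) t :=
  ⟨hv.right.comp hu.right (tendsto_nhdsGE_of_monotone hm hc),
    hv.left.comp hu.left (tendsto_nhdsLE_of_monotone hm hc),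
    fun ht => (hv.full (hu.apply_mem_iff.not.2 ht)).comp (hu.full ht) hc⟩

theorem LocPL.cancel {u v : ℝ → ℝ} {t : ℝ} (hvu : LocPL (fun y => v (u y)) t)
    (hv : LocPL v (u t)) (hm : Monotone u) (hc : ContinuousAt u t) : LocPL u t :=
  ⟨hvu.right.cancel hv.right (tendsto_nhdsGE_of_monotone hm hc),
    hvu.left.cancel hv.left (tendsto_nhdsLE_of_monotone hm hc),
    fun ht => (hvu.full ht).cancel
      (hv.full fun h => ht (hvu.apply_mem_iff.1 (hv.apply_mem_iff.2 h))) hc⟩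

theorem LocPL.ite {u v : ℝ → ℝ} {p t : ℝ} (hp : p ∈ dyadicRing) (huv : u p = v p)
    (hu : t ≤ p → LocPL u t) (hv : p ≤ t → LocPL v t) :
    LocPL (fun y => if y ≤ p then u y else v y) t := by
  rcases lt_trichotomy t p with h | h | h
  · refine (hu h.le).congr ?_
    filter_upwards [eventually_lt_nhds h] with y hy
    rw [if_pos hy.le]
  · subst h
    refine ⟨(hv le_rfl).right.congr ?_, (hu le_rfl).left.congr ?_, fun h => absurd hp h⟩
    · filter_upwards [self_mem_nhdsWithin] with y hy
      by_cases h : y ≤ t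
      · rw [if_pos h, le_antisymm h hy, huv]
      · rw [if_neg h]
    · filter_upwards [self_mem_nhdsWithin] with y hy
      rw [if_pos (show y ≤ t from hy)]
  · refine (hv h.le).congr ?_
    filter_upwards [eventually_gt_nhds h] with y hy
    rw [if_neg hy.not_ge]

/-- The group of piecewise linear dyadic homeomorphisms of the line, with a possibly infinite but
discrete set of breakpoints. -/
def PLR : Subgroup (ℝ ≃o ℝ) where
  carrier := {u | ∀ t, LocPL u t}
  one_mem' t := (dyAff_id (𝓝 t)).locPL
  mul_mem' {u v} hu hv t := (hu (v t)).comp (hv t) v.monotone v.continuous.continuousAt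
  inv_mem' {u} hu t := by
    refine LocPL.cancel (v := u) ?_ (hu _) u.symm.monotone u.symm.continuous.continuousAt
    have : (fun y => u (u⁻¹ y)) = fun y => y := funext fun y => u.apply_symm_apply y
    change LocPL (fun y => u (u⁻¹ y)) t
    rw [this]
    exact (dyAff_id (𝓝 t)).locPL

/-- The increasing affine map `t ↦ 2 ^ k * t + c`. -/
noncomputable def affIso (k : ℤ) (c : ℝ) : ℝ ≃o ℝ :=
  StrictMono.orderIsoOfSurjective (fun t : ℝ => 2 ^ k * t + c)
    (fun s t h => by
      have : (0 : ℝ) < 2 ^ k := by positivity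
      simp only
      nlinarith)
    (fun s => ⟨(s - c) / 2 ^ k, by field_simp; ring⟩)

theorem affIso_apply (k : ℤ) (c t : ℝ) : affIso k c t = 2 ^ k * t + c := rfl

theorem affIso_mem {k : ℤ} {c : ℝ} (hc : c ∈ dyadicRing) : affIso k c ∈ PLR :=
  fun _ => DyAff.locPL ⟨k, c, hc, Eventually.of_forall fun _ => rfl⟩

/-- Gluing of two increasing homeomorphisms which agree at a point. -/
noncomputable def glueIso (p : ℝ) (u v : ℝ ≃o ℝ) (h : u p = v p) : ℝ ≃o ℝ :=
  StrictMono.orderIsoOfSurjective (fun t : ℝ => if t ≤ p then u t else v t)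
    (fun s t hst => by
      simp only
      split_ifs with h1 h2 h2
      · exact u.strictMono hst
      · exact (u.monotone h1).trans_lt (h.trans_lt (v.strictMono (not_le.1 h2)))
      · exact absurd (hst.le.trans h2) h1
      · exact v.strictMono hst)
    (fun s => by
      rcases le_or_gt s (u p) with hs | hs
      · refine ⟨u.symm s, ?_⟩
        simp only
        rw [if_pos, u.apply_symm_apply]
        rwa [← u.le_iff_le, u.apply_symm_apply]
      · refine ⟨v.symm s, ?_⟩
        simp only
        rw [if_neg, v.apply_symm_apply]
        rw [not_le, ← v.lt_iff_lt, v.apply_symm_apply, ← h]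
        exact hs)

theorem glueIso_of_le {p t : ℝ} {u v : ℝ ≃o ℝ} (h : u p = v p) (ht : t ≤ p) :
    glueIso p u v h t = u t := if_pos ht

theorem glueIso_of_ge {p t : ℝ} {u v : ℝ ≃o ℝ} (h : u p = v p) (ht : p ≤ t) :
    glueIso p u v h t = v t := by
  rcases ht.eq_or_lt with rfl | ht
  · rw [glueIso_of_le h le_rfl, h]
  · exact if_neg ht.not_ge

theorem glueIso_mem {p : ℝ} {u v : ℝ ≃o ℝ} (h : u p = v p) (hp : p ∈ dyadicRing) (hu : u ∈ PLR)
    (hv : v ∈ PLR) : glueIso p u v h ∈ PLR :=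
  fun t => LocPL.ite hp h (fun _ => hu t) (fun _ => hv t)

/-! ### Homeomorphisms supported in an interval -/

/-- The subgroup of the increasing homeomorphisms of the line supported in `(a, b)`. -/
def suppIn (a b : ℝ) : Subgroup (ℝ ≃o ℝ) where
  carrier := {u | ∀ t, t ∉ Ioo a b → u t = t}
  one_mem' _ _ := rfl
  mul_mem' {u v} hu hv t ht := by
    change u (v t) = t
    rw [hv t ht, hu t ht]
  inv_mem' {u} hu t ht := by
    change u.symm t = t
    rw [OrderIso.symm_apply_eq, hu t ht]

theorem suppIn_apply_mem {a b : ℝ} {u : ℝ ≃o ℝ} (hu : u ∈ suppIn a b) {t : ℝ} :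
    u t ∈ Ioo a b ↔ t ∈ Ioo a b := by
  have ha : u a = a := hu a (by simp)
  have hb : u b = b := hu b (by simp)
  constructor
  · rintro ⟨h1, h2⟩
    rw [← ha] at h1
    rw [← hb] at h2
    exact ⟨u.lt_iff_lt.1 h1, u.lt_iff_lt.1 h2⟩
  · rintro ⟨h1, h2⟩
    rw [← u.lt_iff_lt, ha] at h1
    rw [← u.lt_iff_lt, hb] at h2
    exact ⟨h1, h2⟩

/-- The group of piecewise linear dyadic homeomorphisms supported in `(a, b)`. -/
def PLS (a b : ℝ) : Subgroup (ℝ ≃o ℝ) := PLR ⊓ suppIn a b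

/-- Extension by the identity of an increasing self-homeomorphism of `(a, b)`. -/
noncomputable def extIso {a b : ℝ} (f : Ioo a b ≃ₜ Ioo a b) (hf : StrictMono f) : ℝ ≃o ℝ := by
  classical
  exact StrictMono.orderIsoOfSurjective (fun t : ℝ => if h : t ∈ Ioo a b then (f ⟨t, h⟩ : ℝ) else t)
    (fun s t hst => by
      simp only
      split_ifs with h1 h2 h2
      · exact hf (a := ⟨s, h1⟩) (b := ⟨t, h2⟩) hst
      · have := (f ⟨s, h1⟩).2
        simp only [mem_Ioo, not_and, not_lt] at h1 h2 this
        exact this.2.trans_le (h2 (h1.1.trans hst))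
      · have := (f ⟨t, h2⟩).2
        simp only [mem_Ioo, not_and, not_lt] at h1 h2 this
        by_contra hcon
        push Not at hcon
        exact absurd (h1 (this.1.trans_le hcon)) (by linarith)
      · exact hst)
    (fun s => by
      by_cases hs : s ∈ Ioo a b
      · refine ⟨f.symm ⟨s, hs⟩, ?_⟩
        simp
      · exact ⟨s, dif_neg hs⟩)

theorem extIso_of_mem {a b : ℝ} (f : Ioo a b ≃ₜ Ioo a b) (hf : StrictMono f) (t : Ioo a b) :
    extIso f hf t = f t := dif_pos t.2

theorem extIso_mem_suppIn {a b : ℝ} (f : Ioo a b ≃ₜ Ioo a b) (hf : StrictMono f) :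
    extIso f hf ∈ suppIn a b := fun _ ht => dif_neg ht

/-- A function which is locally dyadic affine on an interval is dyadic affine there. -/
theorem exists_affine_of_locally {v : ℝ → ℝ} {p q : ℝ} (hpq : p < q)
    (h : ∀ t ∈ Ioo p q, DyAff v (𝓝 t)) :
    ∃ k : ℤ, ∃ c ∈ dyadicRing, ∀ t ∈ Ioo p q, v t = 2 ^ k * t + c := by
  obtain ⟨x₀, hx₀⟩ := exists_between hpq
  obtain ⟨k, c, hc, h0⟩ := h x₀ hx₀
  refine ⟨k, c, hc, ?_⟩
  -- `A` and `B` collect the points with the affine germ `(k, c)` and with another one. Both are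
  -- open, they cover the interval, and they are disjoint since an affine germ determines its
  -- coefficients; connectedness concludes.
  let A : Set ℝ := {x | ∀ᶠ y in 𝓝 x, v y = 2 ^ k * y + c}
  let B : Set ℝ := {x | ∃ (l : ℤ) (d : ℝ), (l ≠ k ∨ d ≠ c) ∧ ∀ᶠ y in 𝓝 x, v y = 2 ^ l * y + d}
  have hA : IsOpen A := isOpen_setOfPred_eventually_nhds
  have hB : IsOpen B := by
    have : B = ⋃ (l : ℤ) (d : ℝ) (_ : l ≠ k ∨ d ≠ c),
      {x | ∀ᶠ y in 𝓝 x, v y = 2 ^ l * y + d} := by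
      ext x; simp [B]
    rw [this]
    exact isOpen_iUnion fun l => isOpen_iUnion fun d => isOpen_iUnion fun _ =>
      isOpen_setOfPred_eventually_nhds
  have hdisj : ∀ x, x ∈ A → x ∈ B → False := by
    rintro x hxA ⟨l, d, hne, hxB⟩
    have hx : ∀ᶠ y in 𝓝 x, (2 : ℝ) ^ k * y + c = 2 ^ l * y + d := by
      filter_upwards [hxA, hxB] with y h1 h2
      rw [← h1, ← h2]
    obtain ⟨y, hy, hlt⟩ := ((hx.filter_mono nhdsWithin_le_nhds).and
      (eventually_mem_nhdsWithin (a := x) (s := Ioi x))).exists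
    have hx0 := hx.self_of_nhds
    have hne' : y - x ≠ 0 := sub_ne_zero.2 (ne_of_gt hlt)
    have h1 : (2 : ℝ) ^ k = 2 ^ l := mul_right_cancel₀ hne' (by linarith)
    have h2 : k = l := zpow_right_injective₀ two_pos (by norm_num) h1
    rcases hne with h | h
    · exact h h2.symm
    · rw [h1] at hx0
      exact h (by linarith)
  have hsub : Ioo p q ⊆ A := by
    refine isPreconnected_Ioo.subset_left_of_subset_union hA hB
      (Set.disjoint_left.2 fun x h1 h2 => hdisj x h1 h2) ?_ ⟨x₀, hx₀, h0⟩
    intro x hx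
    obtain ⟨l, d, -, hl⟩ := h x hx
    by_cases e : l = k ∧ d = c
    · obtain ⟨rfl, rfl⟩ := e
      exact Or.inl hl
    · exact Or.inr ⟨l, d, by tauto, hl⟩
  exact fun t ht => (hsub ht).self_of_nhds

theorem dyAff_nhdsGE {v : ℝ → ℝ} {p q : ℝ} (hpq : p < q) (hv : Continuous v)
    (h : ∀ t ∈ Ioo p q, DyAff v (𝓝 t)) : DyAff v (𝓝[≥] p) := by
  obtain ⟨k, c, hc, hk⟩ := exists_affine_of_locally hpq h
  refine ⟨k, c, hc, ?_⟩
  have hp : p ∈ closure (Ioo p q) := by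
    rw [closure_Ioo hpq.ne]
    exact left_mem_Icc.2 hpq.le
  have hcl : IsClosed {t | v t = 2 ^ k * t + c} := isClosed_eq hv (by fun_prop)
  filter_upwards [Ico_mem_nhdsGE hpq] with y hy
  rcases hy.1.eq_or_lt with rfl | hy1
  · exact closure_minimal (fun t ht => hk t ht) hcl hp
  · exact hk y ⟨hy1, hy.2⟩

theorem dyAff_nhdsLE {v : ℝ → ℝ} {p q : ℝ} (hpq : p < q) (hv : Continuous v)
    (h : ∀ t ∈ Ioo p q, DyAff v (𝓝 t)) : DyAff v (𝓝[≤] q) := by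
  obtain ⟨k, c, hc, hk⟩ := exists_affine_of_locally hpq h
  refine ⟨k, c, hc, ?_⟩
  have hp : q ∈ closure (Ioo p q) := by
    rw [closure_Ioo hpq.ne]
    exact right_mem_Icc.2 hpq.le
  have hcl : IsClosed {t | v t = 2 ^ k * t + c} := isClosed_eq hv (by fun_prop)
  filter_upwards [Ioc_mem_nhdsLE hpq] with y hy
  rcases hy.2.eq_or_lt with rfl | hy1
  · exact closure_minimal (fun t ht => hk t ht) hcl hp
  · exact hk y ⟨hy.1, hy1⟩

theorem map_val_nhds {a b : ℝ} (x : Ioo a b) : map Subtype.val (𝓝 x) = 𝓝 (x : ℝ) :=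
  isOpen_Ioo.isOpenEmbedding_subtypeVal.map_nhds_eq x

theorem infinite_Ioo_subtype {a b : ℝ} (hab : a < b) : Infinite (Ioo a b) :=
  (Ioo_infinite hab).to_subtype

/-- A homeomorphism of an interval is monotone, and a decreasing one cannot have the positive slope
`2 ^ k` at a point off the breakpoints. -/
theorem IsPLDyadic.strictMono {a b : ℝ} {f : Ioo a b ≃ₜ Ioo a b} (hf : IsPLDyadic f) :
    StrictMono f := by
  rcases lt_or_ge a b with hab | hab
  swap
  · intro s
    exact absurd (s.2.1.trans s.2.2) hab.not_gt
  have := infinite_Ioo_subtype hab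
  obtain ⟨S, -, hS⟩ := hf
  obtain ⟨x, hx⟩ := Infinite.exists_notMem_finset S
  have : Inhabited (Ioo a b) := ⟨x⟩
  rcases f.continuous.strictMono_of_inj f.injective with h | h
  · exact h
  exfalso
  obtain ⟨k, c, -, hk⟩ := hS x hx
  have hx0 := hk.self_of_nhds
  have hev : ∀ᶠ y in 𝓝 (x : ℝ), ∃ h : y ∈ Ioo a b, (f ⟨y, h⟩ : ℝ) = 2 ^ k * y + c := by
    rw [← map_val_nhds, eventually_map]
    filter_upwards [hk] with y hy using ⟨y.2, hy⟩
  obtain ⟨y, ⟨hy, hy'⟩, hlt⟩ := ((hev.filter_mono nhdsWithin_le_nhds).and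
      (eventually_mem_nhdsWithin (a := (x : ℝ)) (s := Ioi (x : ℝ)))).exists
  have h1 : (f ⟨y, hy⟩ : ℝ) < f x := h (a := x) (b := ⟨y, hy⟩) hlt
  have : (0 : ℝ) < 2 ^ k := by positivity
  rw [hy', hx0] at h1
  have hlt' : (x : ℝ) < y := hlt
  nlinarith

theorem extIso_mem_PLR {a b : ℝ} (ha : a ∈ dyadicRing) (hb : b ∈ dyadicRing)
    {f : Ioo a b ≃ₜ Ioo a b} (hf : IsPLDyadic f) : extIso f hf.strictMono ∈ PLR := by
  intro t
  set u := extIso f hf.strictMono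
  obtain ⟨S, hS, h⟩ := hf
  -- The extension may break at the endpoints as well, which is why they have to be dyadic.
  let T : Set ℝ := Subtype.val '' (S : Set (Ioo a b)) ∪ {a, b}
  have hTf : T.Finite := (S.finite_toSet.image _).union (by simp)
  have hTd : ∀ x ∈ T, x ∈ dyadicRing := by
    rintro _ (⟨x, hx, rfl⟩ | rfl | rfl)
    exacts [hS x hx, ha, hb]
  have hloc : ∀ x, x ∉ T → DyAff u (𝓝 x) := by
    intro x hx
    by_cases hxI : x ∈ Ioo a b
    · have hxS : (⟨x, hxI⟩ : Ioo a b) ∉ S := fun h' => hx (Or.inl ⟨_, h', rfl⟩)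
      obtain ⟨k, c, hc, hk⟩ := h _ hxS
      refine ⟨k, c, hc, ?_⟩
      have := map_val_nhds ⟨x, hxI⟩
      simp only at this
      rw [← this, eventually_map]
      filter_upwards [hk] with y hy
      rw [extIso_of_mem, hy]
    · have hxc : x ∉ Icc a b := by
        intro hc
        rcases eq_endpoints_or_mem_Ioo_of_mem_Icc hc with h | h | h
        · exact hx (Or.inr (Or.inl h))
        · exact hx (Or.inr (Or.inr h))
        · exact hxI h
      refine (dyAff_id _).congr ?_
      filter_upwards [isClosed_Icc.isOpen_compl.mem_nhds hxc] with y hy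
      exact (extIso_mem_suppIn _ _ y fun h => hy (Ioo_subset_Icc_self h)).symm
  have hev : ∀ᶠ y in 𝓝 t, y ∉ T \ {t} :=
    (hTf.subset sdiff_subset).isClosed.isOpen_compl.mem_nhds (by simp)
  obtain ⟨p, q, ⟨hp, hq⟩, hsub⟩ := mem_nhds_iff_exists_Ioo_subset.1 hev
  have hcont : Continuous u := u.continuous
  refine ⟨dyAff_nhdsGE hq hcont fun x hx => hloc x fun hxT =>
      hsub ⟨hp.trans hx.1, hx.2⟩ ⟨hxT, hx.1.ne'⟩,
    dyAff_nhdsLE hp hcont fun x hx => hloc x fun hxT =>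
      hsub ⟨hx.1, hx.2.trans hq⟩ ⟨hxT, hx.2.ne⟩, fun ht => hloc t fun h => ht (hTd t h)⟩

/-- Restriction to `(a, b)` of a homeomorphism supported in `(a, b)`. -/
noncomputable def restrictIoo {a b : ℝ} (u : ℝ ≃o ℝ) (hu : u ∈ suppIn a b) :
    Ioo a b ≃ₜ Ioo a b :=
  u.toHomeomorph.subtype fun _ => (suppIn_apply_mem hu).symm

/-- The one-sided affine germs at a point leave no breakpoints in a punctured neighbourhood of it,
so the breakpoints in the compact interval `[a, b]` cannot accumulate and are finite in number. -/
theorem isPLDyadic_restrictIoo {a b : ℝ} (u : ℝ ≃o ℝ) (hu : u ∈ suppIn a b) (hP : u ∈ PLR) :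
    IsPLDyadic (restrictIoo u hu) := by
  let T : Set ℝ := {t ∈ Icc a b | ¬ DyAff u (𝓝 t)}
  have hTf : T.Finite := by
    by_contra hinf
    obtain ⟨t, -, ht⟩ := Set.Infinite.exists_accPt_of_subset_isCompact hinf isCompact_Icc
      (fun x hx => hx.1)
    rw [accPt_iff_frequently_nhdsNE] at ht
    apply ht
    have h1 := (hP t).right
    have h2 := (hP t).left
    obtain ⟨k, c, hc, h1⟩ := h1
    obtain ⟨l, d, hd, h2⟩ := h2
    have h1' : ∀ᶠ y in 𝓝[>] t, DyAff u (𝓝 y) := by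
      have := eventually_eventually_nhdsWithin.2 (h1.filter_mono (nhdsWithin_mono t Ioi_subset_Ici_self))
      filter_upwards [this, self_mem_nhdsWithin] with y hy hyt
      rw [IsOpen.nhdsWithin_eq isOpen_Ioi hyt] at hy
      exact ⟨k, c, hc, hy⟩
    have h2' : ∀ᶠ y in 𝓝[<] t, DyAff u (𝓝 y) := by
      have := eventually_eventually_nhdsWithin.2 (h2.filter_mono (nhdsWithin_mono t Iio_subset_Iic_self))
      filter_upwards [this, self_mem_nhdsWithin] with y hy hyt
      rw [IsOpen.nhdsWithin_eq isOpen_Iio hyt] at hy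
      exact ⟨l, d, hd, hy⟩
    have h3 : ∀ᶠ y in 𝓝[≠] t, DyAff u (𝓝 y) := by
      rw [← Iio_union_Ioi, nhdsWithin_union]
      exact eventually_sup.2 ⟨h2', h1'⟩
    filter_upwards [h3] with y hy hyT
    exact hyT.2 hy
  have hpre : (Subtype.val ⁻¹' T : Set (Ioo a b)).Finite :=
    hTf.preimage Subtype.val_injective.injOn
  refine ⟨hpre.toFinset, fun s hs => ?_, fun x hx => ?_⟩
  · by_contra hcon
    exact (hpre.mem_toFinset.1 hs).2 ((hP s).full hcon)
  · have : DyAff u (𝓝 (x : ℝ)) := by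
      by_contra hcon
      exact hx (hpre.mem_toFinset.2 ⟨Ioo_subset_Icc_self x.2, hcon⟩)
    obtain ⟨k, c, hc, hk⟩ := this
    exact ⟨k, c, hc, continuous_subtype_val.continuousAt.eventually hk⟩

/-- Extension by the identity identifies `PLDyadic a b` with `PLS a b`. -/
noncomputable def extEquiv {a b : ℝ} (ha : a ∈ dyadicRing) (hb : b ∈ dyadicRing) :
    PLDyadic a b ≃* PLS a b where
  toFun f := ⟨extIso f.1 (IsPLDyadic.strictMono f.2), extIso_mem_PLR ha hb f.2,
    extIso_mem_suppIn _ _⟩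
  invFun u := ⟨restrictIoo u.1 u.2.2, isPLDyadic_restrictIoo _ _ u.2.1⟩
  left_inv f := by
    apply Subtype.ext
    ext t
    exact extIso_of_mem f.1 (IsPLDyadic.strictMono f.2) t
  right_inv u := by
    apply Subtype.ext
    ext t
    by_cases ht : t ∈ Ioo a b
    · exact extIso_of_mem (restrictIoo u.1 u.2.2)
        (IsPLDyadic.strictMono (isPLDyadic_restrictIoo _ u.2.2 u.2.1)) ⟨t, ht⟩
    · exact (extIso_mem_suppIn (restrictIoo u.1 u.2.2)
        (IsPLDyadic.strictMono (isPLDyadic_restrictIoo _ u.2.2 u.2.1)) t ht).trans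
        (u.2.2 t ht).symm
  map_mul' f g := by
    apply Subtype.ext
    ext t
    have hf := IsPLDyadic.strictMono f.2
    have hg := IsPLDyadic.strictMono g.2
    change extIso (f * g).1 (IsPLDyadic.strictMono (f * g).2) t =
      extIso f.1 hf (extIso g.1 hg t)
    by_cases ht : t ∈ Ioo a b
    · have h1 := extIso_of_mem g.1 (IsPLDyadic.strictMono g.2) ⟨t, ht⟩
      simp only at h1
      rw [h1, extIso_of_mem]
      exact extIso_of_mem _ _ ⟨t, ht⟩
    · rw [extIso_mem_suppIn _ (IsPLDyadic.strictMono g.2) t ht,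
        extIso_mem_suppIn _ _ t ht, extIso_mem_suppIn _ _ t ht]

theorem extEquiv_apply {a b : ℝ} (ha : a ∈ dyadicRing) (hb : b ∈ dyadicRing) (f : PLDyadic a b)
    (t : Ioo a b) : (extEquiv ha hb f).1 t = f.1 t :=
  extIso_of_mem f.1 (IsPLDyadic.strictMono f.2) t

/-! ### Conjugation and copies of Thompson's group on other intervals -/

theorem conj_mem_PLS {a b : ℝ} {w u : ℝ ≃o ℝ} (hw : w ∈ PLR) (hu : u ∈ PLS a b) :
    w * u * w⁻¹ ∈ PLS (w a) (w b) := by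
  refine Subgroup.mem_inf.2 ⟨mul_mem (mul_mem hw hu.1) (inv_mem hw), fun t ht => ?_⟩
  change w (u (w.symm t)) = t
  have : w.symm t ∉ Ioo a b := fun h => ht (by
    have h1 := w.strictMono h.1
    have h2 := w.strictMono h.2
    rw [w.apply_symm_apply] at h1 h2
    exact ⟨h1, h2⟩)
  rw [hu.2 _ this, w.apply_symm_apply]

/-- Conjugation by a piecewise linear dyadic homeomorphism. -/
noncomputable def conjEquiv (a b : ℝ) (w : ℝ ≃o ℝ) (hw : w ∈ PLR) :
    PLS a b ≃* PLS (w a) (w b) where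
  toFun u := ⟨w * u * w⁻¹, conj_mem_PLS hw u.2⟩
  invFun u := ⟨w⁻¹ * u * w, by
    have := conj_mem_PLS (inv_mem hw) u.2
    have e : ∀ t, w⁻¹ (w t) = t := fun t => w.symm_apply_apply t
    rwa [inv_inv, e, e] at this⟩
  left_inv u := Subtype.ext (by simp [mul_assoc])
  right_inv u := Subtype.ext (by simp [mul_assoc])
  map_mul' u v := Subtype.ext (by simp [mul_assoc])

theorem intCast_mem_dyadicRing (n : ℤ) : (n : ℝ) ∈ dyadicRing := intCast_mem _ n

theorem div_two_pow_mem_dyadicRing (m : ℤ) (n : ℕ) : (m : ℝ) / 2 ^ n ∈ dyadicRing := by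
  rw [div_eq_mul_inv, ← zpow_natCast, ← zpow_neg]
  exact mul_mem (intCast_mem_dyadicRing m) (two_zpow_mem_dyadicRing _)

theorem mem_dyadicRing_of_eq {t : ℝ} (m : ℤ) (n : ℕ) (h : t = m / 2 ^ n) : t ∈ dyadicRing :=
  h ▸ div_two_pow_mem_dyadicRing m n

/-- Thompson's group as a group of homeomorphisms of the line. -/
noncomputable def thompsonEquiv : ThompsonF ≃* PLS 0 1 :=
  extEquiv (zero_mem _) (one_mem _)

/-- The length `7 / 8` is not a power of `2`, so no single dyadic affine map carries `[0, 1]` to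
`J`. The map `w` has slope `1` up to `3 / 4` and slope `1 / 2` afterwards, with total variation `3 /
4 + 1 / 8`. -/
theorem exists_mulEquiv_PLS_chart : Nonempty (PLS (1 / 16) (1 - 1 / 16) ≃* ThompsonF) := by
  have h1 : (1 / 16 : ℝ) ∈ dyadicRing := mem_dyadicRing_of_eq 1 4 (by norm_num)
  have h2 : (7 / 16 : ℝ) ∈ dyadicRing := mem_dyadicRing_of_eq 7 4 (by norm_num)
  have h3 : (3 / 4 : ℝ) ∈ dyadicRing := mem_dyadicRing_of_eq 3 2 (by norm_num)
  have e : affIso 0 (1 / 16) (3 / 4) = affIso (-1) (7 / 16) (3 / 4) := by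
    simp only [affIso_apply]
    norm_num
  let w := glueIso (3 / 4) (affIso 0 (1 / 16)) (affIso (-1) (7 / 16)) e
  have hw : w ∈ PLR := glueIso_mem e h3 (affIso_mem h1) (affIso_mem h2)
  have hw0 : w 0 = 1 / 16 := by
    change glueIso _ _ _ _ _ = _
    rw [glueIso_of_le e (by norm_num), affIso_apply]
    norm_num
  have hw1 : w 1 = 1 - 1 / 16 := by
    change glueIso _ _ _ _ _ = _
    rw [glueIso_of_ge e (by norm_num), affIso_apply]
    norm_num
  have c := conjEquiv 0 1 w hw
  rw [hw0, hw1] at c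
  exact ⟨(thompsonEquiv.trans c).symm⟩

/-- The interval is enlarged to one of length `2 ^ n`, which is affinely equivalent to `[0, 1]` by a
dyadic map. -/
theorem exists_injective_PLS_int (a b : ℤ) :
    ∃ i : PLS a b →* ThompsonF, Function.Injective i := by
  obtain ⟨n, hn⟩ : ∃ n : ℕ, b - a ≤ 2 ^ n := by
    obtain ⟨n, hn⟩ := pow_unbounded_of_one_lt (b - a) (one_lt_two (α := ℤ))
    exact ⟨n, hn.le⟩
  have hle : PLS a b ≤ PLS a (a + 2 ^ n) := by
    refine inf_le_inf_left _ fun u hu t ht => hu t fun h => ht ⟨h.1, h.2.trans_le ?_⟩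
    have : ((b - a : ℤ) : ℝ) ≤ ((2 ^ n : ℤ) : ℝ) := by exact_mod_cast hn
    push_cast at this
    linarith
  let w := affIso (n : ℤ) a
  have hw : w ∈ PLR := affIso_mem (intCast_mem_dyadicRing a)
  have c := conjEquiv 0 1 w hw
  have h0 : w 0 = a := by simp [w, affIso_apply]
  have h1 : w 1 = a + 2 ^ n := by simp [w, affIso_apply, add_comm]
  rw [h0, h1] at c
  refine ⟨((thompsonEquiv.trans c).symm.toMonoidHom).comp (Subgroup.inclusion hle), ?_⟩
  exact (thompsonEquiv.trans c).symm.injective.comp (Subgroup.inclusion_injective hle)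

/-! ## Finite generation of Thompson's group -/

theorem OrderIso.mul_apply' {α : Type*} [LE α] (u v : α ≃o α) (t : α) : (u * v) t = u (v t) := rfl

theorem OrderIso.inv_apply_eq {α : Type*} [LE α] {u : α ≃o α} {s t : α} :
    u⁻¹ s = t ↔ s = u t := u.symm_apply_eq

theorem zpow_apply_of_step {α : Type*} [LE α] {u : α ≃o α} {F : ℤ → α} {a b : ℤ}
    (h : ∀ n, a ≤ n → n < b → u (F n) = F (n + 1)) {i j : ℤ} (hi : a ≤ i) (hi' : i ≤ b)
    (hj : a ≤ j) (hj' : j ≤ b) : (u ^ (j - i)) (F i) = F j := by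
  have key : ∀ i, a ≤ i → ∀ j, i ≤ j → j ≤ b → (u ^ (j - i)) (F i) = F j := by
    intro i hi j hij
    induction j, hij using Int.le_induction with
    | base => intro _; simp
    | succ j hij ih =>
      intro hj
      have e : j + 1 - i = 1 + (j - i) := by ring
      rw [e, zpow_one_add, OrderIso.mul_apply', ih (by lia), h j (by lia) (by lia)]
  rcases le_total i j with hij | hij
  · exact key i hi j hij hj'
  · have := key j hj i hij hi'
    rw [← neg_sub, zpow_neg, OrderIso.inv_apply_eq, this]

theorem zpow_apply_of_step' {α : Type*} [LE α] {u : α ≃o α} {F : ℤ → α}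
    (h : ∀ n, u (F n) = F (n + 1)) (i j : ℤ) : (u ^ j) (F i) = F (i + j) := by
  have := zpow_apply_of_step (u := u) (F := F) (a := min i (i + j)) (b := max i (i + j))
    (fun n _ _ => h n) (i := i) (j := i + j) (min_le_left _ _) (le_max_left _ _)
    (min_le_right _ _) (le_max_right _ _)
  simpa using this

/-- The unit translation. -/
noncomputable def unitShift : ℝ ≃o ℝ := affIso 0 1

theorem unitShift_apply (t : ℝ) : unitShift t = t + 1 := by simp [unitShift, affIso_apply]

theorem unitShift_zpow_apply (n : ℤ) (t : ℝ) : (unitShift ^ n) t = t + n := by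
  have := zpow_apply_of_step' (u := unitShift) (F := fun n : ℤ => t + n)
    (fun n => by rw [unitShift_apply]; push_cast; ring) 0 n
  simpa using this

/-- The map which is the identity on `(-∞, 0]`, `t ↦ 2 * t` on `[0, 1]` and `t ↦ t + 1` on
`[1, ∞)`. -/
noncomputable def unitDoubling : ℝ ≃o ℝ :=
  glueIso 0 (affIso 0 0) (glueIso 1 (affIso 1 0) (affIso 0 1) (by norm_num [affIso_apply]))
    (by rw [glueIso_of_le _ (by norm_num)]; norm_num [affIso_apply])

theorem unitDoubling_of_nonpos {t : ℝ} (ht : t ≤ 0) : unitDoubling t = t := by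
  rw [unitDoubling, glueIso_of_le _ ht]
  simp [affIso_apply]

theorem unitDoubling_of_mem {t : ℝ} (h0 : 0 ≤ t) (h1 : t ≤ 1) : unitDoubling t = 2 * t := by
  rw [unitDoubling, glueIso_of_ge _ h0, glueIso_of_le _ h1]
  simp [affIso_apply]

theorem unitDoubling_of_one_le {t : ℝ} (ht : 1 ≤ t) : unitDoubling t = t + 1 := by
  rw [unitDoubling, glueIso_of_ge _ (by linarith), glueIso_of_ge _ ht]
  simp [affIso_apply]

/-- The group generated by the unit translation and `unitDoubling`. -/
noncomputable def lineGroup : Subgroup (ℝ ≃o ℝ) := Subgroup.closure {unitShift, unitDoubling}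

theorem unitShift_mem : unitShift ∈ lineGroup := Subgroup.subset_closure (by simp)

theorem unitDoubling_mem : unitDoubling ∈ lineGroup := Subgroup.subset_closure (by simp)

/-- `u` maps each interval `[n, n + 1]` affinely onto a standard dyadic interval. -/
def IsExpansion (u : ℝ ≃o ℝ) : Prop :=
  ∀ n : ℤ, ∃ l : ℕ, ∃ z : ℤ, ∀ s ∈ Icc (0 : ℝ) 1, u (n + s) = (z + s) / 2 ^ l

/-- The non integral points in the image of `ℤ`. -/
def nonIntegral (u : ℝ ≃o ℝ) : Set ℝ := range (fun n : ℤ => u n) \ range (fun n : ℤ => (n : ℝ))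

theorem le_of_odd_div_eq {j k : ℤ} {m n : ℕ} (hj : Odd j)
    (h : (j : ℝ) / 2 ^ m = k / 2 ^ n) : m ≤ n := by
  by_contra hlt
  push Not at hlt
  obtain ⟨d, rfl⟩ := Nat.exists_eq_add_of_lt hlt
  rw [div_eq_div_iff (by positivity) (by positivity), pow_succ, pow_add] at h
  have h2 : (j : ℝ) = (k * 2 ^ d) * 2 := by
    have : (2 : ℝ) ^ n ≠ 0 := by positivity
    field_simp at h
    linarith
  have h3 : j = (k * 2 ^ d) * 2 := by exact_mod_cast h2
  rw [← Int.not_even_iff_odd] at hj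
  exact hj (h3 ▸ even_two.mul_left _)

theorem exists_odd_div {z : ℤ} {l : ℕ} (h : ∀ n : ℤ, (z : ℝ) / 2 ^ l ≠ n) :
    ∃ j : ℤ, ∃ m : ℕ, Odd j ∧ 1 ≤ m ∧ (z : ℝ) / 2 ^ l = j / 2 ^ m := by
  induction l generalizing z with
  | zero => exact absurd (by simp) (h z)
  | succ l ih =>
    rcases Int.even_or_odd z with he | ho
    · obtain ⟨w, rfl⟩ := he
      have e : ((w + w : ℤ) : ℝ) / 2 ^ (l + 1) = w / 2 ^ l := by
        push_cast
        field_simp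
        ring
      rw [e] at h ⊢
      exact ih h
    · exact ⟨z, l + 1, ho, by lia, rfl⟩

/-- The image of a cell has length `1 / 2 ^ l` and integral endpoints, which forces `l = 0`; so `u`
is an integer translation. -/
theorem IsExpansion.mem_of_integral {u : ℝ ≃o ℝ} (hu : IsExpansion u)
    (h : ∀ n : ℤ, ∃ m : ℤ, u n = m) : u ∈ lineGroup := by
  have hstep : ∀ n : ℤ, ∀ s ∈ Icc (0 : ℝ) 1, u (n + s) = u n + s := by
    intro n
    obtain ⟨l, z, hz⟩ := hu n
    have h0 := hz 0 (by simp)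
    have h1 := hz 1 (by simp)
    obtain ⟨m, hm⟩ := h n
    obtain ⟨m', hm'⟩ := h (n + 1)
    push_cast at hm'
    rw [add_zero, hm, add_zero] at h0
    rw [hm'] at h1
    have h2 : ((m' - m : ℤ) : ℝ) * 2 ^ l = 1 := by
      push_cast
      rw [h0, h1]
      field_simp
      ring
    have h3 : (m' - m) * 2 ^ l = 1 := by exact_mod_cast h2
    have h4 : (2 : ℤ) ^ l = 1 := by
      rcases Int.eq_one_or_neg_one_of_mul_eq_one' h3 with ⟨_, h⟩ | ⟨_, h⟩
      · exact h
      · have : (0 : ℤ) < 2 ^ l := by positivity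
        lia
    have h5 : (2 : ℝ) ^ l = 1 := by exact_mod_cast h4
    intro s hs
    rw [hz s hs, hm, h0, h5]
    ring
  obtain ⟨a, ha⟩ := h 0
  have hint : ∀ n : ℤ, u n = n + a := by
    intro n
    induction n with
    | zero => simpa using ha
    | succ n ih =>
      push_cast at ih ⊢
      have := hstep n 1 (by simp)
      push_cast at this
      rw [this, ih]
      ring
    | pred n ih =>
      have := hstep (-n - 1) 1 (by simp)
      push_cast at ih this ⊢
      rw [sub_add_cancel, ih] at this
      linarith
  have : u = unitShift ^ a := by
    ext t
    rw [unitShift_zpow_apply]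
    have := hstep ⌊t⌋ (Int.fract t) ⟨Int.fract_nonneg _, (Int.fract_lt_one _).le⟩
    rw [Int.floor_add_fract] at this
    rw [this, hint]
    have := Int.floor_add_fract t
    linarith
  rw [this]
  exact zpow_mem unitShift_mem a

/-- The conjugate of `unitDoubling` which doubles `[i, i + 1]`. -/
noncomputable def doublingAt (i : ℤ) : ℝ ≃o ℝ := unitShift ^ i * unitDoubling * (unitShift ^ i)⁻¹

theorem doublingAt_mem (i : ℤ) : doublingAt i ∈ lineGroup :=
  mul_mem (mul_mem (zpow_mem unitShift_mem _) unitDoubling_mem)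
    (inv_mem (zpow_mem unitShift_mem _))

theorem doublingAt_apply (i : ℤ) (t : ℝ) : doublingAt i t = unitDoubling (t - i) + i := by
  rw [doublingAt, OrderIso.mul_apply', OrderIso.mul_apply', ← zpow_neg, unitShift_zpow_apply,
    unitShift_zpow_apply]
  push_cast
  rw [← sub_eq_add_neg]

/-- Since `j` is odd, the images of the cells `[i, i + 1]` and `[i + 1, i + 2]` are the two halves
of one standard dyadic interval. Precomposition with `doublingAt i` makes that interval the image of
the single cell `[i, i + 1]`. -/
theorem IsExpansion.mul_doublingAt {u : ℝ ≃o ℝ} (hu : IsExpansion u) {i : ℤ} {j : ℤ} {m : ℕ}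
    (hj : Odd j) (hl : ∀ s ∈ Icc (0 : ℝ) 1, u (i + s) = ((j - 1 : ℤ) + s) / 2 ^ (m + 1))
    (hr : ∀ s ∈ Icc (0 : ℝ) 1, u (i + 1 + s) = (j + s) / 2 ^ (m + 1)) :
    IsExpansion (u * doublingAt i) := by
  intro n
  simp only [OrderIso.mul_apply', doublingAt_apply]
  rcases lt_trichotomy n i with h | rfl | h
  · obtain ⟨l, z, hz⟩ := hu n
    refine ⟨l, z, fun s hs => ?_⟩
    have : (n : ℝ) + 1 ≤ i := by exact_mod_cast h
    rw [unitDoubling_of_nonpos (by linarith [hs.2]), sub_add_cancel, hz s hs]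
  · obtain ⟨w, hw⟩ := hj
    refine ⟨m, w, fun s hs => ?_⟩
    rw [unitDoubling_of_mem (by linarith [hs.1]) (by linarith [hs.2])]
    rcases le_total s (1 / 2) with h | h
    · have := hl (2 * s) ⟨by linarith [hs.1], by linarith⟩
      rw [show 2 * (n + s - n) + n = n + 2 * s by ring, this, hw]
      push_cast
      field_simp
      ring
    · have := hr (2 * s - 1) ⟨by linarith [hs.1], by linarith [hs.2]⟩
      rw [show 2 * (n + s - n) + n = n + 1 + (2 * s - 1) by ring, this, hw]
      push_cast
      field_simp
      ring
  · obtain ⟨l, z, hz⟩ := hu (n + 1)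
    refine ⟨l, z, fun s hs => ?_⟩
    have : (i : ℝ) + 1 ≤ n := by exact_mod_cast h
    rw [unitDoubling_of_one_le (by linarith [hs.1]), ← hz s hs]
    push_cast
    congr 1
    ring

/-- `doublingAt i` maps integers to integers and skips exactly `i + 1`. -/
theorem nonIntegral_mul_doublingAt (u : ℝ ≃o ℝ) (i : ℤ) :
    nonIntegral (u * doublingAt i) ⊆ nonIntegral u \ {u (i + 1)} := by
  rintro _ ⟨⟨n, rfl⟩, hn⟩
  have key : ∃ n' : ℤ, doublingAt i n = n' ∧ n' ≠ i + 1 := by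
    rw [doublingAt_apply]
    rcases le_or_gt n i with h | h
    · have : (n : ℝ) ≤ i := by exact_mod_cast h
      exact ⟨n, by rw [unitDoubling_of_nonpos (by linarith)]; ring, by lia⟩
    · have : (i : ℝ) + 1 ≤ n := by exact_mod_cast h
      refine ⟨n + 1, ?_, by lia⟩
      rw [unitDoubling_of_one_le (by linarith)]
      push_cast
      ring
  obtain ⟨n', h1, h2⟩ := key
  simp only [OrderIso.mul_apply', h1] at hn ⊢
  refine ⟨⟨⟨n', rfl⟩, hn⟩, fun h => h2 ?_⟩
  have := u.injective h
  exact_mod_cast this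

/-- Induction on the number of non-integral vertices. A vertex of maximal denominator separates two
sibling intervals, and merging these removes it, like the removal of a caret from a binary forest.
-/
theorem IsExpansion.mem_lineGroup {u : ℝ ≃o ℝ} (hu : IsExpansion u) (hf : (nonIntegral u).Finite) :
    u ∈ lineGroup := by
  induction h : (nonIntegral u).ncard using Nat.strong_induction_on generalizing u with
  | h k ih =>
  by_cases hne : (nonIntegral u).Nonempty
  swap
  · refine hu.mem_of_integral fun n => ?_
    by_contra hcon
    exact hne ⟨u n, ⟨n, rfl⟩, fun ⟨m, hm⟩ => hcon ⟨m, hm.symm⟩⟩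
  have hrep : ∀ q ∈ nonIntegral u, ∃ j : ℤ, ∃ m : ℕ, Odd j ∧ 1 ≤ m ∧ q = j / 2 ^ m := by
    rintro _ ⟨⟨n, rfl⟩, hn⟩
    obtain ⟨l, z, hz⟩ := hu n
    have h0 := hz 0 (by simp)
    simp only [add_zero] at h0 hn ⊢
    rw [h0] at hn ⊢
    exact exists_odd_div fun m hm => hn ⟨m, hm.symm⟩
  choose! J M hJ hM hJM using hrep
  obtain ⟨q, hq, hmax⟩ := Set.exists_max_image (nonIntegral u) M hf hne
  obtain ⟨i, rfl⟩ := hq.1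
  simp only at hq hmax
  set j := J (u i) with hj
  set m := M (u i) with hm
  have hqj : u i = j / 2 ^ m := hJM _ hq
  have hjo : Odd j := hJ _ hq
  have hm1 : 1 ≤ m := hM _ hq
  have hlev : ∀ (n : ℤ) (z : ℤ) (l : ℕ), Odd z → u n = z / 2 ^ l → l ≤ m := by
    intro n z l hz hzl
    by_cases hn : u n ∈ nonIntegral u
    · have := hJM _ hn
      rw [hzl] at this
      exact (le_of_odd_div_eq hz this).trans (by simpa only [← hzl] using hmax _ hn)
    · have : ∃ w : ℤ, (w : ℝ) = u n := by
        by_contra hcon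
        exact hn ⟨⟨n, rfl⟩, hcon⟩
      obtain ⟨w, hw⟩ := this
      have : (z : ℝ) / 2 ^ l = w / 2 ^ 0 := by rw [← hzl, ← hw]; simp
      exact (le_of_odd_div_eq hz this).trans (Nat.zero_le _)
  clear_value j m
  obtain ⟨m, rfl⟩ : ∃ m', m = m' + 1 := ⟨m - 1, by lia⟩
  -- If the cell to the right of the vertex were finer than its denominator, the other endpoint of
  -- the cell would have an odd numerator over a larger power of `2`, against maximality. The same
  -- argument settles the cell to the left.
  have hr : ∀ s ∈ Icc (0 : ℝ) 1, u (i + s) = (j + s) / 2 ^ (m + 1) := by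
    obtain ⟨l, z, hz⟩ := hu i
    have h0 := hz 0 (by simp)
    simp only [add_zero] at h0
    rw [hqj] at h0
    have h1 : m + 1 ≤ l := le_of_odd_div_eq hjo h0
    have h1' := hz 1 (by simp)
    obtain rfl | hlt := h1.eq_or_lt
    · have : (j : ℝ) = z := by
        field_simp at h0
        exact h0
      intro s hs
      rw [hz s hs, this]
    · exfalso
      have hzo : ¬ Odd z := fun ho => by
        have := le_of_odd_div_eq ho h0.symm
        lia
      have := hlev (i + 1) (z + 1) l (by
        rw [Int.not_odd_iff_even] at hzo
        exact hzo.add_one) (by push_cast; exact h1')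
      lia
  have hl : ∀ s ∈ Icc (0 : ℝ) 1, u ((i - 1 : ℤ) + s) = ((j - 1 : ℤ) + s) / 2 ^ (m + 1) := by
    obtain ⟨l, z, hz⟩ := hu (i - 1)
    have h0 := hz 1 (by simp)
    push_cast at h0
    rw [sub_add_cancel, hqj] at h0
    have h0' : (j : ℝ) / 2 ^ (m + 1) = (z + 1 : ℤ) / 2 ^ l := by push_cast; exact h0
    have h1 : m + 1 ≤ l := le_of_odd_div_eq hjo h0'
    have h1' := hz 0 (by simp)
    obtain rfl | hlt := h1.eq_or_lt
    · have : (j : ℝ) = z + 1 := by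
        field_simp at h0
        exact h0
      intro s hs
      rw [hz s hs]
      push_cast
      rw [this]
      ring
    · exfalso
      have hzo : ¬ Odd (z + 1) := fun ho => by
        have := le_of_odd_div_eq ho h0'.symm
        lia
      have := hlev (i - 1) z l (by
        rw [Int.not_odd_iff_even] at hzo
        rcases Int.even_or_odd z with he | ho
        · exact absurd hzo (by rw [Int.not_even_iff_odd]; exact he.add_one)
        · exact ho) (by simpa using h1')
      lia
  have hr' : ∀ s ∈ Icc (0 : ℝ) 1, u ((i - 1 : ℤ) + 1 + s) = (j + s) / 2 ^ (m + 1) := by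
    intro s hs
    rw [← hr s hs]
    push_cast
    congr 1
    ring
  have hexp := hu.mul_doublingAt hjo hl hr'
  have hsub := nonIntegral_mul_doublingAt u (i - 1)
  have hss : nonIntegral (u * doublingAt (i - 1)) ⊂ nonIntegral u := by
    refine ⟨hsub.trans sdiff_subset, fun hcon => ?_⟩
    have := (hsub (hcon hq)).2
    push_cast at this
    rw [sub_add_cancel] at this
    exact this rfl
  have := ih _ (h ▸ Set.ncard_lt_ncard hss hf) hexp (hf.subset hss.1) rfl
  exact (Subgroup.mul_mem_cancel_right _ (doublingAt_mem _)).1 this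

/-- The map which sends `[-R, R]` subdivided in intervals of length `2 ^ (-N)` to unit intervals,
inverted. -/
theorem exists_subdivision (R N : ℕ) : ∃ u : ℝ ≃o ℝ,
    (∀ t, t ≤ -(R * 2 ^ N : ℝ) → u t = t + R * 2 ^ N - R) ∧
    (∀ t, -(R * 2 ^ N : ℝ) ≤ t → t ≤ R * 2 ^ N → u t = t / 2 ^ N) ∧
    (∀ t, (R * 2 ^ N : ℝ) ≤ t → u t = t - R * 2 ^ N + R) := by
  have e1 : affIso (-N) 0 (R * 2 ^ N) = affIso 0 (R - R * 2 ^ N) (R * 2 ^ N) := by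
    simp only [affIso_apply, zpow_neg, zpow_natCast]
    field_simp
    simp
  have hle : -(R * 2 ^ N : ℝ) ≤ R * 2 ^ N := by
    have : (0 : ℝ) ≤ R * 2 ^ N := by positivity
    linarith
  have e2 : affIso 0 (R * 2 ^ N - R) (-(R * 2 ^ N)) =
      glueIso (R * 2 ^ N) (affIso (-N) 0) (affIso 0 (R - R * 2 ^ N)) e1 (-(R * 2 ^ N)) := by
    rw [glueIso_of_le _ hle]
    simp only [affIso_apply, zpow_neg, zpow_natCast]
    field_simp
    ring
  refine ⟨glueIso _ _ _ e2, fun t ht => ?_, fun t h1 h2 => ?_, fun t ht => ?_⟩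
  · rw [glueIso_of_le _ ht, affIso_apply]
    simp
    ring
  · rw [glueIso_of_ge _ h1, glueIso_of_le _ h2, affIso_apply]
    simp [div_eq_inv_mul]
  · rw [glueIso_of_ge _ (hle.trans ht), glueIso_of_ge _ ht, affIso_apply]
    simp
    ring

/-- `g` maps `[i / 2 ^ N, (i + 1) / 2 ^ N]` affinely onto a standard dyadic interval. -/
def IsStandardOn (g : ℝ → ℝ) (N : ℕ) (i : ℤ) : Prop :=
  ∃ l : ℕ, ∃ z : ℤ, ∀ s ∈ Icc (0 : ℝ) 1, g ((i + s) / 2 ^ N) = (z + s) / 2 ^ l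

/-- The image has length `2 ^ (k - N)`, so `l = N - k`. The lower bound on `N` ensures `M ≤ l`, so
that `c` is a multiple of `1 / 2 ^ l`. -/
theorem isStandardOn_of_affine {g : ℝ → ℝ} {N : ℕ} {i : ℤ} {k : ℤ} {c : ℝ} {w : ℤ} {M : ℕ}
    (hc : c = w / 2 ^ M) (hN : M + k.natAbs ≤ N)
    (h : ∀ t ∈ Icc ((i : ℝ) / 2 ^ N) ((i + 1) / 2 ^ N), g t = 2 ^ k * t + c) :
    IsStandardOn g N i := by
  obtain ⟨l, hl⟩ : ∃ l : ℕ, (l : ℤ) = N - k := ⟨(N - k).toNat, by lia⟩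
  obtain ⟨d, rfl⟩ : ∃ d, l = M + d := ⟨l - M, by lia⟩
  refine ⟨M + d, i + w * 2 ^ d, fun s hs => ?_⟩
  rw [h _ ⟨by gcongr; linarith [hs.1], by gcongr; exact hs.2⟩, hc]
  have hk : (2 : ℝ) ^ k = 2 ^ N / 2 ^ (M + d) := by
    rw [← zpow_natCast, ← zpow_natCast, hl, ← zpow_sub₀ two_ne_zero]
    congr 1
    ring
  rw [hk, pow_add]
  push_cast
  field_simp
  ring

theorem mem_dyadicRing_iff {t : ℝ} : t ∈ dyadicRing ↔ ∃ (w : ℤ) (M : ℕ), t = w / 2 ^ M := by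
  constructor
  · intro h
    induction h using Subring.closure_induction with
    | mem x hx => exact ⟨1, 1, by simpa using hx⟩
    | zero => exact ⟨0, 0, by simp⟩
    | one => exact ⟨1, 0, by simp⟩
    | add x y _ _ hx hy =>
      obtain ⟨w, M, rfl⟩ := hx
      obtain ⟨w', M', rfl⟩ := hy
      refine ⟨w * 2 ^ M' + w' * 2 ^ M, M + M', ?_⟩
      push_cast
      rw [pow_add]
      field_simp
    | neg x _ hx =>
      obtain ⟨w, M, rfl⟩ := hx
      exact ⟨-w, M, by push_cast; ring⟩
    | mul x y _ _ hx hy =>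
      obtain ⟨w, M, rfl⟩ := hx
      obtain ⟨w', M', rfl⟩ := hy
      refine ⟨w * w', M + M', ?_⟩
      push_cast
      rw [pow_add]
      field_simp
  · rintro ⟨w, M, rfl⟩
    exact div_two_pow_mem_dyadicRing w M

theorem exists_isStandardOn_near {g : ℝ → ℝ} {t : ℝ} (hg : LocPL g t) :
    ∃ s ∈ 𝓝 t, ∃ N₀ : ℕ, ∀ N ≥ N₀, ∀ i : ℤ,
      (Icc ((i : ℝ) / 2 ^ N) ((i + 1) / 2 ^ N) ∩ s).Nonempty → IsStandardOn g N i := by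
  have hlen : ∀ N : ℕ, ∀ i : ℤ, ((i : ℝ) + 1) / 2 ^ N = i / 2 ^ N + 1 / 2 ^ N := fun N i => by ring
  have hsmall : ∀ δ > (0 : ℝ), ∃ N₀ : ℕ, ∀ N ≥ N₀, 1 / (2 : ℝ) ^ N < δ := by
    intro δ hδ
    obtain ⟨N₀, h⟩ := exists_pow_lt_of_lt_one hδ (by norm_num : (1 / 2 : ℝ) < 1)
    refine ⟨N₀, fun N hN => lt_of_le_of_lt ?_ h⟩
    rw [one_div_pow]
    gcongr
    norm_num
  have hball : ∀ δ > (0 : ℝ), ∃ s ∈ 𝓝 t, ∃ N₀ : ℕ, ∀ N ≥ N₀, ∀ i : ℤ,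
      (Icc ((i : ℝ) / 2 ^ N) ((i + 1) / 2 ^ N) ∩ s).Nonempty →
      Icc ((i : ℝ) / 2 ^ N) ((i + 1) / 2 ^ N) ⊆ Ioo (t - δ) (t + δ) := by
    intro δ hδ
    obtain ⟨N₀, h⟩ := hsmall (δ / 2) (by positivity)
    refine ⟨Ioo (t - δ / 2) (t + δ / 2), Ioo_mem_nhds (by linarith) (by linarith), N₀, ?_⟩
    rintro N hN i ⟨y, hy, hy'⟩ x hx
    have := h N hN
    have := hlen N i
    constructor
    · linarith [hx.1, hx.2, hy.1, hy.2, hy'.1, hy'.2]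
    · linarith [hx.1, hx.2, hy.1, hy.2, hy'.1, hy'.2]
  by_cases ht : t ∈ dyadicRing
  · obtain ⟨k, c, hc, h1⟩ := hg.right
    obtain ⟨l, d, hd, h2⟩ := hg.left
    obtain ⟨δ₁, hδ₁, h1⟩ := Metric.eventually_nhds_iff.1 (eventually_nhdsWithin_iff.1 h1)
    obtain ⟨δ₂, hδ₂, h2⟩ := Metric.eventually_nhds_iff.1 (eventually_nhdsWithin_iff.1 h2)
    obtain ⟨s, hs, N₀, hN₀⟩ := hball (min δ₁ δ₂) (lt_min hδ₁ hδ₂)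
    obtain ⟨w, M, hw⟩ := mem_dyadicRing_iff.1 ht
    obtain ⟨w₁, M₁, hw₁⟩ := mem_dyadicRing_iff.1 hc
    obtain ⟨w₂, M₂, hw₂⟩ := mem_dyadicRing_iff.1 hd
    refine ⟨s, hs, max N₀ (max M (max (M₁ + k.natAbs) (M₂ + l.natAbs))), fun N hN i hne => ?_⟩
    simp only [ge_iff_le, max_le_iff] at hN
    have hI := hN₀ N hN.1 i hne
    -- From the level `M` on, `t` is a point of the grid. No cell straddles it, and one of the two
    -- one-sided formulas holds on the whole cell.
    obtain ⟨e, rfl⟩ := Nat.exists_eq_add_of_le hN.2.1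
    have ht' : t = (w * 2 ^ e : ℤ) / 2 ^ (M + e) := by
      rw [hw, pow_add]
      push_cast
      field_simp
    rcases le_or_gt (w * 2 ^ e) i with hi | hi
    · refine isStandardOn_of_affine hw₁ hN.2.2.1 fun y hy => h1 ?_ ?_
      · have := hI hy
        rw [Real.dist_eq, abs_lt]
        have := min_le_left δ₁ δ₂
        constructor <;> linarith [(hI hy).1, (hI hy).2]
      · refine le_trans ?_ hy.1
        rw [ht']
        gcongr
    · refine isStandardOn_of_affine hw₂ hN.2.2.2 fun y hy => h2 ?_ ?_
      · have := hI hy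
        rw [Real.dist_eq, abs_lt]
        have := min_le_right δ₁ δ₂
        constructor <;> linarith [(hI hy).1, (hI hy).2]
      · refine le_trans hy.2 ?_
        rw [ht']
        have : (i : ℝ) + 1 ≤ (w * 2 ^ e : ℤ) := by exact_mod_cast hi
        gcongr
  · obtain ⟨k, c, hc, h1⟩ := hg.full ht
    obtain ⟨δ, hδ, h1⟩ := Metric.eventually_nhds_iff.1 h1
    obtain ⟨s, hs, N₀, hN₀⟩ := hball δ hδ
    obtain ⟨w, M, hw⟩ := mem_dyadicRing_iff.1 hc
    refine ⟨s, hs, max N₀ (M + k.natAbs), fun N hN i hne => ?_⟩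
    simp only [ge_iff_le, max_le_iff] at hN
    have hI := hN₀ N hN.1 i hne
    refine isStandardOn_of_affine hw hN.2 fun y hy => h1 ?_
    rw [Real.dist_eq, abs_lt]
    constructor <;> linarith [(hI hy).1, (hI hy).2]

theorem exists_isStandardOn {g : ℝ → ℝ} (hg : ∀ t, LocPL g t) {K : Set ℝ} (hK : IsCompact K) :
    ∃ N₀ : ℕ, ∀ N ≥ N₀, ∀ i : ℤ,
      (Icc ((i : ℝ) / 2 ^ N) ((i + 1) / 2 ^ N) ∩ K).Nonempty → IsStandardOn g N i := by
  refine hK.induction_on (p := fun K => ∃ N₀ : ℕ, ∀ N ≥ N₀, ∀ i : ℤ,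
      (Icc ((i : ℝ) / 2 ^ N) ((i + 1) / 2 ^ N) ∩ K).Nonempty → IsStandardOn g N i) ?_ ?_ ?_ ?_
  · exact ⟨0, fun N _ i h => by simp at h⟩
  · intro s t hst ih
    obtain ⟨N₀, h⟩ := ih
    exact ⟨N₀, fun N hN i hne => h N hN i (hne.mono (inter_subset_inter_right _ hst))⟩
  · intro s t ihs iht
    obtain ⟨N₀, h⟩ := ihs
    obtain ⟨N₁, h'⟩ := iht
    refine ⟨max N₀ N₁, fun N hN i hne => ?_⟩
    rw [inter_union_distrib_left, union_nonempty] at hne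
    rcases hne with hne | hne
    · exact h N ((le_max_left _ _).trans hN) i hne
    · exact h' N ((le_max_right _ _).trans hN) i hne
  · intro x hx
    obtain ⟨s, hs, h⟩ := exists_isStandardOn_near (hg x)
    exact ⟨s, nhdsWithin_le_nhds hs, h⟩

/-- After `u`, the unit cells within `R * 2 ^ N` of `0` become grid cells of size `2 ^ (-N)`, on
which `g` is standard. Farther away both maps are integer translations, so only finitely many
vertices fail to be integral. -/
theorem mul_subdivision_mem {g u : ℝ ≃o ℝ} {R N : ℕ} {a b : ℤ}
    (ha : ∀ t, (R : ℝ) ≤ t → g t = t + a) (hb : ∀ t, t ≤ -(R : ℝ) → g t = t + b)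
    (hN : ∀ i : ℤ, (Icc ((i : ℝ) / 2 ^ N) ((i + 1) / 2 ^ N) ∩ Icc (-(R : ℝ)) R).Nonempty →
      IsStandardOn g N i)
    (h1 : ∀ t, t ≤ -(R * 2 ^ N : ℝ) → u t = t + R * 2 ^ N - R)
    (h2 : ∀ t, -(R * 2 ^ N : ℝ) ≤ t → t ≤ R * 2 ^ N → u t = t / 2 ^ N)
    (h3 : ∀ t, (R * 2 ^ N : ℝ) ≤ t → u t = t - R * 2 ^ N + R) : g * u ∈ lineGroup := by
  have hpos : (0 : ℝ) < 2 ^ N := by positivity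
  refine IsExpansion.mem_lineGroup (fun n => ?_) ?_
  · simp only [OrderIso.mul_apply']
    rcases lt_or_ge n (-(R * 2 ^ N)) with h | h
    · have h' : (n : ℝ) + 1 ≤ -(R * 2 ^ N) := by exact_mod_cast h
      refine ⟨0, n + R * 2 ^ N - R + b, fun s hs => ?_⟩
      rw [h1 _ (by linarith [hs.2]), hb _ (by linarith [hs.2])]
      push_cast
      ring
    rcases lt_or_ge n (R * 2 ^ N) with h4 | h4
    · have h' : -(R * 2 ^ N : ℝ) ≤ n := by exact_mod_cast h
      have h4' : (n : ℝ) + 1 ≤ R * 2 ^ N := by exact_mod_cast h4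
      obtain ⟨l, z, hz⟩ := hN n ⟨n / 2 ^ N, ⟨le_rfl, by gcongr; linarith⟩, by
        rw [le_div_iff₀ hpos]; linarith, by rw [div_le_iff₀ hpos]; linarith⟩
      refine ⟨l, z, fun s hs => ?_⟩
      rw [h2 _ (by linarith [hs.1]) (by linarith [hs.2]), hz s hs]
    · have h4' : (R * 2 ^ N : ℝ) ≤ n := by exact_mod_cast h4
      refine ⟨0, n - R * 2 ^ N + R + a, fun s hs => ?_⟩
      rw [h3 _ (by linarith [hs.1]), ha _ (by linarith [hs.1])]
      push_cast
      ring
  · refine ((finite_Icc (-(R * 2 ^ N) : ℤ) (R * 2 ^ N)).image fun n : ℤ => (g * u) n).subset ?_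
    rintro _ ⟨⟨n, rfl⟩, hn⟩
    refine ⟨n, ?_, rfl⟩
    by_contra hcon
    rw [mem_Icc, not_and_or, not_le, not_le] at hcon
    apply hn
    simp only [OrderIso.mul_apply']
    rcases hcon with h | h
    · have h' : (n : ℝ) ≤ -(R * 2 ^ N) := by exact_mod_cast h.le
      refine ⟨n + R * 2 ^ N - R + b, ?_⟩
      rw [h1 _ h', hb _ (by linarith)]
      push_cast
      ring
    · have h' : (R * 2 ^ N : ℝ) ≤ n := by exact_mod_cast h.le
      refine ⟨n - R * 2 ^ N + R + a, ?_⟩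
      rw [h3 _ h', ha _ (by linarith)]
      push_cast
      ring

/-- The piecewise linear dyadic homeomorphisms which are integral translations near `±∞` belong to
the group generated by `unitShift` and `unitDoubling`. -/
theorem mem_lineGroup {g : ℝ ≃o ℝ} (hg : g ∈ PLR) {R : ℕ} {a b : ℤ}
    (ha : ∀ t, (R : ℝ) ≤ t → g t = t + a) (hb : ∀ t, t ≤ -(R : ℝ) → g t = t + b) :
    g ∈ lineGroup := by
  obtain ⟨N, hN⟩ := exists_isStandardOn hg (isCompact_Icc (a := -(R : ℝ)) (b := R))
  obtain ⟨u, h1, h2, h3⟩ := exists_subdivision R N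
  -- The case `g = 1` puts the subdivision itself in the group, where it can be cancelled.
  have hu : 1 * u ∈ lineGroup := mul_subdivision_mem (g := 1) (a := 0) (b := 0)
    (fun t _ => by simp) (fun t _ => by simp)
    (fun i _ => ⟨N, i, fun s _ => rfl⟩) h1 h2 h3
  rw [one_mul] at hu
  exact (Subgroup.mul_mem_cancel_right _ hu).1
    (mul_subdivision_mem ha hb (hN N le_rfl) h1 h2 h3)

/-! ### Transfer from the line to the unit interval -/

theorem quarter_mem_dyadicRing : (1 / 4 : ℝ) ∈ dyadicRing := mem_dyadicRing_of_eq 1 2 (by norm_num)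

theorem half_mem_dyadicRing : (1 / 2 : ℝ) ∈ dyadicRing := mem_dyadicRing_of_eq 1 1 (by norm_num)

/-- This map plays the role of the unit translation: it sends `1 / 2` to `3 / 4`, and the interval
`[1 / 2, 3 / 4)` is a fundamental domain for it on `(0, 1)`. -/
theorem exists_boundedShift : ∃ u ∈ PLS 0 1, (∀ t, 0 ≤ t → t ≤ 1 / 4 → u t = 2 * t) ∧
    (∀ t, 1 / 4 ≤ t → t ≤ 1 / 2 → u t = t + 1 / 4) ∧
    (∀ t, 1 / 2 ≤ t → t ≤ 1 → u t = t / 2 + 1 / 2) := by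
  have e1 : affIso (-1) (1 / 2) 1 = (1 : ℝ ≃o ℝ) 1 := by norm_num [affIso_apply]
  have e2 : affIso 0 (1 / 4) (1 / 2) = glueIso _ _ _ e1 (1 / 2) := by
    rw [glueIso_of_le _ (by norm_num)]
    norm_num [affIso_apply]
  have e3 : affIso 1 0 (1 / 4) = glueIso _ _ _ e2 (1 / 4) := by
    rw [glueIso_of_le _ (by norm_num)]
    norm_num [affIso_apply]
  have e4 : (1 : ℝ ≃o ℝ) 0 = glueIso _ _ _ e3 0 := by
    rw [glueIso_of_le _ (by norm_num)]
    norm_num [affIso_apply]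
  refine ⟨glueIso _ _ _ e4, Subgroup.mem_inf.2 ⟨?_, fun t ht => ?_⟩, fun t h0 h1 => ?_,
    fun t h0 h1 => ?_, fun t h0 h1 => ?_⟩
  · exact glueIso_mem _ (zero_mem _) (one_mem _) (glueIso_mem _ quarter_mem_dyadicRing
      (affIso_mem (zero_mem _)) (glueIso_mem _ half_mem_dyadicRing
      (affIso_mem quarter_mem_dyadicRing) (glueIso_mem _ (one_mem _)
      (affIso_mem half_mem_dyadicRing) (one_mem _))))
  · rw [mem_Ioo, not_and_or, not_lt, not_lt] at ht
    rcases ht with ht | ht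
    · rw [glueIso_of_le _ ht]
      rfl
    · rw [glueIso_of_ge _ (by linarith), glueIso_of_ge _ (by linarith),
        glueIso_of_ge _ (by linarith), glueIso_of_ge _ ht]
      rfl
  · rw [glueIso_of_ge _ h0, glueIso_of_le _ h1]
    simp [affIso_apply]
  · rw [glueIso_of_ge _ (by linarith), glueIso_of_ge _ h0, glueIso_of_le _ h1]
    simp [affIso_apply]
  · rw [glueIso_of_ge _ (by linarith), glueIso_of_ge _ (by linarith), glueIso_of_ge _ h0,
      glueIso_of_le _ h1, affIso_apply, zpow_neg_one]
    ring

/-- The element of `PLS 0 1` with slopes `2`, `1` and `1 / 2`, the standard generator of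
infinite order of Thompson's group. -/
noncomputable def boundedShift : ℝ ≃o ℝ := exists_boundedShift.choose

theorem boundedShift_mem : boundedShift ∈ PLS 0 1 := exists_boundedShift.choose_spec.1

theorem boundedShift_of_le {t : ℝ} (h0 : 0 ≤ t) (h1 : t ≤ 1 / 4) : boundedShift t = 2 * t :=
  exists_boundedShift.choose_spec.2.1 t h0 h1

theorem boundedShift_of_mem {t : ℝ} (h0 : 1 / 4 ≤ t) (h1 : t ≤ 1 / 2) :
    boundedShift t = t + 1 / 4 := exists_boundedShift.choose_spec.2.2.1 t h0 h1

theorem boundedShift_of_ge {t : ℝ} (h0 : 1 / 2 ≤ t) (h1 : t ≤ 1) :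
    boundedShift t = t / 2 + 1 / 2 := exists_boundedShift.choose_spec.2.2.2 t h0 h1

/-- This is `unitDoubling` read in the coordinate `coordFun`, which sends `0`, `1 / 2`, `1` to `1 /
2`, `5 / 8`, `3 / 4`. Beyond `3 / 4` it is the translation, that is, `boundedShift`. -/
theorem exists_boundedDoubling : ∃ u ∈ PLS 0 1, (∀ t, t ≤ 1 / 2 → u t = t) ∧
    (∀ t, 1 / 2 ≤ t → t ≤ 5 / 8 → u t = 2 * t - 1 / 2) ∧
    (∀ t, 5 / 8 ≤ t → t ≤ 3 / 4 → u t = t + 1 / 8) ∧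
    (∀ t, 3 / 4 ≤ t → u t = boundedShift t) := by
  have e1 : affIso 0 (1 / 8) (3 / 4) = boundedShift (3 / 4) := by
    rw [boundedShift_of_ge (by norm_num) (by norm_num)]
    norm_num [affIso_apply]
  have e2 : affIso 1 (-(1 / 2)) (5 / 8) = glueIso _ _ _ e1 (5 / 8) := by
    rw [glueIso_of_le _ (by norm_num)]
    norm_num [affIso_apply]
  have e3 : (1 : ℝ ≃o ℝ) (1 / 2) = glueIso _ _ _ e2 (1 / 2) := by
    rw [glueIso_of_le _ (by norm_num)]
    norm_num [affIso_apply]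
  have d1 : (1 / 8 : ℝ) ∈ dyadicRing := mem_dyadicRing_of_eq 1 3 (by norm_num)
  have d2 : (3 / 4 : ℝ) ∈ dyadicRing := mem_dyadicRing_of_eq 3 2 (by norm_num)
  have d3 : (5 / 8 : ℝ) ∈ dyadicRing := mem_dyadicRing_of_eq 5 3 (by norm_num)
  refine ⟨glueIso _ _ _ e3, Subgroup.mem_inf.2 ⟨?_, fun t ht => ?_⟩, fun t h1 => ?_,
    fun t h0 h1 => ?_, fun t h0 h1 => ?_, fun t h0 => ?_⟩
  · exact glueIso_mem _ half_mem_dyadicRing (one_mem _) (glueIso_mem _ d3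
      (affIso_mem (neg_mem half_mem_dyadicRing)) (glueIso_mem _ d2
      (affIso_mem d1) (Subgroup.mem_inf.1 boundedShift_mem).1))
  · rw [mem_Ioo, not_and_or, not_lt, not_lt] at ht
    rcases ht with ht | ht
    · rw [glueIso_of_le _ (by linarith)]
      rfl
    · rw [glueIso_of_ge _ (by linarith), glueIso_of_ge _ (by linarith),
        glueIso_of_ge _ (by linarith)]
      exact (Subgroup.mem_inf.1 boundedShift_mem).2 t fun h => by linarith [h.2]
  · rw [glueIso_of_le _ h1]
    rfl
  · rw [glueIso_of_ge _ h0, glueIso_of_le _ h1, affIso_apply, zpow_one]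
    ring
  · rw [glueIso_of_ge _ (by linarith), glueIso_of_ge _ h0, glueIso_of_le _ h1]
    simp [affIso_apply]
  · rw [glueIso_of_ge _ (by linarith), glueIso_of_ge _ (by linarith), glueIso_of_ge _ h0]

theorem boundedShift_zpow_half_of_nonneg (n : ℕ) :
    (boundedShift ^ (n : ℤ)) (1 / 2) = 1 - 1 / 2 ^ (n + 1) := by
  induction n with
  | zero => norm_num
  | succ n ih =>
    push_cast
    rw [add_comm, zpow_one_add, OrderIso.mul_apply', ih, boundedShift_of_ge]
    · rw [pow_succ 2 (n + 1)]
      ring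
    · have : (1 : ℝ) / 2 ^ (n + 1) ≤ 1 / 2 ^ 1 := by
        gcongr
        · norm_num
        · lia
      linarith
    · have : (0 : ℝ) < 1 / 2 ^ (n + 1) := by positivity
      linarith

theorem boundedShift_zpow_half_of_nonpos (n : ℕ) :
    (boundedShift ^ (-n : ℤ)) (1 / 2) = 1 / 2 ^ (n + 1) := by
  induction n with
  | zero => norm_num
  | succ n ih =>
    have e : (-((n + 1 : ℕ) : ℤ)) = -1 + -n := by push_cast; ring
    rw [e, zpow_add, zpow_neg_one, OrderIso.mul_apply', ih, OrderIso.inv_apply_eq,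
      boundedShift_of_le (by positivity)]
    · rw [pow_succ 2 (n + 1)]
      field_simp
    · have : (1 : ℝ) / 2 ^ (n + 1 + 1) ≤ 1 / 2 ^ 2 := by
        gcongr
        · norm_num
        · lia
      linarith

theorem boundedShift_zpow_mem (n : ℤ) : boundedShift ^ n ∈ PLS 0 1 := zpow_mem boundedShift_mem n

theorem boundedShift_zpow_add_one (n : ℤ) :
    (boundedShift ^ (n + 1)) (1 / 2) = (boundedShift ^ n) (3 / 4) := by
  rw [zpow_add_one, OrderIso.mul_apply', boundedShift_of_mem (by norm_num) le_rfl]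
  norm_num

theorem boundedShift_zpow_half_strictMono :
    StrictMono fun n : ℤ => (boundedShift ^ n) (1 / 2) := by
  refine strictMono_int_of_lt_succ fun n => ?_
  rw [boundedShift_zpow_add_one]
  exact (boundedShift ^ n).strictMono (by norm_num)

/-- The coordinate change from the line to `(0, 1)` which conjugates `unitShift` to
`boundedShift`. -/
noncomputable def coordFun (s : ℝ) : ℝ := (boundedShift ^ ⌊s⌋) (1 / 2 + Int.fract s / 4)

theorem coordFun_eq {s : ℝ} {n : ℤ} (h0 : n ≤ s) (h1 : s ≤ n + 1) :
    coordFun s = (boundedShift ^ n) (1 / 2 + (s - n) / 4) := by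
  rcases h1.eq_or_lt with h | h
  · have e : ⌊s⌋ = n + 1 := Int.floor_eq_iff.2 ⟨by push_cast; linarith, by push_cast; linarith⟩
    rw [coordFun, Int.fract, e, h]
    push_cast
    rw [sub_self, zero_div, add_zero, boundedShift_zpow_add_one]
    norm_num
  · have e : ⌊s⌋ = n := Int.floor_eq_iff.2 ⟨h0, h⟩
    rw [coordFun, Int.fract, e]

theorem coordFun_add_int (s : ℝ) (n : ℤ) : coordFun (s + n) = (boundedShift ^ n) (coordFun s) := by
  simp only [coordFun, Int.floor_add_intCast, Int.fract_add_intCast]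
  rw [add_comm, zpow_add, OrderIso.mul_apply']

theorem coordFun_strictMono : StrictMono coordFun := by
  intro s t hst
  have hs0 := Int.floor_le s
  have hs1 := Int.lt_floor_add_one s
  have ht0 := Int.floor_le t
  have ht1 := Int.lt_floor_add_one t
  rcases (Int.floor_mono hst.le).eq_or_lt with h | h
  · rw [coordFun_eq hs0 hs1.le, h, coordFun_eq ht0 ht1.le]
    exact (boundedShift ^ ⌊t⌋).strictMono (by linarith)
  · calc coordFun s = (boundedShift ^ ⌊s⌋) (1 / 2 + (s - ⌊s⌋) / 4) := coordFun_eq hs0 hs1.le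
      _ < (boundedShift ^ ⌊s⌋) (3 / 4) := (boundedShift ^ ⌊s⌋).strictMono (by linarith)
      _ = (boundedShift ^ (⌊s⌋ + 1)) (1 / 2) := (boundedShift_zpow_add_one _).symm
      _ ≤ (boundedShift ^ ⌊t⌋) (1 / 2) := boundedShift_zpow_half_strictMono.monotone h
      _ ≤ (boundedShift ^ ⌊t⌋) (1 / 2 + (t - ⌊t⌋) / 4) :=
        (boundedShift ^ ⌊t⌋).monotone (by linarith)
      _ = coordFun t := (coordFun_eq ht0 ht1.le).symm

theorem coordFun_mem (s : ℝ) : coordFun s ∈ Ioo (0 : ℝ) 1 := by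
  rw [coordFun, suppIn_apply_mem (Subgroup.mem_inf.1 (boundedShift_zpow_mem _)).2]
  have := Int.fract_nonneg s
  have := Int.fract_lt_one s
  constructor <;> linarith

theorem exists_two_pow_lt {r : ℝ} (hr : 0 < r) : ∃ n : ℕ, 1 / (2 : ℝ) ^ (n + 1) < r := by
  obtain ⟨n, h⟩ := exists_pow_lt_of_lt_one hr (by norm_num : (1 / 2 : ℝ) < 1)
  refine ⟨n, lt_of_le_of_lt ?_ h⟩
  rw [one_div_pow]
  gcongr
  · norm_num
  · lia

theorem coordFun_surj {r : ℝ} (hr : r ∈ Ioo (0 : ℝ) 1) : ∃ s, coordFun s = r := by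
  obtain ⟨N, hN⟩ := exists_two_pow_lt hr.1
  obtain ⟨M, hM⟩ := exists_two_pow_lt (sub_pos.2 hr.2)
  have hmono := boundedShift_zpow_half_strictMono
  -- The orbit of `1 / 2` under `boundedShift` tends to `0` and `1`, so `r` lies in exactly one
  -- translate of the fundamental domain.
  obtain ⟨n, hn, hmax⟩ := Int.exists_greatest_of_bdd
    (P := fun n => (boundedShift ^ n) (1 / 2) ≤ r)
    ⟨M, fun n hn => by
      refine hmono.le_iff_le.1 (hn.trans ?_)
      change _ ≤ (boundedShift ^ (M : ℤ)) (1 / 2)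
      rw [boundedShift_zpow_half_of_nonneg]
      linarith⟩
    ⟨-N, by rw [boundedShift_zpow_half_of_nonpos]; exact hN.le⟩
  have hn' : r < (boundedShift ^ (n + 1)) (1 / 2) := by
    by_contra hcon
    have := hmax _ (not_lt.1 hcon)
    lia
  rw [boundedShift_zpow_add_one] at hn'
  set y := (boundedShift ^ n).symm r with hy
  have hry : r = (boundedShift ^ n) y := ((boundedShift ^ n).apply_symm_apply r).symm
  rw [hry, (boundedShift ^ n).le_iff_le] at hn
  rw [hry, (boundedShift ^ n).lt_iff_lt] at hn'
  refine ⟨n + 4 * (y - 1 / 2), ?_⟩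
  rw [coordFun_eq (n := n) (by linarith) (by linarith), hry]
  congr 1
  ring

theorem coordFun_locPL (s : ℝ) : LocPL coordFun s := by
  set n := ⌊s⌋ with hn
  have hs0 := Int.floor_le s
  have hs1 := Int.lt_floor_add_one s
  rw [← hn] at hs0 hs1
  let v : ℤ → ℝ ≃o ℝ := fun n => boundedShift ^ n * affIso (-2) (1 / 2 - n / 4)
  have hv : ∀ n, v n ∈ PLR := fun n =>
    mul_mem (Subgroup.mem_inf.1 (boundedShift_zpow_mem n)).1 (affIso_mem (sub_mem
      half_mem_dyadicRing (mem_dyadicRing_of_eq n 2 (by norm_num))))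
  have hvc : ∀ (n : ℤ) (s : ℝ), n ≤ s → s ≤ n + 1 → coordFun s = v n s := by
    intro n s h0 h1
    rw [coordFun_eq h0 h1]
    change _ = (boundedShift ^ n) (affIso _ _ s)
    rw [affIso_apply]
    congr 1
    norm_num
    ring
  have huv : v (n - 1) n = v n n := by
    rw [← hvc (n - 1) n (by push_cast; linarith) (by push_cast; linarith),
      ← hvc n n le_rfl (by linarith)]
  -- As `s` may be the integer `n` itself, the branches of both cells adjacent to `n` are needed.
  refine (LocPL.ite (p := n) (t := s) (intCast_mem_dyadicRing n) huv (fun _ => hv _ _)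
    (fun _ => hv _ _)).congr ?_
  filter_upwards [Ioo_mem_nhds (show (n : ℝ) - 1 < s by linarith) hs1] with y hy
  split_ifs with h
  · exact (hvc (n - 1) y (by push_cast; linarith [hy.1]) (by push_cast; linarith)).symm
  · exact (hvc n y (by linarith) hy.2.le).symm

/-- `coordFun` as an order isomorphism. -/
noncomputable def coordIso : ℝ ≃o Ioo (0 : ℝ) 1 :=
  StrictMono.orderIsoOfSurjective (fun s => ⟨coordFun s, coordFun_mem s⟩)
    (fun _ _ h => coordFun_strictMono h)
    (fun r => by
      obtain ⟨s, hs⟩ := coordFun_surj r.2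
      exact ⟨s, Subtype.ext hs⟩)

theorem coordIso_apply (s : ℝ) : (coordIso s : ℝ) = coordFun s := rfl

theorem coordFun_coordIso_symm (r : Ioo (0 : ℝ) 1) : coordFun (coordIso.symm r) = r := by
  rw [← coordIso_apply, OrderIso.apply_symm_apply]

theorem exists_conj_coordFun {g : ℝ ≃o ℝ} (hg : g ∈ suppIn 0 1) :
    ∃ u : ℝ ≃o ℝ, ∀ s, coordFun (u s) = g (coordFun s) := by
  have hmem : ∀ {u : ℝ ≃o ℝ}, u ∈ suppIn 0 1 → ∀ s, u (coordFun s) ∈ Ioo (0 : ℝ) 1 :=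
    fun hu s => (suppIn_apply_mem hu).2 (coordFun_mem s)
  refine ⟨StrictMono.orderIsoOfSurjective (fun s => coordIso.symm ⟨g (coordFun s), hmem hg s⟩)
    (fun s t h => coordIso.symm.strictMono (g.strictMono (coordFun_strictMono h)))
    (fun s => ⟨coordIso.symm ⟨g⁻¹ (coordFun s), hmem (inv_mem hg) s⟩, ?_⟩),
    fun s => coordFun_coordIso_symm _⟩
  simp only [coordFun_coordIso_symm]
  rw [OrderIso.symm_apply_eq]
  exact Subtype.ext (g.apply_symm_apply _)

theorem boundedShift_zpow_near_one (j : ℤ) :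
    ∀ᶠ y in 𝓝[≤] (1 : ℝ), (boundedShift ^ j) y = 1 - 2 ^ (-j) * (1 - y) := by
  -- Close enough to `1`, all intermediate iterates stay in the domain of the last affine branch of
  -- `boundedShift`.
  have hev : ∀ᶠ y in 𝓝[≤] (1 : ℝ), ∀ i ∈ Finset.Icc (-|j|) |j|,
      1 / 2 ≤ 1 - 2 ^ (-i) * (1 - y) := by
    refine (Finset.eventually_all _).2 fun i _ => ?_
    have : Tendsto (fun y : ℝ => 1 - 2 ^ (-i) * (1 - y)) (𝓝[≤] 1) (𝓝 (1 - 2 ^ (-i) * (1 - 1))) :=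
      (Continuous.tendsto (by fun_prop) _).mono_left nhdsWithin_le_nhds
    exact this.eventually (eventually_ge_nhds (by norm_num))
  filter_upwards [hev, self_mem_nhdsWithin] with y hy hy1
  have hy1' : y ≤ 1 := hy1
  have h0 := abs_nonneg j
  have := zpow_apply_of_step (u := boundedShift)
    (F := fun i : ℤ => 1 - 2 ^ (-i) * (1 - y)) (a := -|j|) (b := |j|) (fun n h1 h2 => by
      rw [boundedShift_of_ge (hy n (Finset.mem_Icc.2 ⟨h1, h2.le⟩))]
      · rw [neg_add, zpow_add₀ two_ne_zero, zpow_neg_one]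
        ring
      · have : (0 : ℝ) ≤ 2 ^ (-n) * (1 - y) := mul_nonneg (by positivity) (by linarith)
        linarith) (i := 0) (j := j) (by lia) h0 (neg_abs_le j) (le_abs_self j)
  simpa using this

theorem boundedShift_zpow_near_zero (j : ℤ) :
    ∀ᶠ y in 𝓝[≥] (0 : ℝ), (boundedShift ^ j) y = 2 ^ j * y := by
  have hev : ∀ᶠ y in 𝓝[≥] (0 : ℝ), ∀ i ∈ Finset.Icc (-|j|) |j|, 2 ^ i * y ≤ 1 / 4 := by
    refine (Finset.eventually_all _).2 fun i _ => ?_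
    have : Tendsto (fun y : ℝ => 2 ^ i * y) (𝓝[≥] 0) (𝓝 (2 ^ i * 0)) :=
      (Continuous.tendsto (by fun_prop) _).mono_left nhdsWithin_le_nhds
    exact this.eventually (eventually_le_nhds (by norm_num))
  filter_upwards [hev, self_mem_nhdsWithin] with y hy hy1
  have hy1' : 0 ≤ y := hy1
  have h0 := abs_nonneg j
  have := zpow_apply_of_step (u := boundedShift)
    (F := fun i : ℤ => 2 ^ i * y) (a := -|j|) (b := |j|) (fun n h1 h2 => by
      rw [boundedShift_of_le (by positivity) (hy n (Finset.mem_Icc.2 ⟨h1, h2.le⟩)),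
        zpow_add₀ two_ne_zero, zpow_one]
      ring) (i := 0) (j := j) (by lia) h0 (neg_abs_le j) (le_abs_self j)
  simpa using this

/-- Near its fixed points `0` and `1`, `g` is linear with slope a power of `2`, so it coincides
there with a power of `boundedShift`. In the coordinate of the line this is an integer translation
near `±∞`. -/
theorem conj_coordFun_mem_lineGroup {g u : ℝ ≃o ℝ} (hg : g ∈ PLS 0 1)
    (hu : ∀ s, coordFun (u s) = g (coordFun s)) : u ∈ lineGroup := by
  obtain ⟨hgP, hgS⟩ := Subgroup.mem_inf.1 hg
  have hcc : Continuous coordFun := continuous_subtype_val.comp coordIso.continuous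
  have huP : u ∈ PLR := by
    intro s
    refine LocPL.cancel (v := coordFun) ?_ (coordFun_locPL _) u.monotone
      u.continuous.continuousAt
    simp only [hu]
    exact (hgP _).comp (coordFun_locPL s) coordFun_strictMono.monotone hcc.continuousAt
  have hfar : ∀ {k : ℤ} {s : ℝ}, g (coordFun s) = (boundedShift ^ k) (coordFun s) →
      u s = s + k := by
    intro k s h
    apply coordFun_strictMono.injective
    rw [hu, h, coordFun_add_int]
  have hright : ∃ R : ℝ, ∃ a : ℤ, ∀ t, R ≤ t → u t = t + a := by
    obtain ⟨k, c, -, hk⟩ := (hgP 1).left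
    have h1 : g 1 = 1 := hgS 1 (by simp)
    have hc : (1 : ℝ) = 2 ^ k * 1 + c := by rw [← hk.self_of_nhdsWithin (by simp), h1]
    have hev : ∀ᶠ y in 𝓝[≤] (1 : ℝ), g y = (boundedShift ^ (-k)) y := by
      filter_upwards [hk, boundedShift_zpow_near_one (-k)] with y h1 h2
      rw [h1, h2, neg_neg]
      linarith
    obtain ⟨l, hl, hsub⟩ := (mem_nhdsLE_iff_exists_Ioc_subset' (zero_lt_one' ℝ)).1 hev
    have hm : (max l 0 + 1) / 2 ∈ Ioo (0 : ℝ) 1 := by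
      have : max l 0 < 1 := max_lt hl one_pos
      have := le_max_right l 0
      constructor <;> linarith
    have hlm : l < (max l 0 + 1) / 2 := by
      have : max l 0 < 1 := max_lt hl one_pos
      have := le_max_left l 0
      linarith
    obtain ⟨R, hR⟩ := coordFun_surj hm
    refine ⟨R, -k, fun t ht => hfar (hsub ⟨?_, (coordFun_mem t).2.le⟩)⟩
    exact hlm.trans_le (hR.symm.le.trans (coordFun_strictMono.monotone ht))
  have hleft : ∃ R : ℝ, ∃ a : ℤ, ∀ t, t ≤ R → u t = t + a := by
    obtain ⟨k, c, -, hk⟩ := (hgP 0).right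
    have h1 : g 0 = 0 := hgS 0 (by simp)
    have hc : (0 : ℝ) = 2 ^ k * 0 + c := by rw [← hk.self_of_nhdsWithin (by simp), h1]
    have hev : ∀ᶠ y in 𝓝[≥] (0 : ℝ), g y = (boundedShift ^ k) y := by
      filter_upwards [hk, boundedShift_zpow_near_zero k] with y h1 h2
      rw [h1, h2]
      linarith
    obtain ⟨r, hr, hsub⟩ := (mem_nhdsGE_iff_exists_Ico_subset' (zero_lt_one' ℝ)).1 hev
    have hr0 : (0 : ℝ) < r := hr
    have hm : min r 1 / 2 ∈ Ioo (0 : ℝ) 1 := by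
      have : 0 < min r 1 := lt_min hr one_pos
      have := min_le_right r 1
      constructor <;> linarith
    have hlm : min r 1 / 2 < r := by
      have := min_le_left r 1
      linarith
    obtain ⟨R, hR⟩ := coordFun_surj hm
    refine ⟨R, k, fun t ht => hfar (hsub ⟨(coordFun_mem t).1.le, ?_⟩)⟩
    exact ((coordFun_strictMono.monotone ht).trans hR.le).trans_lt hlm
  obtain ⟨R, a, ha⟩ := hright
  obtain ⟨R', b, hb⟩ := hleft
  obtain ⟨N, hN⟩ := exists_nat_ge (max R (-R'))
  exact mem_lineGroup huP (R := N) (a := a) (b := b)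
    (fun t ht => ha t ((le_max_left _ _).trans (hN.trans ht)))
    (fun t ht => hb t (by have := (le_max_right R (-R')).trans hN; linarith))

/-- Through `coordFun`, the generators `unitShift` and `unitDoubling` of `lineGroup` become
`boundedShift` and the bounded doubling, which therefore generate. -/
theorem fg_PLS_zero_one : Group.FG (PLS 0 1) := by
  obtain ⟨d, hd, d1, d2, d3, d4⟩ := exists_boundedDoubling
  have hdconj : ∀ s, coordFun (unitDoubling s) = d (coordFun s) := by
    intro s
    have h0 : coordFun 0 = 1 / 2 := by rw [coordFun_eq (n := 0) (by simp) (by simp)]; simp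
    have h1 : coordFun 1 = 3 / 4 := by
      rw [coordFun_eq (n := 0) (by simp) (by simp)]
      norm_num
    have hI : ∀ s, 0 ≤ s → s ≤ 1 → coordFun s = 1 / 2 + s / 4 := fun s h h' => by
      rw [coordFun_eq (n := 0) (by simpa using h) (by simpa using h')]
      simp
    rcases le_total s 0 with hs | hs
    · rw [unitDoubling_of_nonpos hs, d1 _ (h0 ▸ coordFun_strictMono.monotone hs)]
    rcases le_total s 1 with hs' | hs'
    · rw [unitDoubling_of_mem hs hs', hI s hs hs']
      rcases le_total s (1 / 2) with h | h
      · rw [d2 _ (by linarith) (by linarith), hI _ (by linarith) (by linarith)]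
        ring
      · rw [d3 _ (by linarith) (by linarith)]
        have := coordFun_add_int (2 * s - 1) 1
        rw [hI (2 * s - 1) (by linarith) (by linarith)] at this
        push_cast at this
        rw [sub_add_cancel, zpow_one, boundedShift_of_ge (by linarith) (by linarith)] at this
        rw [this]
        ring
    · have := coordFun_add_int s 1
      push_cast at this
      rw [unitDoubling_of_one_le hs', this, zpow_one,
        d4 _ (h1 ▸ coordFun_strictMono.monotone hs')]
  have key : ∀ u ∈ lineGroup, ∃ w ∈ Subgroup.closure {(⟨boundedShift, boundedShift_mem⟩ : PLS 0 1),
      ⟨d, hd⟩}, ∀ s, coordFun (u s) = w.1 (coordFun s) := by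
    intro u hu
    induction hu using Subgroup.closure_induction with
    | mem x hx =>
      rcases hx with rfl | rfl
      · refine ⟨_, Subgroup.subset_closure (Or.inl rfl), fun s => ?_⟩
        have := coordFun_add_int s 1
        push_cast at this
        rw [unitShift_apply, this, zpow_one]
      · exact ⟨_, Subgroup.subset_closure (Or.inr rfl), hdconj⟩
    | one => exact ⟨1, one_mem _, fun s => rfl⟩
    | mul x y _ _ hx hy =>
      obtain ⟨w, hw, h⟩ := hx
      obtain ⟨w', hw', h'⟩ := hy
      refine ⟨w * w', mul_mem hw hw', fun s => ?_⟩
      rw [OrderIso.mul_apply', h, h']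
      rfl
    | inv x _ hx =>
      obtain ⟨w, hw, h⟩ := hx
      refine ⟨w⁻¹, inv_mem hw, fun s => ?_⟩
      have := h (x⁻¹ s)
      rw [← OrderIso.mul_apply', mul_inv_cancel] at this
      exact (OrderIso.inv_apply_eq.2 this).symm
  refine (Group.fg_iff).2 ⟨{(⟨boundedShift, boundedShift_mem⟩ : PLS 0 1), ⟨d, hd⟩}, ?_, by simp⟩
  rw [eq_top_iff]
  intro g _
  obtain ⟨u, hu⟩ := exists_conj_coordFun g.2.2
  obtain ⟨w, hw, h⟩ := key u (conj_coordFun_mem_lineGroup g.2 hu)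
  have : g = w := by
    apply Subtype.ext
    ext t
    by_cases ht : t ∈ Ioo (0 : ℝ) 1
    · obtain ⟨s, rfl⟩ := coordFun_surj ht
      rw [← hu, h]
    · rw [g.2.2 t ht, w.2.2 t ht]
  rwa [this]

theorem fg_thompsonF : Group.FG ThompsonF :=
  have := fg_PLS_zero_one
  Group.fg_of_surjective (f := thompsonEquiv.symm.toMonoidHom) thompsonEquiv.symm.surjective

/-! ## The dyadic odometer -/

/-- The carry at the digit `n` when `1` is added at the digit `k`. -/
def carry (k : ℕ) (a : ℕ → Bool) : ℕ → Bool
  | 0 => true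
  | n + 1 => if n < k then true else carry k a n && a n

/-- Addition of `1` at the digit `k`. -/
def addDigit (k : ℕ) (a : ℕ → Bool) (n : ℕ) : Bool :=
  if n < k then a n else xor (a n) (carry k a n)

theorem carry_succ (k : ℕ) (a : ℕ → Bool) (n : ℕ) :
    carry k a (n + 1) = if n < k then true else carry k a n && a n := rfl

theorem carry_of_le {k : ℕ} {a : ℕ → Bool} {n : ℕ} (h : n ≤ k) : carry k a n = true := by
  cases n with
  | zero => rfl
  | succ n => rw [carry_succ, if_pos (Nat.lt_of_succ_le h)]

theorem addDigit_of_lt {k : ℕ} {a : ℕ → Bool} {n : ℕ} (h : n < k) : addDigit k a n = a n :=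
  if_pos h

theorem addDigit_self (k : ℕ) (a : ℕ → Bool) : addDigit k a k = !a k := by
  rw [addDigit, if_neg (lt_irrefl k), carry_of_le le_rfl, Bool.xor_true]

theorem addDigit_of_le {k : ℕ} {a : ℕ → Bool} {n : ℕ} (h : k ≤ n) :
    addDigit k a n = xor (a n) (carry k a n) := if_neg h.not_gt

/-- When `2 ^ k` is added twice, at most one of the two additions carries into a digit beyond `k`,
and the total carry is that of adding `2 ^ (k + 1)` once. The two facts are proved by a joint
induction. -/
theorem carry_addDigit (k : ℕ) (a : ℕ → Bool) {n : ℕ} (h : k + 1 ≤ n) :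
    (carry k a n && carry k (addDigit k a) n) = false ∧
      xor (carry k a n) (carry k (addDigit k a) n) = carry (k + 1) a n := by
  induction n, h using Nat.le_induction with
  | base =>
    rw [carry_succ, carry_succ, if_neg (lt_irrefl k), if_neg (lt_irrefl k),
      carry_of_le le_rfl, carry_of_le le_rfl, carry_of_le le_rfl, addDigit_self]
    cases a k <;> simp
  | succ n hn ih =>
    rw [carry_succ, carry_succ, carry_succ, if_neg (by lia), if_neg (by lia), if_neg (by lia),
      addDigit_of_le (by lia), ← ih.2]
    have := ih.1
    revert this
    cases carry k a n <;> cases carry k (addDigit k a) n <;> cases a n <;> simp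

theorem addDigit_addDigit (k : ℕ) (a : ℕ → Bool) :
    addDigit k (addDigit k a) = addDigit (k + 1) a := by
  funext n
  rcases lt_trichotomy n k with h | rfl | h
  · rw [addDigit_of_lt h, addDigit_of_lt h, addDigit_of_lt (by lia)]
  · rw [addDigit_self, addDigit_self, addDigit_of_lt (by lia), Bool.not_not]
  · rw [addDigit_of_le h.le, addDigit_of_le h.le, addDigit_of_le h,
      ← (carry_addDigit k a h).2, Bool.xor_assoc]

theorem iterate_addDigit (k : ℕ) (a : ℕ → Bool) : (addDigit 0)^[2 ^ k] a = addDigit k a := by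
  induction k generalizing a with
  | zero => rfl
  | succ k ih => rw [pow_succ, mul_two, Function.iterate_add_apply, ih, ih, addDigit_addDigit]

/-- The borrow at the digit `n` when `1` is subtracted. -/
def borrow (a : ℕ → Bool) : ℕ → Bool
  | 0 => true
  | n + 1 => borrow a n && !a n

/-- Subtraction of `1`. -/
def subDigit (a : ℕ → Bool) (n : ℕ) : Bool := xor (a n) (borrow a n)

theorem borrow_addDigit (a : ℕ → Bool) (n : ℕ) : borrow (addDigit 0 a) n = carry 0 a n := by
  induction n with
  | zero => rfl
  | succ n ih =>
    rw [borrow, ih, carry_succ, if_neg (by lia), addDigit_of_le (by lia)]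
    cases carry 0 a n <;> cases a n <;> rfl

theorem carry_subDigit (a : ℕ → Bool) (n : ℕ) : carry 0 (subDigit a) n = borrow a n := by
  induction n with
  | zero => rfl
  | succ n ih =>
    rw [carry_succ, if_neg (by lia), ih, borrow, subDigit]
    cases borrow a n <;> cases a n <;> rfl

theorem continuous_bool_op {A : Type*} [TopologicalSpace A] {f g : A → Bool}
    (op : Bool → Bool → Bool) (hf : Continuous f) (hg : Continuous g) :
    Continuous fun a => op (f a) (g a) :=
  (continuous_of_discreteTopology (f := fun p : Bool × Bool => op p.1 p.2)).comp (hf.prodMk hg)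

theorem continuous_carry (n : ℕ) : Continuous fun a => carry 0 a n := by
  induction n with
  | zero => exact continuous_const
  | succ n ih =>
    simp only [carry_succ, Nat.not_lt_zero, if_false]
    exact continuous_bool_op and ih (continuous_apply n)

theorem continuous_borrow (n : ℕ) : Continuous fun a => borrow a n := by
  induction n with
  | zero => exact continuous_const
  | succ n ih => exact continuous_bool_op (fun x y => x && !y) ih (continuous_apply n)

/-- The dyadic odometer. -/
def odometer : (ℕ → Bool) ≃ₜ (ℕ → Bool) where
  toFun := addDigit 0
  invFun := subDigit
  left_inv a := by
    funext n
    rw [subDigit, borrow_addDigit, addDigit_of_le (Nat.zero_le _), Bool.xor_assoc, Bool.xor_self,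
      Bool.xor_false]
  right_inv a := by
    funext n
    rw [addDigit_of_le (Nat.zero_le _), carry_subDigit, subDigit, Bool.xor_assoc, Bool.xor_self,
      Bool.xor_false]
  continuous_toFun := continuous_pi fun n => by
    have : (fun a => addDigit 0 a n) = fun a => xor (a n) (carry 0 a n) :=
      funext fun a => addDigit_of_le (Nat.zero_le _)
    rw [this]
    exact continuous_bool_op xor (continuous_apply n) (continuous_carry n)
  continuous_invFun := continuous_pi fun n =>
    continuous_bool_op xor (continuous_apply n) (continuous_borrow n)

/-- Digits are corrected one after the other: `2 ^ k` further steps flip the digit `k` and leave the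
lower digits unchanged. -/
theorem exists_iterate_agree (a b : ℕ → Bool) (k : ℕ) :
    ∃ m : ℕ, ∀ i < k, ((addDigit 0)^[m] a) i = b i := by
  induction k with
  | zero => exact ⟨0, by simp⟩
  | succ k ih =>
    obtain ⟨m, hm⟩ := ih
    by_cases h : ((addDigit 0)^[m] a) k = b k
    · refine ⟨m, fun i hi => ?_⟩
      rcases Nat.lt_succ_iff_lt_or_eq.1 hi with hi | rfl
      exacts [hm i hi, h]
    · refine ⟨2 ^ k + m, fun i hi => ?_⟩
      rw [Function.iterate_add_apply, iterate_addDigit]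
      rcases Nat.lt_succ_iff_lt_or_eq.1 hi with hi | rfl
      · rw [addDigit_of_lt hi, hm i hi]
      · rw [addDigit_self]
        revert h
        cases ((addDigit 0)^[m] a) i <;> cases b i <;> simp

theorem Homeomorph.coe_pow_eq_iterate {X : Type*} [TopologicalSpace X] (φ : X ≃ₜ X) (m : ℕ) :
    ⇑(φ ^ m) = φ^[m] := by
  induction m with
  | zero => rfl
  | succ m ih =>
    rw [pow_succ, Function.iterate_succ, ← ih]
    rfl

theorem isMinimalHomeo_odometer : IsMinimalHomeo odometer := by
  intro a
  rw [(PiNat.isTopologicalBasis_cylinders fun _ : ℕ => Bool).dense_iff]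
  rintro _ ⟨b, k, rfl⟩ -
  obtain ⟨m, hm⟩ := exists_iterate_agree a b k
  refine ⟨(odometer ^ (m : ℤ)) a, ?_, ⟨m, rfl⟩⟩
  rw [PiNat.mem_cylinder_iff, zpow_natCast, Homeomorph.coe_pow_eq_iterate]
  exact hm

/-! ### Clopen partitions of a punctured Cantor space -/

theorem exists_isClopenPartition {X : Type u} [TopologicalSpace X] (e : X ≃ₜ (ℕ → Bool)) (x₀ : X) :
    ∃ C : ℕ → Set X, IsClopenPartition x₀ C := by
  classical
  have hcoord : ∀ i, IsClopen {x | e x i = e x₀ i} := fun i =>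
    (isClopen_discrete {e x₀ i}).preimage ((continuous_apply i).comp e.continuous)
  -- The pieces are indexed by the first digit at which a point differs from `x₀`.
  refine ⟨fun n => (⋂ i ∈ Finset.range n, {x | e x i = e x₀ i}) ∩ {x | e x n = e x₀ n}ᶜ,
    ⟨fun n => (isClopen_biInter_finset fun i _ => hcoord i).inter (hcoord n).compl, ?_, ?_⟩⟩
  · have key : ∀ m n : ℕ, m < n → ∀ x, e x m ≠ e x₀ m →
        (∀ i ∈ Finset.range n, e x i = e x₀ i) → False :=
      fun m n h x h1 h2 => h1 (h2 m (Finset.mem_range.2 h))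
    intro m n hmn
    rw [Set.disjoint_left]
    rintro x ⟨h1, h2⟩ ⟨h3, h4⟩
    simp only [mem_iInter, mem_ofPred_eq] at h1 h3
    rcases hmn.lt_or_gt with h | h
    · exact key m n h x h2 h3
    · exact key n m h x h4 h1
  · ext x
    simp only [mem_iUnion, mem_inter_iff, mem_iInter, mem_compl_iff, mem_ofPred_eq,
      mem_singleton_iff, Finset.mem_range]
    constructor
    · rintro ⟨n, -, h⟩ rfl
      exact h rfl
    · intro hx
      have hne : ∃ n, e x n ≠ e x₀ n := by
        by_contra hcon
        push Not at hcon
        exact hx (e.injective (funext hcon))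
      exact ⟨Nat.find hne, fun i hi => not_not.1 (Nat.find_min hne hi), Nat.find_spec hne⟩

/-! ## Existence of the approximating sequence -/

/-- The limit pushes points to the right on both sides of its fixed point `0`, which is therefore
attracting on the left, with slope `1 / 2`, and repelling on the right, with slope `2`. -/
theorem exists_limit_map : ∃ u ∈ PLS (-1 / 4) (1 / 4),
    (∀ t, -1 / 8 ≤ t → t ≤ 0 → u t = t / 2) ∧ (∀ t, 0 ≤ t → t ≤ 1 / 16 → u t = 2 * t) ∧
    ∀ t ∈ Ioo (-1 / 4 : ℝ) (1 / 4), t ≠ 0 → t < u t := by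
  have d1 : (1 / 8 : ℝ) ∈ dyadicRing := mem_dyadicRing_of_eq 1 3 (by norm_num)
  have d2 : (1 / 16 : ℝ) ∈ dyadicRing := mem_dyadicRing_of_eq 1 4 (by norm_num)
  have d3 : (-1 / 8 : ℝ) ∈ dyadicRing := mem_dyadicRing_of_eq (-1) 3 (by norm_num)
  have d4 : (-3 / 16 : ℝ) ∈ dyadicRing := mem_dyadicRing_of_eq (-3) 4 (by norm_num)
  have d5 : (-1 / 4 : ℝ) ∈ dyadicRing := mem_dyadicRing_of_eq (-1) 2 (by norm_num)
  have e1 : affIso (-1) (1 / 8) (1 / 4) = (1 : ℝ ≃o ℝ) (1 / 4) := by norm_num [affIso_apply]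
  have e2 : affIso 0 (1 / 16) (1 / 8) = glueIso _ _ _ e1 (1 / 8) := by
    rw [glueIso_of_le _ (by norm_num)]
    norm_num [affIso_apply]
  have e3 : affIso 1 0 (1 / 16) = glueIso _ _ _ e2 (1 / 16) := by
    rw [glueIso_of_le _ (by norm_num)]
    norm_num [affIso_apply]
  have e4 : affIso (-1) 0 0 = glueIso _ _ _ e3 0 := by
    rw [glueIso_of_le _ (by norm_num)]
    norm_num [affIso_apply]
  have e5 : affIso 0 (1 / 16) (-1 / 8) = glueIso _ _ _ e4 (-1 / 8) := by
    rw [glueIso_of_le _ (by norm_num)]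
    norm_num [affIso_apply]
  have e6 : affIso 1 (1 / 4) (-3 / 16) = glueIso _ _ _ e5 (-3 / 16) := by
    rw [glueIso_of_le _ (by norm_num)]
    norm_num [affIso_apply]
  have e7 : (1 : ℝ ≃o ℝ) (-1 / 4) = glueIso _ _ _ e6 (-1 / 4) := by
    rw [glueIso_of_le _ (by norm_num)]
    norm_num [affIso_apply]
  have a1 : ∀ t, -1 / 4 ≤ t → t ≤ -3 / 16 → glueIso _ _ _ e7 t = 2 * t + 1 / 4 := fun t h0 h1 => by
    rw [glueIso_of_ge _ h0, glueIso_of_le _ h1, affIso_apply, zpow_one]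
  have a2 : ∀ t, -3 / 16 ≤ t → t ≤ -1 / 8 → glueIso _ _ _ e7 t = t + 1 / 16 := fun t h0 h1 => by
    rw [glueIso_of_ge _ (by linarith), glueIso_of_ge _ h0, glueIso_of_le _ h1, affIso_apply,
      zpow_zero, one_mul]
  have a3 : ∀ t, -1 / 8 ≤ t → t ≤ 0 → glueIso _ _ _ e7 t = t / 2 := fun t h0 h1 => by
    rw [glueIso_of_ge _ (by linarith), glueIso_of_ge _ (by linarith), glueIso_of_ge _ h0,
      glueIso_of_le _ h1, affIso_apply, zpow_neg_one]
    ring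
  have a4 : ∀ t, 0 ≤ t → t ≤ 1 / 16 → glueIso _ _ _ e7 t = 2 * t := fun t h0 h1 => by
    rw [glueIso_of_ge _ (by linarith), glueIso_of_ge _ (by linarith), glueIso_of_ge _ (by linarith),
      glueIso_of_ge _ h0, glueIso_of_le _ h1, affIso_apply, zpow_one, add_zero]
  have a5 : ∀ t, 1 / 16 ≤ t → t ≤ 1 / 8 → glueIso _ _ _ e7 t = t + 1 / 16 := fun t h0 h1 => by
    rw [glueIso_of_ge _ (by linarith), glueIso_of_ge _ (by linarith), glueIso_of_ge _ (by linarith),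
      glueIso_of_ge _ (by linarith), glueIso_of_ge _ h0, glueIso_of_le _ h1, affIso_apply,
      zpow_zero, one_mul]
  have a6 : ∀ t, 1 / 8 ≤ t → t ≤ 1 / 4 → glueIso _ _ _ e7 t = t / 2 + 1 / 8 := fun t h0 h1 => by
    rw [glueIso_of_ge _ (by linarith), glueIso_of_ge _ (by linarith), glueIso_of_ge _ (by linarith),
      glueIso_of_ge _ (by linarith), glueIso_of_ge _ (by linarith), glueIso_of_ge _ h0,
      glueIso_of_le _ h1, affIso_apply, zpow_neg_one]
    ring
  refine ⟨glueIso _ _ _ e7, Subgroup.mem_inf.2 ⟨?_, fun t ht => ?_⟩, a3, a4, fun t ht ht0 => ?_⟩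
  · exact glueIso_mem _ d5 (one_mem _) (glueIso_mem _ d4 (affIso_mem quarter_mem_dyadicRing)
      (glueIso_mem _ d3 (affIso_mem d2) (glueIso_mem _ (zero_mem _) (affIso_mem (zero_mem _))
      (glueIso_mem _ d2 (affIso_mem (zero_mem _)) (glueIso_mem _ d1 (affIso_mem d2)
      (glueIso_mem _ quarter_mem_dyadicRing (affIso_mem d1) (one_mem _)))))))
  · rw [mem_Ioo, not_and_or, not_lt, not_lt] at ht
    rcases ht with ht | ht
    · rw [glueIso_of_le _ ht]
      rfl
    · rw [glueIso_of_ge _ (by linarith), glueIso_of_ge _ (by linarith),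
        glueIso_of_ge _ (by linarith), glueIso_of_ge _ (by linarith),
        glueIso_of_ge _ (by linarith), glueIso_of_ge _ (by linarith), glueIso_of_ge _ ht]
      rfl
  · obtain ⟨h0, h1⟩ := ht
    rcases le_total t (-3 / 16) with h2 | h2
    · rw [a1 t h0.le h2]; linarith
    rcases le_total t (-1 / 8) with h3 | h3
    · rw [a2 t h2 h3]; linarith
    rcases lt_or_gt_of_ne ht0 with h4 | h4
    · rw [a3 t h3 h4.le]; linarith
    rcases le_total t (1 / 16) with h5 | h5
    · rw [a4 t h4.le h5]; linarith
    rcases le_total t (1 / 8) with h6 | h6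
    · rw [a5 t h5 h6]; linarith
    · rw [a6 t h6 h1.le]; linarith

/-- The graph of `u` meets that of `t ↦ t + ε` at `-(2 * ε)`, where `u` is halving, and at `ε`,
where it is doubling. Replacing the arc in between removes the fixed point. -/
theorem exists_translate_near_zero {u : ℝ ≃o ℝ} (hu : u ∈ PLS (-1 / 4) (1 / 4))
    (hneg : ∀ t, -1 / 8 ≤ t → t ≤ 0 → u t = t / 2) (hpos : ∀ t, 0 ≤ t → t ≤ 1 / 16 → u t = 2 * t)
    {ε : ℝ} (h0 : 0 < ε) (h1 : ε ≤ 1 / 16) (hε : ε ∈ dyadicRing) :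
    ∃ v ∈ PLS (-1 / 4) (1 / 4), (∀ t, t ≤ -(2 * ε) → v t = u t) ∧
      (∀ t, -(2 * ε) ≤ t → t ≤ ε → v t = t + ε) ∧ ∀ t, ε ≤ t → v t = u t := by
  obtain ⟨huP, huS⟩ := Subgroup.mem_inf.1 hu
  have e1 : affIso 0 ε ε = u ε := by
    rw [hpos ε h0.le h1, affIso_apply]
    simp
    ring
  have e2 : u (-(2 * ε)) = glueIso _ _ _ e1 (-(2 * ε)) := by
    rw [glueIso_of_le _ (by linarith), hneg _ (by linarith) (by linarith), affIso_apply]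
    simp
    ring
  have hd : -(2 * ε) ∈ dyadicRing := neg_mem (mul_mem (ofNat_mem dyadicRing 2) hε)
  have a1 : ∀ t, t ≤ -(2 * ε) → glueIso _ _ _ e2 t = u t := fun t ht => glueIso_of_le _ ht
  have a2 : ∀ t, ε ≤ t → glueIso _ _ _ e2 t = u t := fun t ht => by
    rw [glueIso_of_ge _ (by linarith), glueIso_of_ge _ ht]
  refine ⟨glueIso _ _ _ e2, Subgroup.mem_inf.2 ⟨glueIso_mem _ hd huP
    (glueIso_mem _ hε (affIso_mem hε) huP), fun t ht => ?_⟩, a1, fun t h0 h1 => ?_, a2⟩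
  · have hut := huS t ht
    rw [mem_Ioo, not_and_or, not_lt, not_lt] at ht
    rcases ht with ht | ht
    · rw [a1 t (by linarith), hut]
    · rw [a2 t (by linarith), hut]
  · rw [glueIso_of_ge _ h0, glueIso_of_le _ h1, affIso_apply, zpow_zero, one_mul]

theorem exists_isApproxSequence : ∃ s sInf, IsApproxSequence s sInf := by
  obtain ⟨u, hu, hneg, hpos, hlt⟩ := exists_limit_map
  obtain ⟨huP, huS⟩ := Subgroup.mem_inf.1 hu
  have hsmall : ∀ n : ℕ, (1 : ℝ) / 4 ^ (n + 2) ≤ 1 / 16 := fun n => by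
    rw [show (16 : ℝ) = 4 ^ 2 by norm_num]
    gcongr
    · norm_num
    · lia
  have hd : ∀ n : ℕ, (1 : ℝ) / 4 ^ (n + 2) ∈ dyadicRing := fun n => by
    refine mem_dyadicRing_of_eq 1 (2 * (n + 2)) ?_
    rw [pow_mul]
    norm_num
  -- With `ε = 1 / 4 ^ (n + 2)` the modified interval `[-(2 * ε), ε]` lies in the window of radius
  -- `1 / 4 ^ (n + 1) = 4 * ε`.
  choose v hv v1 v2 v3 using fun n : ℕ => exists_translate_near_zero hu hneg hpos
    (ε := 1 / 4 ^ (n + 2)) (by positivity) (hsmall n) (hd n)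
  have hstep : ∀ n : ℕ, (1 : ℝ) / 4 ^ (n + 1) = 4 * (1 / 4 ^ (n + 2)) := fun n => by
    rw [pow_succ 4 (n + 1)]
    field_simp
  have hout : ∀ m n, m ≤ n → ∀ t : ℝ, t ∉ Ioo (-(1 / 4 ^ (m + 1)) : ℝ) (1 / 4 ^ (m + 1)) →
      v n t = u t := by
    intro m n hmn t ht
    have hp : (0 : ℝ) < 1 / 4 ^ (n + 2) := by positivity
    have hle : (1 : ℝ) / 4 ^ (n + 1) ≤ 1 / 4 ^ (m + 1) := by
      gcongr
      norm_num
    have := hstep n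
    rw [mem_Ioo, not_and_or, not_lt, not_lt] at ht
    rcases ht with ht | ht
    · exact v1 n t (by linarith)
    · exact v3 n t (by linarith)
  have h0mem : (0 : ℝ) ∈ Ioo (-1 / 4 : ℝ) (1 / 4) := by norm_num
  refine ⟨fun n => ⟨restrictIoo (v n) (Subgroup.mem_inf.1 (hv n)).2,
    isPLDyadic_restrictIoo _ _ (Subgroup.mem_inf.1 (hv n)).1⟩, restrictIoo u huS,
    ⟨fun n t => ?_, fun m n hmn t ht => ?_, ?_, fun t => ?_⟩⟩
  · change (t : ℝ) < v n t
    have hp : (0 : ℝ) < 1 / 4 ^ (n + 2) := by positivity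
    rcases le_total (t : ℝ) (-(2 * (1 / 4 ^ (n + 2)))) with h | h
    · rw [v1 n t h]
      exact hlt t t.2 (by linarith)
    rcases le_total (t : ℝ) (1 / 4 ^ (n + 2)) with h' | h'
    · rw [v2 n t h h']
      linarith
    · rw [v3 n t h']
      exact hlt t t.2 (by linarith)
  · apply Subtype.ext
    change v n t = v m t
    rw [hout m n hmn t ht, hout m m le_rfl t ht]
  · change Tendsto (fun n => v n 0) atTop (𝓝 0)
    have : ∀ n, v n 0 = 1 / 16 * (1 / 4) ^ n := fun n => by
      rw [v2 n 0 (by have : (0 : ℝ) < 1 / 4 ^ (n + 2) := by positivity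
                     linarith) (by positivity), zero_add, one_div_pow, pow_add]
      field_simp
      norm_num
    simp only [this]
    simpa using (tendsto_pow_atTop_nhds_zero_of_lt_one (by norm_num : (0 : ℝ) ≤ 1 / 4)
      (by norm_num)).const_mul (1 / 16 : ℝ)
  · rw [tendsto_subtype_rng]
    change Tendsto (fun n => v n t) atTop (𝓝 (u t))
    by_cases ht : (t : ℝ) = 0
    · rw [ht, hpos 0 le_rfl (by norm_num), mul_zero]
      have : ∀ n, v n 0 = 1 / 16 * (1 / 4) ^ n := fun n => by
        rw [v2 n 0 (by have : (0 : ℝ) < 1 / 4 ^ (n + 2) := by positivity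
                       linarith) (by positivity), zero_add, one_div_pow, pow_add]
        field_simp
        norm_num
      simp only [this]
      simpa using (tendsto_pow_atTop_nhds_zero_of_lt_one (by norm_num : (0 : ℝ) ≤ 1 / 4)
        (by norm_num)).const_mul (1 / 16 : ℝ)
    · obtain ⟨m, hm⟩ := exists_pow_lt_of_lt_one (abs_pos.2 ht) (by norm_num : (1 / 4 : ℝ) < 1)
      refine tendsto_const_nhds.congr' ?_
      filter_upwards [eventually_ge_atTop m] with n hn
      refine (hout m n hn t fun h => ?_).symm
      have h1 : |(t : ℝ)| < 1 / 4 ^ (m + 1) := abs_lt.2 h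
      have h2 : (1 : ℝ) / 4 ^ (m + 1) ≤ (1 / 4) ^ m := by
        rw [one_div_pow]
        gcongr
        · norm_num
        · lia
      linarith

/-! ## Lifts of elements of `H(φ)` to fibrewise homeomorphisms of `X × ℝ` -/

namespace Suspension

variable {X : Type u} [TopologicalSpace X] (φ : X ≃ₜ X)

theorem proj_eq_proj_iff {x x' : X} {t t' : ℝ} :
    proj φ x t = proj φ x' t' ↔ ∃ n : ℤ, x' = (φ ^ n) x ∧ t' = t - n := by
  refine (Quotient.eq (r := suspensionSetoid φ) (x := (x, t)) (y := (x', t'))).trans ?_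
  change (∃ n : ℤ, (x', t') = _) ↔ _
  simp only [Prod.mk.injEq]

theorem proj_shift (x : X) (t : ℝ) (n : ℤ) : proj φ ((φ ^ n) x) (t - n) = proj φ x t :=
  ((proj_eq_proj_iff φ).2 ⟨n, rfl, rfl⟩).symm

theorem continuous_proj : Continuous fun p : X × ℝ => proj φ p.1 p.2 := continuous_quot_mk

theorem exists_proj_eq (y : Suspension φ) : ∃ x t, proj φ x t = y := by
  induction y using Quotient.inductionOn with
  | h p => exact ⟨p.1, p.2, rfl⟩

theorem isOpenMap_proj : IsOpenMap fun p : X × ℝ => proj φ p.1 p.2 := by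
  intro U hU
  have hq : IsQuotientMap fun p : X × ℝ => proj φ p.1 p.2 := isQuotientMap_quot_mk
  rw [← hq.isOpen_preimage]
  have : (fun p : X × ℝ => proj φ p.1 p.2) ⁻¹' ((fun p : X × ℝ => proj φ p.1 p.2) '' U) =
      ⋃ n : ℤ, (fun p : X × ℝ => ((φ ^ n) p.1, p.2 - n)) ⁻¹' U := by
    ext ⟨x, t⟩
    simp only [mem_preimage, mem_image, mem_iUnion, Prod.exists]
    constructor
    · rintro ⟨x', t', hU', h⟩
      obtain ⟨n, rfl, rfl⟩ := (proj_eq_proj_iff φ).1 h.symm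
      exact ⟨n, hU'⟩
    · rintro ⟨n, hn⟩
      exact ⟨_, _, hn, proj_shift φ x t n⟩
  rw [this]
  exact isOpen_iUnion fun n => hU.preimage (by fun_prop)

theorem map_proj_nhds (x : X) (t : ℝ) :
    map (fun p : X × ℝ => proj φ p.1 p.2) (𝓝 (x, t)) = 𝓝 (proj φ x t) :=
  (isOpenMap_proj φ).map_nhds_eq (continuous_proj φ).continuousAt

/-- The group of fibrewise increasing homeomorphisms of `X × ℝ`, depending continuously on the
fibre, which commute with the action of `ℤ`. -/
def liftGroup : Subgroup (X → ℝ ≃o ℝ) where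
  carrier := {L | (∀ t, Continuous fun x => L x t) ∧
    ∀ (n : ℤ) x t, L ((φ ^ n) x) (t - n) = L x t - n}
  one_mem' := ⟨fun _ => continuous_const, fun _ _ _ => rfl⟩
  mul_mem' := by
    rintro L M ⟨hL, hL'⟩ ⟨hM, hM'⟩
    refine ⟨fun t => ?_, fun n x t => ?_⟩
    · rw [continuous_iff_continuousAt]
      intro x
      change Tendsto (fun x' => L x' (M x' t)) (𝓝 x) (𝓝 (L x (M x t)))
      rw [tendsto_order]
      constructor
      · intro a ha
        -- Comparison at the point `(L x).symm b`, which is below `M x t`: for `x'` near `x`, `M x'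
        -- t` stays above it and `L x'` sends it above `a`. Monotonicity on the fibres replaces
        -- joint continuity here.
        obtain ⟨b, hb1, hb2⟩ := exists_between ha
        have h1 : (L x).symm b < M x t := by
          rwa [← (L x).lt_iff_lt, OrderIso.apply_symm_apply]
        have h2 : a < L x ((L x).symm b) := by rwa [OrderIso.apply_symm_apply]
        filter_upwards [(hM t).continuousAt.eventually (eventually_gt_nhds h1),
          (hL _).continuousAt.eventually (eventually_gt_nhds h2)] with x' h3 h4
        exact h4.trans ((L x').strictMono h3)
      · intro a ha
        obtain ⟨b, hb1, hb2⟩ := exists_between ha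
        have h1 : M x t < (L x).symm b := by
          rwa [← (L x).lt_iff_lt, OrderIso.apply_symm_apply]
        have h2 : L x ((L x).symm b) < a := by rwa [OrderIso.apply_symm_apply]
        filter_upwards [(hM t).continuousAt.eventually (eventually_lt_nhds h1),
          (hL _).continuousAt.eventually (eventually_lt_nhds h2)] with x' h3 h4
        exact ((L x').strictMono h3).trans h4
    · change L _ (M _ _) = L _ (M _ _) - n
      rw [hM', hL']
  inv_mem' := by
    rintro L ⟨hL, hL'⟩
    refine ⟨fun t => ?_, fun n x t => ?_⟩
    · rw [continuous_iff_continuousAt]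
      intro x
      change Tendsto (fun x' => (L x').symm t) (𝓝 x) (𝓝 ((L x).symm t))
      rw [tendsto_order]
      constructor
      · intro a ha
        have h1 : L x a < t := by rwa [← (L x).lt_iff_lt, OrderIso.apply_symm_apply] at ha
        filter_upwards [(hL a).continuousAt.eventually (eventually_lt_nhds h1)] with x' h3
        rwa [← (L x').lt_iff_lt, OrderIso.apply_symm_apply]
      · intro a ha
        have h1 : t < L x a := by
          rwa [gt_iff_lt, ← (L x).lt_iff_lt, OrderIso.apply_symm_apply] at ha
        filter_upwards [(hL a).continuousAt.eventually (eventually_gt_nhds h1)] with x' h3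
        rwa [← (L x').lt_iff_lt, OrderIso.apply_symm_apply]
    · change (L _).symm _ = (L _).symm _ - n
      rw [OrderIso.symm_apply_eq, hL', OrderIso.apply_symm_apply]

variable {φ}

theorem liftGroup_shift (L : liftGroup φ) (n : ℤ) (x : X) (t : ℝ) :
    L.1 ((φ ^ n) x) (t - n) = L.1 x t - n := L.2.2 n x t

/-- A family of increasing homeomorphisms which is pointwise continuous in the parameter is
jointly continuous. -/
theorem continuous_uncurry_of_orderIso {A : Type*} [TopologicalSpace A] {L : A → ℝ ≃o ℝ}
    (hL : ∀ t, Continuous fun x => L x t) : Continuous fun p : A × ℝ => L p.1 p.2 := by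
  rw [continuous_iff_continuousAt]
  rintro ⟨x, t⟩
  change Tendsto (fun p : A × ℝ => L p.1 p.2) (𝓝 (x, t)) (𝓝 (L x t))
  rw [tendsto_order, nhds_prod_eq]
  constructor
  · intro a ha
    obtain ⟨b, hb1, hb2⟩ := exists_between ha
    have h1 : (L x).symm b < t := by rwa [← (L x).lt_iff_lt, OrderIso.apply_symm_apply]
    have h2 : a < L x ((L x).symm b) := by rwa [OrderIso.apply_symm_apply]
    filter_upwards [((hL _).continuousAt.eventually (eventually_gt_nhds h2)).prod_mk
      (eventually_gt_nhds h1)] with p hp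
    exact hp.1.trans ((L p.1).strictMono hp.2)
  · intro a ha
    obtain ⟨b, hb1, hb2⟩ := exists_between ha
    have h1 : t < (L x).symm b := by rwa [← (L x).lt_iff_lt, OrderIso.apply_symm_apply]
    have h2 : L x ((L x).symm b) < a := by rwa [OrderIso.apply_symm_apply]
    filter_upwards [((hL _).continuousAt.eventually (eventually_lt_nhds h2)).prod_mk
      (eventually_lt_nhds h1)] with p hp
    exact ((L p.1).strictMono hp.2).trans hp.1

theorem continuous_lift (L : liftGroup φ) : Continuous fun p : X × ℝ => L.1 p.1 p.2 :=
  continuous_uncurry_of_orderIso L.2.1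

/-- The self-map of the suspension induced by a lift. -/
def descend (L : liftGroup φ) : Suspension φ → Suspension φ :=
  Quotient.map (fun p : X × ℝ => (p.1, L.1 p.1 p.2)) (by
    rintro p q ⟨n, rfl⟩
    exact ⟨n, Prod.ext rfl (liftGroup_shift L n p.1 p.2)⟩)

theorem continuous_descend (L : liftGroup φ) : Continuous (descend L) :=
  continuous_quot_lift _ (continuous_quot_mk.comp
    (continuous_fst.prodMk (continuous_lift L)))

theorem descend_mul (L M : liftGroup φ) (y : Suspension φ) :
    descend (L * M) y = descend L (descend M y) := by
  obtain ⟨x, t, rfl⟩ := exists_proj_eq φ y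
  rfl

theorem descend_one (y : Suspension φ) : descend (1 : liftGroup φ) y = y := by
  obtain ⟨x, t, rfl⟩ := exists_proj_eq φ y
  rfl

/-- The displacement of a lift, as a function on the suspension. -/
def displacement (L : liftGroup φ) : C(Suspension φ, ℝ) where
  toFun := Quotient.lift (fun p : X × ℝ => L.1 p.1 p.2 - p.2) (by
    rintro p q ⟨n, rfl⟩
    change _ = L.1 ((φ ^ n) p.1) (p.2 - n) - (p.2 - n)
    rw [liftGroup_shift]
    ring)
  continuous_toFun := continuous_quot_lift _ ((continuous_lift L).sub continuous_snd)

/-- The homeomorphism of the suspension induced by a lift. -/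
def descendHomeo (L : liftGroup φ) : Suspension φ ≃ₜ Suspension φ where
  toFun := descend L
  invFun := descend L⁻¹
  left_inv y := by rw [← descend_mul, inv_mul_cancel, descend_one]
  right_inv y := by rw [← descend_mul, mul_inv_cancel, descend_one]
  continuous_toFun := continuous_descend L
  continuous_invFun := continuous_descend L⁻¹

theorem descendHomeo_mem (L : liftGroup φ) : descendHomeo L ∈ flowGroup φ := by
  refine ⟨displacement L, fun y => ?_⟩
  obtain ⟨x, t, rfl⟩ := exists_proj_eq φ y
  change proj φ x (L.1 x t) = proj φ x (t + (L.1 x t - t))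
  rw [add_sub_cancel]

/-- The homomorphism which sends a lift to the homeomorphism of the suspension it induces. -/
def descendHom : liftGroup φ →* flowGroup φ where
  toFun L := ⟨descendHomeo L, descendHomeo_mem L⟩
  map_one' := Subtype.ext (Homeomorph.ext descend_one)
  map_mul' L M := Subtype.ext (Homeomorph.ext (descend_mul L M))

theorem descendHom_proj (L : liftGroup φ) (x : X) (t : ℝ) :
    (descendHom L).1 (proj φ x t) = proj φ x (L.1 x t) := rfl

/-- The homeomorphism `φ` has no periodic points. -/
def _root_.IsAperiodicHomeo (φ : X ≃ₜ X) : Prop := ∀ (n : ℤ) (x : X), (φ ^ n) x = x → n = 0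

theorem proj_injective_right (hφ : IsAperiodicHomeo φ) {x : X} {t t' : ℝ} :
    proj φ x t = proj φ x t' ↔ t = t' := by
  refine ⟨fun h => ?_, fun h => h ▸ rfl⟩
  obtain ⟨n, h1, h2⟩ := (proj_eq_proj_iff φ).1 h
  rw [hφ n x h1.symm] at h2
  simpa using h2.symm

theorem descendHom_injective (hφ : IsAperiodicHomeo φ) :
    Function.Injective (descendHom (φ := φ)) := by
  intro L M h
  apply Subtype.ext
  funext x
  ext t
  have := congrArg (fun f : flowGroup φ => f.1 (proj φ x t)) h
  simp only [descendHom_proj] at this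
  exact (proj_injective_right hφ).1 this

/-! ## Periodic extension of fibrewise homeomorphisms -/

/-- The value at `t` of the extension by equivariance of a fibrewise homeomorphism `L` which
preserves `[c, c + 1]`. -/
noncomputable def periodicFun (φ : X ≃ₜ X) (c : ℝ) (L : X → ℝ ≃o ℝ) (x : X) (t : ℝ) : ℝ :=
  L ((φ ^ ⌊t - c⌋) x) (t - ⌊t - c⌋) + ⌊t - c⌋

theorem apply_mem_Ico {c : ℝ} {u : ℝ ≃o ℝ} (h0 : u c = c) (h1 : u (c + 1) = c + 1) {t : ℝ} :
    u t ∈ Ico c (c + 1) ↔ t ∈ Ico c (c + 1) := by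
  have hl := u.le_iff_le (x := c) (y := t)
  have hr := u.lt_iff_lt (x := t) (y := c + 1)
  rw [h0] at hl
  rw [h1] at hr
  rw [mem_Ico, mem_Ico, hl, hr]

theorem sub_floor_mem_Ico (c t : ℝ) : t - ⌊t - c⌋ ∈ Ico c (c + 1) := by
  have := Int.floor_le (t - c)
  have := Int.lt_floor_add_one (t - c)
  constructor <;> linarith

theorem floor_eq_of_mem_Ico {c t : ℝ} {n : ℤ} (h : t - n ∈ Ico c (c + 1)) : ⌊t - c⌋ = n :=
  Int.floor_eq_iff.2 ⟨by linarith [h.1], by linarith [h.2]⟩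

theorem periodicFun_of_mem {c : ℝ} {L : X → ℝ ≃o ℝ} {x : X} {t : ℝ} {n : ℤ}
    (h : t - n ∈ Ico c (c + 1)) :
    periodicFun φ c L x t = L ((φ ^ n) x) (t - n) + n := by
  rw [periodicFun, floor_eq_of_mem_Ico h]

theorem periodicFun_sub_mem {c : ℝ} {L : X → ℝ ≃o ℝ} (h0 : ∀ x, L x c = c)
    (h1 : ∀ x, L x (c + 1) = c + 1) {x : X} {t : ℝ} {n : ℤ}
    (h : t - n ∈ Ico c (c + 1)) : periodicFun φ c L x t - n ∈ Ico c (c + 1) := by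
  rw [periodicFun_of_mem h, add_sub_cancel_right]
  exact (apply_mem_Ico (h0 _) (h1 _)).2 h

/-- The extension by equivariance of a fibrewise homeomorphism which preserves `[c, c + 1]`. -/
noncomputable def periodicIso (φ : X ≃ₜ X) (c : ℝ) (L : X → ℝ ≃o ℝ) (h0 : ∀ x, L x c = c)
    (h1 : ∀ x, L x (c + 1) = c + 1) (x : X) : ℝ ≃o ℝ :=
  StrictMono.orderIsoOfSurjective (periodicFun φ c L x)
    (fun s t hst => by
      have hs := sub_floor_mem_Ico c s
      have ht := sub_floor_mem_Ico c t
      rcases (Int.floor_mono (sub_le_sub_right hst.le c)).eq_or_lt with h | h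
      · rw [h] at hs
        rw [periodicFun_of_mem hs, periodicFun_of_mem ht]
        exact add_lt_add_left ((L _).strictMono (by linarith)) _
      · have hs' := periodicFun_sub_mem (φ := φ) (x := x) h0 h1 hs
        have ht' := periodicFun_sub_mem (φ := φ) (x := x) h0 h1 ht
        have : (⌊s - c⌋ : ℝ) + 1 ≤ ⌊t - c⌋ := by exact_mod_cast h
        linarith [hs'.2, ht'.1])
    (fun s => by
      have hs := sub_floor_mem_Ico c s
      set n := ⌊s - c⌋
      refine ⟨(L ((φ ^ n) x)).symm (s - n) + n, ?_⟩
      have : (L ((φ ^ n) x)).symm (s - n) + n - n ∈ Ico c (c + 1) := by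
        rw [add_sub_cancel_right, ← apply_mem_Ico (h0 ((φ ^ n) x)) (h1 _),
          OrderIso.apply_symm_apply]
        exact hs
      rw [periodicFun_of_mem this, add_sub_cancel_right, OrderIso.apply_symm_apply]
      ring)

theorem zpow_apply_zpow_apply (φ : X ≃ₜ X) (m n : ℤ) (x : X) :
    (φ ^ m) ((φ ^ n) x) = (φ ^ (m + n)) x := by
  rw [zpow_add]
  rfl

/-- The lift defined by a fibrewise homeomorphism which preserves `[c, c + 1]`. -/
noncomputable def periodicLift (φ : X ≃ₜ X) (c : ℝ) (L : X → ℝ ≃o ℝ)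
    (hL : ∀ t, Continuous fun x => L x t) (h0 : ∀ x, L x c = c)
    (h1 : ∀ x, L x (c + 1) = c + 1) : liftGroup φ :=
  ⟨periodicIso φ c L h0 h1, fun t => ((hL _).comp (φ ^ _).continuous).add continuous_const,
    fun n x t => by
      have ht := sub_floor_mem_Ico c t
      change periodicFun φ c L _ _ = periodicFun φ c L _ _ - n
      have : t - n - (⌊t - c⌋ - n : ℤ) ∈ Ico c (c + 1) := by
        push_cast
        rw [sub_sub_sub_cancel_right]
        exact ht
      rw [periodicFun_of_mem ht, periodicFun_of_mem this, zpow_apply_zpow_apply]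
      push_cast
      rw [sub_sub_sub_cancel_right, sub_add_cancel]
      ring⟩

theorem periodicLift_of_mem {c : ℝ} {L : X → ℝ ≃o ℝ} (hL : ∀ t, Continuous fun x => L x t)
    (h0 : ∀ x, L x c = c) (h1 : ∀ x, L x (c + 1) = c + 1) {x : X} {t : ℝ} {n : ℤ}
    (h : t - n ∈ Ico c (c + 1)) :
    (periodicLift φ c L hL h0 h1).1 x t = L ((φ ^ n) x) (t - n) + n := periodicFun_of_mem h

end Suspension

/-! ## The fibrewise twist -/

/-- Extensions to the line of the terms and of the limit of an approximating sequence. -/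
structure IsLineApprox (v : ℕ → ℝ ≃o ℝ) (w : ℝ ≃o ℝ) : Prop where
  mem : ∀ n, v n ∈ PLS (-1 / 4) (1 / 4)
  mem_limit : w ∈ suppIn (-1 / 4) (1 / 4)
  lt_apply : ∀ n, ∀ t ∈ Ioo (-1 / 4 : ℝ) (1 / 4), t < v n t
  eq_limit : ∀ m n, m ≤ n → ∀ t : ℝ, t ∉ Ioo (-(1 / 4 ^ (m + 1)) : ℝ) (1 / 4 ^ (m + 1)) →
    v n t = w t
  limit_zero : w 0 = 0
  tendsto_zero : Tendsto (fun n => v n 0) atTop (𝓝 0)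

theorem neg_quarter_mem_dyadicRing : (-1 / 4 : ℝ) ∈ dyadicRing :=
  mem_dyadicRing_of_eq (-1) 2 (by norm_num)

theorem IsApproxSequence.strictMono_limit {s : ℕ → PLDyadic (-1 / 4) (1 / 4)}
    {sInf : Ioo (-1 / 4 : ℝ) (1 / 4) ≃ₜ Ioo (-1 / 4 : ℝ) (1 / 4)} (h : IsApproxSequence s sInf) :
    StrictMono sInf := by
  have hm : Monotone sInf := fun a b hab =>
    le_of_tendsto_of_tendsto' (h.tendsto a) (h.tendsto b) fun n =>
      (IsPLDyadic.strictMono (s n).2).monotone hab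
  exact hm.strictMono_of_injective sInf.injective

theorem IsApproxSequence.isLineApprox {s : ℕ → PLDyadic (-1 / 4) (1 / 4)}
    {sInf : Ioo (-1 / 4 : ℝ) (1 / 4) ≃ₜ Ioo (-1 / 4 : ℝ) (1 / 4)} (h : IsApproxSequence s sInf) :
    IsLineApprox (fun n => (extEquiv neg_quarter_mem_dyadicRing quarter_mem_dyadicRing (s n)).1)
      (extIso sInf h.strictMono_limit) := by
  have h0mem : (0 : ℝ) ∈ Ioo (-1 / 4 : ℝ) (1 / 4) := by norm_num
  have hv0 : ∀ n, (extEquiv neg_quarter_mem_dyadicRing quarter_mem_dyadicRing (s n)).1 0 =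
      (s n).1 ⟨0, h0mem⟩ := fun n => extEquiv_apply _ _ (s n) ⟨0, h0mem⟩
  refine ⟨fun n => Subtype.coe_prop _, extIso_mem_suppIn _ _, fun n t ht => ?_,
    fun m n hmn t ht => ?_, ?_, ?_⟩
  · rw [extEquiv_apply _ _ (s n) ⟨t, ht⟩]
    exact h.lt_apply n ⟨t, ht⟩
  · by_cases htI : t ∈ Ioo (-1 / 4 : ℝ) (1 / 4)
    · have h1 := extEquiv_apply neg_quarter_mem_dyadicRing quarter_mem_dyadicRing (s n) ⟨t, htI⟩
      have h2 := extIso_of_mem sInf h.strictMono_limit ⟨t, htI⟩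
      simp only at h1 h2
      rw [h1, h2]
      refine congrArg _ (tendsto_nhds_unique tendsto_const_nhds
        ((h.tendsto ⟨t, htI⟩).congr' ?_))
      filter_upwards [eventually_ge_atTop n] with k hk
      rw [h.eq_of_le m k (hmn.trans hk) _ ht, h.eq_of_le m n hmn _ ht]
    · rw [extIso_mem_suppIn _ _ t htI]
      exact (extEquiv neg_quarter_mem_dyadicRing quarter_mem_dyadicRing (s n)).2.2 t htI
  · have h2 := extIso_of_mem sInf h.strictMono_limit ⟨0, h0mem⟩
    simp only at h2
    rw [h2]
    have h3 : Tendsto (fun n => ((s n).1 ⟨0, h0mem⟩ : ℝ)) atTop (𝓝 (sInf ⟨0, h0mem⟩ : ℝ)) :=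
      (continuous_subtype_val.tendsto _).comp (h.tendsto _)
    exact tendsto_nhds_unique h3 h.tendsto_zero
  · simp only [hv0]
    exact h.tendsto_zero

theorem IsLineApprox.lt_limit {v : ℕ → ℝ ≃o ℝ} {w : ℝ ≃o ℝ} (h : IsLineApprox v w) {t : ℝ}
    (ht : t ∈ Ioo (-1 / 4 : ℝ) (1 / 4)) (h0 : t ≠ 0) : t < w t := by
  obtain ⟨m, hm⟩ := exists_pow_lt_of_lt_one (abs_pos.2 h0) (by norm_num : (1 / 4 : ℝ) < 1)
  rw [← h.eq_limit m m le_rfl t fun hI => ?_]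
  · exact h.lt_apply m t ht
  · have h1 : |t| < 1 / 4 ^ (m + 1) := abs_lt.2 hI
    have h2 : (1 : ℝ) / 4 ^ (m + 1) ≤ (1 / 4) ^ m := by
      rw [one_div_pow]
      gcongr
      · norm_num
      · lia
    linarith

/-- The data defining the twist. -/
structure TwistData {X : Type u} [TopologicalSpace X] (φ : X ≃ₜ X) where
  /-- The base point. -/
  x₀ : X
  /-- The pieces of the partition. -/
  C : ℕ → Set X
  /-- The terms of the approximating sequence. -/
  v : ℕ → ℝ ≃o ℝ
  /-- The limit of the approximating sequence. -/
  w : ℝ ≃o ℝ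
  partition : IsClopenPartition x₀ C
  approx : IsLineApprox v w

namespace TwistData

open Suspension

variable {X : Type u} [TopologicalSpace X] {φ : X ≃ₜ X} (D : TwistData φ)

theorem notMem (n : ℕ) : D.x₀ ∉ D.C n := fun h => by
  have : D.x₀ ∈ ⋃ n, D.C n := mem_iUnion.2 ⟨n, h⟩
  rw [D.partition.iUnion_eq] at this
  exact this rfl

theorem exists_mem {x : X} (hx : x ≠ D.x₀) : ∃ n, x ∈ D.C n := by
  have : x ∈ ⋃ n, D.C n := by rw [D.partition.iUnion_eq]; exact hx
  exact mem_iUnion.1 this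

open Classical in
/-- The action of the twist on the fibres. -/
noncomputable def fibre (x : X) : ℝ ≃o ℝ := if h : ∃ n, x ∈ D.C n then D.v h.choose else D.w

theorem fibre_of_mem {x : X} {n : ℕ} (hx : x ∈ D.C n) : D.fibre x = D.v n := by
  have h : ∃ n, x ∈ D.C n := ⟨n, hx⟩
  rw [fibre, dif_pos h]
  congr 1
  by_contra hne
  exact Set.disjoint_left.1 (D.partition.pairwise_disjoint hne) h.choose_spec hx

theorem fibre_base : D.fibre D.x₀ = D.w := dif_neg fun ⟨n, h⟩ => D.notMem n h

theorem fibre_cases (x : X) : (∃ n, x ∈ D.C n ∧ D.fibre x = D.v n) ∨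
    (x = D.x₀ ∧ D.fibre x = D.w) := by
  by_cases hx : x = D.x₀
  · exact Or.inr ⟨hx, hx ▸ D.fibre_base⟩
  · obtain ⟨n, hn⟩ := D.exists_mem hx
    exact Or.inl ⟨n, hn, D.fibre_of_mem hn⟩

theorem fibre_mem (x : X) : D.fibre x ∈ suppIn (-1 / 4) (1 / 4) := by
  rcases D.fibre_cases x with ⟨n, -, h⟩ | ⟨-, h⟩
  · rw [h]
    exact (Subgroup.mem_inf.1 (D.approx.mem n)).2
  · rw [h]
    exact D.approx.mem_limit

/-- Near the base point only pieces of large index occur. -/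
theorem eventually_base (m : ℕ) : ∀ᶠ x in 𝓝 D.x₀,
    (∃ n, m ≤ n ∧ D.fibre x = D.v n) ∨ D.fibre x = D.w := by
  have hcl : IsClosed (⋃ n ∈ Finset.range m, D.C n) :=
    isClosed_biUnion_finset fun n _ => (D.partition.isClopen n).isClosed
  have hmem : (⋃ n ∈ Finset.range m, D.C n)ᶜ ∈ 𝓝 D.x₀ :=
    hcl.isOpen_compl.mem_nhds (by simp [D.notMem])
  filter_upwards [hmem] with x hx
  rcases D.fibre_cases x with ⟨n, hn, h⟩ | ⟨-, h⟩
  · refine Or.inl ⟨n, ?_, h⟩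
    by_contra hlt
    exact hx (mem_biUnion (Finset.mem_coe.2 (Finset.mem_range.2 (not_le.1 hlt))) hn)
  · exact Or.inr h

/-- Off `x₀` the pieces of the partition are open. Near `x₀` only pieces of large index occur, and
their maps agree with the limit outside a small window around `0`; so `(x₀, 0)` is the only
exception. -/
theorem fibre_locally_const {x : X} {t : ℝ} (h : x ≠ D.x₀ ∨ t ≠ 0) :
    ∀ᶠ p in 𝓝 (x, t), D.fibre p.1 p.2 = D.fibre x p.2 := by
  rw [nhds_prod_eq]
  by_cases hx : x = D.x₀
  · subst hx
    have ht : t ≠ 0 := h.resolve_left fun h => h rfl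
    obtain ⟨m, hm⟩ := exists_pow_lt_of_lt_one (abs_pos.2 ht) (by norm_num : (1 / 4 : ℝ) < 1)
    have hm' : (1 : ℝ) / 4 ^ (m + 1) < |t| := by
      refine lt_of_le_of_lt ?_ hm
      rw [one_div_pow]
      gcongr
      · norm_num
      · lia
    have hev : ∀ᶠ t' in 𝓝 t, 1 / 4 ^ (m + 1) < |t'| :=
      continuous_abs.continuousAt.eventually (eventually_gt_nhds hm')
    filter_upwards [(D.eventually_base m).prod_mk hev] with p hp
    rw [D.fibre_base]
    rcases hp.1 with ⟨n, hn, h⟩ | h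
    · rw [h]
      refine D.approx.eq_limit m n hn _ fun hI => ?_
      exact (abs_lt.2 hI).not_gt hp.2
    · rw [h]
  · obtain ⟨n, hn⟩ := D.exists_mem hx
    have : ∀ᶠ x' in 𝓝 x, x' ∈ D.C n := (D.partition.isClopen n).isOpen.mem_nhds hn
    filter_upwards [this.prod_inl (𝓝 t)] with p hp
    rw [D.fibre_of_mem hp, D.fibre_of_mem hn]

theorem continuous_fibre (t : ℝ) : Continuous fun x => D.fibre x t := by
  rw [continuous_iff_continuousAt]
  intro x
  by_cases h : x ≠ D.x₀ ∨ t ≠ 0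
  · have h1 := D.fibre_locally_const h
    have h2 : Tendsto (fun x' : X => (x', t)) (𝓝 x) (𝓝 (x, t)) := by
      exact (Continuous.prodMk_left t).tendsto x
    exact tendsto_const_nhds.congr' ((h2.eventually h1).mono fun _ h => h.symm)
  · push Not at h
    obtain ⟨rfl, rfl⟩ := h
    -- At the exceptional point, continuity is the convergence of `v n 0` to `0 = w 0`.
    rw [ContinuousAt, D.fibre_base, D.approx.limit_zero, tendsto_def]
    intro U hU
    obtain ⟨N, hN⟩ := eventually_atTop.1 (D.approx.tendsto_zero.eventually hU)
    filter_upwards [D.eventually_base N] with x hx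
    rcases hx with ⟨n, hn, h⟩ | h
    · rw [mem_preimage, h]
      exact hN n hn
    · rw [mem_preimage, h, D.approx.limit_zero]
      exact mem_of_mem_nhds hU

/-- The twist, as a lift. -/
noncomputable def twistLift : liftGroup φ :=
  periodicLift φ (-1 / 2) D.fibre D.continuous_fibre
    (fun x => D.fibre_mem x _ (by norm_num)) (fun x => D.fibre_mem x _ (by norm_num))

end TwistData

/-! ### The chart group as a group of lifts -/

namespace Suspension

variable {X : Type u} [TopologicalSpace X] {φ : X ≃ₜ X}

/-- Between two consecutive translates of the support all the maps involved are the identity, so one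
formula is valid on the open interval `(b - 1, a + 1)`. Every real number then has an open
neighbourhood governed by a single `n`. -/
theorem periodicLift_of_mem_Ioo {c a b : ℝ} {L : X → ℝ ≃o ℝ}
    (hL : ∀ t, Continuous fun x => L x t) (h0 : ∀ x, L x c = c) (h1 : ∀ x, L x (c + 1) = c + 1)
    (hs : ∀ x, L x ∈ suppIn a b) (hca : c ≤ a) (hab : a < b) (hb : b ≤ c + 1) {x : X} {t : ℝ}
    {n : ℤ} (h : t - n ∈ Ioo (b - 1) (a + 1)) :
    (periodicLift φ c L hL h0 h1).1 x t = L ((φ ^ n) x) (t - n) + n := by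
  rcases lt_or_ge (t - n) c with hc | hc
  · rw [periodicLift_of_mem hL h0 h1 (n := n - 1) (by
      push_cast; constructor <;> linarith [h.1, h.2]), hs _ _ fun hI => by
      push_cast at hI; linarith [hI.2, h.1], hs _ _ fun hI => by linarith [hI.1]]
    push_cast
    ring
  rcases lt_or_ge (t - n) (c + 1) with hc' | hc'
  · exact periodicLift_of_mem hL h0 h1 ⟨hc, hc'⟩
  · rw [periodicLift_of_mem hL h0 h1 (n := n + 1) (by
      push_cast; constructor <;> linarith [h.1, h.2]), hs _ _ fun hI => by
      push_cast at hI; linarith [hI.1, h.2], hs _ _ fun hI => by linarith [hI.2]]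
    push_cast
    ring

/-- The lift of the element of `F_{X,J}` defined by an element of `F_J`. -/
noncomputable def constLift (φ : X ≃ₜ X) (u : PLS (1 / 16) (1 - 1 / 16)) : liftGroup φ :=
  periodicLift φ 0 (fun _ => u.1) (fun _ => continuous_const)
    (fun _ => u.2.2 _ (by norm_num)) (fun _ => u.2.2 _ (by norm_num))

theorem constLift_of_mem_Ico (u : PLS (1 / 16) (1 - 1 / 16)) {x : X} {t : ℝ} {n : ℤ}
    (h : t - n ∈ Ico (0 : ℝ) (0 + 1)) : (constLift φ u).1 x t = u.1 (t - n) + n :=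
  periodicLift_of_mem (L := fun _ => u.1) (fun _ => continuous_const)
    (fun _ => u.2.2 _ (by norm_num)) (fun _ => u.2.2 _ (by norm_num)) h

/-- The embedding of `F_J` as `F_{X,J}` in the group of lifts. -/
noncomputable def chartLift (φ : X ≃ₜ X) : PLS (1 / 16) (1 - 1 / 16) →* liftGroup φ where
  toFun := constLift φ
  map_one' := by
    apply Subtype.ext
    funext x
    ext t
    change (constLift φ 1).1 x t = t
    rw [constLift_of_mem_Ico _ (sub_floor_mem_Ico 0 t)]
    simp
  map_mul' u v := by
    apply Subtype.ext
    funext x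
    ext t
    change (constLift φ (u * v)).1 x t = (constLift φ u).1 x ((constLift φ v).1 x t)
    have ht := sub_floor_mem_Ico 0 t
    have h0 : v.1 0 = 0 := v.2.2 _ (by norm_num)
    have h1 : v.1 (0 + 1) = 0 + 1 := v.2.2 _ (by norm_num)
    rw [constLift_of_mem_Ico _ ht, constLift_of_mem_Ico _ ht,
      constLift_of_mem_Ico (n := ⌊t - 0⌋), add_sub_cancel_right]
    · rfl
    · rw [add_sub_cancel_right]
      exact (apply_mem_Ico h0 h1).2 ht

theorem chartLift_of_mem (u : PLS (1 / 16) (1 - 1 / 16)) {x : X} {t : ℝ} {n : ℤ}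
    (h : t - n ∈ Ioo (-1 / 16 : ℝ) (17 / 16)) : (chartLift φ u).1 x t = u.1 (t - n) + n :=
  periodicLift_of_mem_Ioo (c := 0) (a := 1 / 16) (b := 1 - 1 / 16) (L := fun _ => u.1)
    (fun _ => continuous_const) (fun _ => u.2.2 _ (by norm_num))
    (fun _ => u.2.2 _ (by norm_num)) (fun _ => u.2.2) (by norm_num) (by norm_num) (by norm_num) (by norm_num at h ⊢; exact h)

theorem exists_int_sub_mem (t : ℝ) : ∃ n : ℤ, t - n ∈ Ioo (-1 / 16 : ℝ) (17 / 16) := by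
  obtain ⟨h1, h2⟩ := sub_floor_mem_Ico 0 t
  exact ⟨⌊t - 0⌋, by linarith, by linarith⟩

theorem chartLift_of_notMem (u : PLS (1 / 16) (1 - 1 / 16)) {x : X} {t : ℝ}
    (h : ∀ n : ℤ, t - n ∉ Ioo (1 / 16 : ℝ) (1 - 1 / 16)) : (chartLift φ u).1 x t = t := by
  obtain ⟨n, hn⟩ := exists_int_sub_mem t
  rw [chartLift_of_mem u hn, u.2.2 _ (h n), sub_add_cancel]

theorem notMem_chart_proj {a b : ℝ} {x : X} {t : ℝ} :
    proj φ x t ∉ chart φ univ a b ↔ ∀ n : ℤ, t - n ∉ Ioo a b := by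
  constructor
  · intro h n hn
    exact h ⟨(φ ^ n) x, mem_univ _, t - n, hn, proj_shift φ x t n⟩
  · rintro h ⟨x', -, t', ht', he⟩
    obtain ⟨n, -, rfl⟩ := (proj_eq_proj_iff φ).1 he.symm
    exact h n ht'

theorem sixteenth_mem_dyadicRing : (1 / 16 : ℝ) ∈ dyadicRing :=
  mem_dyadicRing_of_eq 1 4 (by norm_num)

theorem one_sub_sixteenth_mem_dyadicRing : (1 - 1 / 16 : ℝ) ∈ dyadicRing :=
  sub_mem (one_mem _) sixteenth_mem_dyadicRing

theorem descendHom_chartLift_proj (u : PLS (1 / 16) (1 - 1 / 16)) (x : X)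
    (t : Ioo (1 / 16 : ℝ) (1 - 1 / 16)) :
    (descendHom (chartLift φ u)).1 (proj φ x t) = proj φ x (u.1 t) := by
  rw [descendHom_proj, chartLift_of_mem u (n := 0)]
  · simp
  · have := t.2.1
    have := t.2.2
    constructor <;> push_cast <;> linarith

theorem descendHom_chartLift_mem (u : PLS (1 / 16) (1 - 1 / 16)) :
    descendHom (chartLift φ u) ∈ chartGroup φ univ (1 / 16) (1 - 1 / 16) := by
  obtain ⟨g, rfl⟩ := (extEquiv sixteenth_mem_dyadicRing one_sub_sixteenth_mem_dyadicRing).surjective u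
  refine ⟨⟨g.1, g.2, fun x _ t => ?_⟩, fun y hy => ?_⟩
  · rw [descendHom_chartLift_proj, extEquiv_apply]
  · obtain ⟨x, t, rfl⟩ := exists_proj_eq φ y
    rw [descendHom_proj, chartLift_of_notMem _ (notMem_chart_proj.1 hy)]

theorem exists_chartLift_eq {h : flowGroup φ}
    (hh : h ∈ chartGroup φ univ (1 / 16) (1 - 1 / 16)) : ∃ u, descendHom (chartLift φ u) = h := by
  obtain ⟨⟨g, hg, h1⟩, h2⟩ := id hh
  refine ⟨extEquiv sixteenth_mem_dyadicRing one_sub_sixteenth_mem_dyadicRing ⟨g, hg⟩, ?_⟩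
  apply Subtype.ext
  ext y
  by_cases hy : y ∈ chart φ univ (1 / 16) (1 - 1 / 16)
  · obtain ⟨x, hx, t, ht, rfl⟩ := hy
    have e1 := descendHom_chartLift_proj (φ := φ)
      (extEquiv sixteenth_mem_dyadicRing one_sub_sixteenth_mem_dyadicRing ⟨g, hg⟩) x ⟨t, ht⟩
    have e2 := h1 x hx ⟨t, ht⟩
    rw [extEquiv_apply] at e1
    exact e1.trans e2.symm
  · rw [(descendHom_chartLift_mem _).2 y hy, h2 y hy]

theorem chartLift_injective [Nonempty X] : Function.Injective (chartLift φ) := by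
  intro u v h
  obtain ⟨x⟩ := ‹Nonempty X›
  apply Subtype.ext
  ext t
  by_cases ht : t ∈ Ioo (1 / 16 : ℝ) (1 - 1 / 16)
  · have e := congrArg (fun L : liftGroup φ => L.1 x t) h
    have ht' : t - (0 : ℤ) ∈ Ioo (-1 / 16 : ℝ) (17 / 16) := by
      constructor <;> push_cast <;> linarith [ht.1, ht.2]
    simp only [chartLift_of_mem _ ht'] at e
    simpa using e
  · rw [u.2.2 t ht, v.2.2 t ht]

theorem nonempty_chartGroup_mulEquiv [Nonempty X] (hφ : IsAperiodicHomeo φ) :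
    Nonempty (PLS (1 / 16) (1 - 1 / 16) ≃* chartGroup φ univ (1 / 16) (1 - 1 / 16)) := by
  let F : PLS (1 / 16) (1 - 1 / 16) →* chartGroup φ univ (1 / 16) (1 - 1 / 16) :=
    (descendHom.comp (chartLift φ)).codRestrict _ descendHom_chartLift_mem
  refine ⟨MulEquiv.ofBijective F ⟨fun u v h => ?_, fun h => ?_⟩⟩
  · exact chartLift_injective (descendHom_injective hφ (congrArg Subtype.val h))
  · obtain ⟨u, hu⟩ := exists_chartLift_eq h.2
    exact ⟨u, Subtype.ext hu⟩

end Suspension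

/-! ### The group of lifts and its germs at the base point -/

namespace TwistData

open Suspension

variable {X : Type u} [TopologicalSpace X] {φ : X ≃ₜ X} (D : TwistData φ)

theorem twistLift_of_mem {x : X} {t : ℝ} {n : ℤ} (h : t - n ∈ Ioo (-3 / 4 : ℝ) (3 / 4)) :
    D.twistLift.1 x t = D.fibre ((φ ^ n) x) (t - n) + n :=
  periodicLift_of_mem_Ioo (c := -1 / 2) (a := -1 / 4) (b := 1 / 4) _ _ _ D.fibre_mem
    (by norm_num) (by norm_num) (by norm_num) (by norm_num at h ⊢; exact h)

theorem twistLift_of_mem' {x : X} {t : ℝ} (h : t ∈ Ioo (-3 / 4 : ℝ) (3 / 4)) :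
    D.twistLift.1 x t = D.fibre x t := by
  have := D.twistLift_of_mem (x := x) (t := t) (n := 0) (by simpa using h)
  simpa using this

theorem exists_int_sub_mem (t : ℝ) : ∃ n : ℤ, t - n ∈ Ioo (-3 / 4 : ℝ) (3 / 4) := by
  obtain ⟨h1, h2⟩ := sub_floor_mem_Ico (-1 / 2) t
  exact ⟨⌊t - -1 / 2⌋, by linarith, by linarith⟩

theorem twistLift_of_notMem {x : X} {t : ℝ}
    (h : ∀ n : ℤ, t - n ∉ Ioo (-1 / 4 : ℝ) (1 / 4)) : D.twistLift.1 x t = t := by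
  obtain ⟨n, hn⟩ := exists_int_sub_mem t
  rw [D.twistLift_of_mem hn, D.fibre_mem _ _ (h n), sub_add_cancel]

/-- The group of lifts of elements of `⟨f, F_{X,J}⟩`. -/
noncomputable def group : Subgroup (liftGroup φ) :=
  Subgroup.closure ({D.twistLift} ∪ range (chartLift φ))

theorem twistLift_mem : D.twistLift ∈ D.group := Subgroup.subset_closure (Or.inl rfl)

theorem chartLift_mem (u) : chartLift φ u ∈ D.group := Subgroup.subset_closure (Or.inr ⟨u, rfl⟩)

theorem map_group : D.group.map descendHom = twistGroup φ (descendHom D.twistLift) := by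
  rw [group, MonoidHom.map_closure, twistGroup]
  congr 1
  rw [image_union, image_singleton, ← range_comp]
  congr 1
  ext h
  constructor
  · rintro ⟨u, rfl⟩
    exact descendHom_chartLift_mem u
  · exact fun hh => exists_chartLift_eq hh

/-- Induction principle for the elements of the group. -/
theorem group_induction {p : liftGroup φ → Prop} (htwist : p D.twistLift)
    (hchart : ∀ u, p (chartLift φ u)) (hone : p 1) (hmul : ∀ L M, p L → p M → p (L * M))
    (hinv : ∀ L, p L → p L⁻¹) {L : liftGroup φ} (hL : L ∈ D.group) : p L := by
  induction hL using Subgroup.closure_induction with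
  | mem x hx =>
    rcases hx with rfl | ⟨u, rfl⟩
    exacts [htwist, hchart u]
  | one => exact hone
  | mul x y _ _ hx hy => exact hmul x y hx hy
  | inv x _ hx => exact hinv x hx

theorem chartLift_near_base (u) (x : X) {t : ℝ} (ht : |t| < 1 / 16) :
    (chartLift φ u).1 x t = t := by
  rw [abs_lt] at ht
  have h : t - (0 : ℤ) ∈ Ioo (-1 / 16 : ℝ) (17 / 16) := by
    constructor <;> push_cast <;> linarith [ht.1, ht.2]
  rw [chartLift_of_mem u h, u.2.2 _ fun hI => ?_]
  · simp
  · have := hI.1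
    push_cast at this
    linarith [ht.2]

theorem apply_base {L : liftGroup φ} (hL : L ∈ D.group) : L.1 D.x₀ 0 = 0 := by
  refine D.group_induction (p := fun L => L.1 D.x₀ 0 = 0) ?_ (fun u => ?_) rfl ?_ ?_ hL
  · rw [D.twistLift_of_mem' (by norm_num), D.fibre_base, D.approx.limit_zero]
  · exact chartLift_near_base u _ (by norm_num)
  · intro L M hL hM
    change L.1 D.x₀ (M.1 D.x₀ 0) = 0
    rw [hM, hL]
  · intro L hL
    change (L.1 D.x₀)⁻¹ 0 = 0
    rw [OrderIso.inv_apply_eq, hL]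

/-- The elements of the group are powers of the twist near the base point. -/
theorem exists_zpow_near_base {L : liftGroup φ} (hL : L ∈ D.group) :
    ∃ k : ℤ, ∀ᶠ p in 𝓝 (D.x₀, (0 : ℝ)), L.1 p.1 p.2 = (D.twistLift ^ k).1 p.1 p.2 := by
  have hmem : ∀ k : ℤ, D.twistLift ^ k ∈ D.group := fun k => zpow_mem D.twistLift_mem k
  have htend : ∀ k : ℤ, Tendsto (fun p : X × ℝ => (p.1, (D.twistLift ^ k).1 p.1 p.2))
      (𝓝 (D.x₀, 0)) (𝓝 (D.x₀, 0)) := fun k => by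
    have := (continuous_fst.prodMk (continuous_lift (D.twistLift ^ k))).tendsto (D.x₀, (0 : ℝ))
    simp only [D.apply_base (hmem k)] at this
    exact this
  have hpow : ∀ (k l : ℤ) (x : X) (t : ℝ), (D.twistLift ^ k).1 x ((D.twistLift ^ l).1 x t) =
      (D.twistLift ^ (k + l)).1 x t := fun k l x t => by
    rw [zpow_add]
    rfl
  refine D.group_induction (p := fun L => ∃ k : ℤ, ∀ᶠ p in 𝓝 (D.x₀, (0 : ℝ)),
    L.1 p.1 p.2 = (D.twistLift ^ k).1 p.1 p.2) ?_ (fun u => ?_) ?_ ?_ ?_ hL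
  · exact ⟨1, Eventually.of_forall fun p => by rw [zpow_one]⟩
  -- The interval `J` stays at distance `1 / 16` from the integers.
  · refine ⟨0, ?_⟩
    have : ∀ᶠ p in 𝓝 (D.x₀, (0 : ℝ)), |p.2| < 1 / 16 :=
      (continuous_abs.comp continuous_snd).continuousAt.eventually
        (eventually_lt_nhds (by norm_num))
    filter_upwards [this] with p hp
    rw [chartLift_near_base u _ hp, zpow_zero]
    rfl
  · exact ⟨0, Eventually.of_forall fun p => rfl⟩
  · rintro L M ⟨k, hk⟩ ⟨l, hl⟩
    refine ⟨k + l, ?_⟩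
    filter_upwards [hl, (htend l).eventually hk] with p h1 h2
    change L.1 p.1 (M.1 p.1 p.2) = _
    rw [h1, h2, hpow]
  · rintro L ⟨k, hk⟩
    refine ⟨-k, ?_⟩
    filter_upwards [(htend (-k)).eventually hk] with p h1
    change (L.1 p.1)⁻¹ p.2 = _
    rw [OrderIso.inv_apply_eq, h1, hpow, add_neg_cancel, zpow_zero]
    rfl

theorem lt_fibre_of_base {t : ℝ} (ht : t ∈ Ioo (0 : ℝ) (1 / 4)) : t < D.twistLift.1 D.x₀ t := by
  rw [D.twistLift_of_mem' ⟨by linarith [ht.1], by linarith [ht.2]⟩, D.fibre_base]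
  exact D.approx.lt_limit ⟨by linarith [ht.1], ht.2⟩ ht.1.ne'

theorem coe_pow_apply (L : liftGroup φ) (k : ℕ) (x : X) (t : ℝ) :
    (L ^ k).1 x t = (L.1 x)^[k] t := by
  induction k with
  | zero => rfl
  | succ k ih =>
    rw [pow_succ', Function.iterate_succ_apply', ← ih]
    rfl

theorem twistLift_base_mem {t : ℝ} (ht : t ∈ Ioo (0 : ℝ) (1 / 4)) :
    D.twistLift.1 D.x₀ t ∈ Ioo (0 : ℝ) (1 / 4) := by
  refine ⟨ht.1.trans (D.lt_fibre_of_base ht), ?_⟩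
  rw [D.twistLift_of_mem' ⟨by linarith [ht.1], by linarith [ht.2]⟩]
  exact ((suppIn_apply_mem (D.fibre_mem _)).2 ⟨by linarith [ht.1], ht.2⟩).2

/-- The base fibre of the twist preserves `(0, 1 / 4)` and moves its points to the right. Hence the
germ of `f` at `z` has infinite order. -/
theorem lt_pow_of_base {t : ℝ} (ht : t ∈ Ioo (0 : ℝ) (1 / 4)) (k : ℕ) :
    t < (D.twistLift ^ (k + 1)).1 D.x₀ t := by
  have key : ∀ k : ℕ, t ≤ (D.twistLift ^ k).1 D.x₀ t ∧
      (D.twistLift ^ k).1 D.x₀ t ∈ Ioo (0 : ℝ) (1 / 4) := by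
    intro k
    simp only [coe_pow_apply]
    induction k with
    | zero => exact ⟨le_rfl, ht⟩
    | succ k ih =>
      rw [Function.iterate_succ_apply']
      exact ⟨ih.1.trans (D.lt_fibre_of_base ih.2).le, D.twistLift_base_mem ih.2⟩
  have h := key k
  have h1 := D.lt_fibre_of_base h.2
  rw [coe_pow_apply, Function.iterate_succ_apply', ← coe_pow_apply]
  exact h.1.trans_lt h1

/-- Nontrivial powers of the twist are not the identity near the base point. -/
theorem eq_zero_of_zpow_near_base {k : ℤ}
    (h : ∀ᶠ p in 𝓝 (D.x₀, (0 : ℝ)), (D.twistLift ^ k).1 p.1 p.2 = p.2) : k = 0 := by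
  have h1 : ∀ᶠ t in 𝓝 (0 : ℝ), (D.twistLift ^ k).1 D.x₀ t = t :=
    (Continuous.prodMk_right D.x₀).continuousAt.eventually h
  obtain ⟨t, ht, hI⟩ := ((h1.filter_mono nhdsWithin_le_nhds).and
    (Ioo_mem_nhdsGT (show (0 : ℝ) < 1 / 4 by norm_num))).exists
  obtain ⟨n, rfl | rfl⟩ := k.eq_nat_or_neg
  · cases n with
    | zero => rfl
    | succ n =>
      rw [zpow_natCast] at ht
      exact absurd ht (D.lt_pow_of_base hI n).ne'
  · cases n with
    | zero => rfl
    | succ n =>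
      rw [zpow_neg, zpow_natCast] at ht
      change ((D.twistLift ^ (n + 1)).1 D.x₀)⁻¹ t = t at ht
      rw [OrderIso.inv_apply_eq] at ht
      exact absurd ht (D.lt_pow_of_base hI n).ne

end TwistData

/-! ## Minimal homeomorphisms of compact spaces -/

section Minimal

open Suspension

variable {X : Type u} [TopologicalSpace X] {φ : X ≃ₜ X}

theorem IsMinimalHomeo.exists_mem (hφ : IsMinimalHomeo φ) {U : Set X} (hU : IsOpen U)
    (hne : U.Nonempty) (x : X) : ∃ n : ℤ, (φ ^ n) x ∈ U := by
  obtain ⟨_, hy, n, rfl⟩ := (hφ x).inter_open_nonempty U hU hne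
  exact ⟨n, hy⟩

/-- Finitely many translates of `U` already cover the compact space. Starting far ahead or far
behind on an orbit gives the one-sided return times below. -/
theorem IsMinimalHomeo.exists_bounded_return [CompactSpace X] (hφ : IsMinimalHomeo φ) {U : Set X}
    (hU : IsOpen U) (hne : U.Nonempty) : ∃ M : ℤ, ∀ x, ∃ n : ℤ, |n| ≤ M ∧ (φ ^ n) x ∈ U := by
  obtain ⟨t, ht⟩ := isCompact_univ.elim_finite_subcover (fun n : ℤ => (φ ^ n) ⁻¹' U)
    (fun n => hU.preimage (φ ^ n).continuous) (fun x _ => by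
      obtain ⟨n, hn⟩ := hφ.exists_mem hU hne x
      exact mem_iUnion.2 ⟨n, hn⟩)
  refine ⟨∑ n ∈ t, |n|, fun x => ?_⟩
  obtain ⟨n, hn, hx⟩ := mem_iUnion₂.1 (ht (mem_univ x))
  exact ⟨n, Finset.single_le_sum (f := fun n : ℤ => |n|) (fun _ _ => abs_nonneg _) hn, hx⟩

theorem IsMinimalHomeo.exists_return_ge [CompactSpace X] (hφ : IsMinimalHomeo φ) {U : Set X}
    (hU : IsOpen U) (hne : U.Nonempty) (x : X) (m : ℤ) : ∃ n, m ≤ n ∧ (φ ^ n) x ∈ U := by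
  obtain ⟨M, hM⟩ := hφ.exists_bounded_return hU hne
  obtain ⟨n, hn, hx⟩ := hM ((φ ^ (m + M)) x)
  rw [zpow_apply_zpow_apply] at hx
  exact ⟨_, by have := abs_le.1 hn; lia, hx⟩

theorem IsMinimalHomeo.exists_return_le [CompactSpace X] (hφ : IsMinimalHomeo φ) {U : Set X}
    (hU : IsOpen U) (hne : U.Nonempty) (x : X) (m : ℤ) : ∃ n, n ≤ m ∧ (φ ^ n) x ∈ U := by
  obtain ⟨M, hM⟩ := hφ.exists_bounded_return hU hne
  obtain ⟨n, hn, hx⟩ := hM ((φ ^ (m - M)) x)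
  rw [zpow_apply_zpow_apply] at hx
  exact ⟨_, by have := abs_le.1 hn; lia, hx⟩

/-- The orbit of a periodic point is finite, hence closed, and being dense it would be the whole
infinite space. -/
theorem IsMinimalHomeo.isAperiodicHomeo [T1Space X] [Infinite X] (hφ : IsMinimalHomeo φ) :
    IsAperiodicHomeo φ := by
  intro n x hx
  by_contra hn
  have hfin : (range fun k : ℤ => (φ ^ k) x).Finite := by
    refine ((finite_Ico (0 : ℤ) |n|).image fun k => (φ ^ k) x).subset ?_
    rintro _ ⟨k, rfl⟩
    have hper : ∀ j : ℤ, (φ ^ (n * j)) x = x := by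
      intro j
      rw [zpow_mul]
      have hmem : φ ^ n ∈ {ψ : X ≃ₜ X | ψ x = x} := hx
      induction j with
      | zero => rfl
      | succ j ih => rw [zpow_add_one]; exact (congrArg _ hx).trans ih
      | pred j ih =>
        rw [zpow_sub_one]
        have : (φ ^ n)⁻¹ x = x := by
          change (φ ^ n).symm x = x
          rw [Homeomorph.symm_apply_eq, hx]
        exact (congrArg _ this).trans ih
    refine ⟨k % n, ⟨Int.emod_nonneg _ hn, Int.emod_lt_abs _ hn⟩, ?_⟩
    have := Int.emod_add_mul_ediv k n
    simp only
    conv_rhs => rw [← this, ← zpow_apply_zpow_apply, hper]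
  have := (hφ x).closure_eq
  rw [hfin.isClosed.closure_eq] at this
  rw [this] at hfin
  exact Set.infinite_univ hfin

end Minimal

namespace TwistData

open Suspension

variable {X : Type u} [TopologicalSpace X] {φ : X ≃ₜ X} (D : TwistData φ)

/-! ## Local constancy in the fibre direction -/

/-- Near `p`, the lift `L` does not depend on the fibre. -/
def LocConstAt (L : liftGroup φ) (p : X × ℝ) : Prop := ∀ᶠ q in 𝓝 p, L.1 q.1 q.2 = L.1 p.1 q.2

/-- The point `p` is not above the base point of the suspension. -/
def OffBase (p : X × ℝ) : Prop := ∀ n : ℤ, ¬ ((φ ^ n) p.1 = D.x₀ ∧ p.2 = n)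

theorem LocConstAt.of_shift {L : liftGroup φ} {x : X} {t : ℝ} (n : ℤ)
    (h : LocConstAt L ((φ ^ n) x, t - n)) : LocConstAt L (x, t) := by
  have hc : Continuous fun q : X × ℝ => ((φ ^ n) q.1, q.2 - n) := by fun_prop
  filter_upwards [(hc.tendsto (x, t)).eventually h] with q hq
  rw [liftGroup_shift, liftGroup_shift] at hq
  exact sub_left_injective hq

theorem locConstAt_twistLift {p : X × ℝ} (hp : D.OffBase p) : LocConstAt D.twistLift p := by
  obtain ⟨x, t⟩ := p
  obtain ⟨n, hn⟩ := exists_int_sub_mem t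
  refine LocConstAt.of_shift n ?_
  have hne : (φ ^ n) x ≠ D.x₀ ∨ t - n ≠ 0 := by
    by_contra hcon
    push Not at hcon
    exact hp n ⟨hcon.1, by linarith [hcon.2]⟩
  have hev : ∀ᶠ q : X × ℝ in 𝓝 ((φ ^ n) x, t - (n : ℝ)), q.2 ∈ Ioo (-3 / 4 : ℝ) (3 / 4) :=
    (continuous_snd.tendsto ((φ ^ n) x, t - (n : ℝ))).eventually (isOpen_Ioo.mem_nhds hn)
  filter_upwards [hev, D.fibre_locally_const hne] with q h1 h2
  rw [D.twistLift_of_mem' h1, D.twistLift_of_mem' h1, h2]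

theorem locConstAt_chartLift (u) (p : X × ℝ) : LocConstAt (chartLift φ u) p := by
  obtain ⟨x, t⟩ := p
  obtain ⟨n, hn⟩ := Suspension.exists_int_sub_mem t
  have hc : Continuous fun q : X × ℝ => q.2 - n := by fun_prop
  have hev : ∀ᶠ q : X × ℝ in 𝓝 (x, t), q.2 - n ∈ Ioo (-1 / 16 : ℝ) (17 / 16) :=
    (hc.tendsto (x, t)).eventually (isOpen_Ioo.mem_nhds hn)
  filter_upwards [hev] with q h1
  rw [chartLift_of_mem u h1, chartLift_of_mem u h1]

theorem tendsto_apply_const (L : liftGroup φ) (x : X) (t : ℝ) :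
    Tendsto (fun q : X × ℝ => (q.1, L.1 x q.2)) (𝓝 (x, t)) (𝓝 (x, L.1 x t)) :=
  (continuous_fst.prodMk ((L.1 x).continuous.comp continuous_snd)).tendsto (x, t)

theorem LocConstAt.mul {L M : liftGroup φ} {x : X} {t : ℝ} (hL : LocConstAt L (x, M.1 x t))
    (hM : LocConstAt M (x, t)) : LocConstAt (L * M) (x, t) := by
  filter_upwards [hM, (tendsto_apply_const M x t).eventually hL] with q h1 h2
  change L.1 q.1 (M.1 q.1 q.2) = L.1 x (M.1 x q.2)
  rw [h1, h2]

theorem LocConstAt.inv {L : liftGroup φ} {x : X} {t : ℝ} (hL : LocConstAt L (x, L⁻¹.1 x t)) :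
    LocConstAt L⁻¹ (x, t) := by
  filter_upwards [(tendsto_apply_const L⁻¹ x t).eventually hL] with q h2
  change (L.1 q.1)⁻¹ q.2 = _
  rw [OrderIso.inv_apply_eq, h2]
  exact ((L.1 x).apply_symm_apply _).symm

theorem OffBase.apply {p : X × ℝ} (hp : D.OffBase p) {L : liftGroup φ} (hL : L.1 D.x₀ 0 = 0) :
    D.OffBase (p.1, L.1 p.1 p.2) := by
  rintro n ⟨h1, h2⟩
  refine hp n ⟨h1, ?_⟩
  have h3 := liftGroup_shift L n p.1 p.2
  simp only at h1 h2
  rw [h1, h2, sub_self, ← hL] at h3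
  have := (L.1 D.x₀).injective h3
  linarith

/-- Every element fixes `(x₀, 0)`, so the complement of the points above `z` is invariant and local
constancy passes from the generators to products and inverses. -/
theorem locConstAt_of_mem {L : liftGroup φ} (hL : L ∈ D.group) {p : X × ℝ} (hp : D.OffBase p) :
    LocConstAt L p := by
  have key : L.1 D.x₀ 0 = 0 ∧ ∀ p, D.OffBase p → LocConstAt L p := by
    refine D.group_induction (p := fun L => L.1 D.x₀ 0 = 0 ∧ ∀ p, D.OffBase p → LocConstAt L p)
      ⟨D.apply_base D.twistLift_mem, fun p hp => D.locConstAt_twistLift hp⟩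
      (fun u => ⟨D.apply_base (D.chartLift_mem u), fun p _ => locConstAt_chartLift u p⟩)
      ⟨rfl, fun p _ => Eventually.of_forall fun q => rfl⟩ ?_ ?_ hL
    · rintro L M ⟨h1, h2⟩ ⟨h3, h4⟩
      refine ⟨?_, fun p hp => (h2 _ (hp.apply D h3)).mul (h4 p hp)⟩
      change L.1 D.x₀ (M.1 D.x₀ 0) = 0
      rw [h3, h1]
    · rintro L ⟨h1, h2⟩
      have h3 : L⁻¹.1 D.x₀ 0 = 0 := by
        change (L.1 D.x₀)⁻¹ 0 = 0
        rw [OrderIso.inv_apply_eq, h1]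
      exact ⟨h3, fun p hp => (h2 _ (hp.apply D h3)).inv⟩
  exact key.2 p hp

/-- The lift `L` is the identity near the base point. -/
def FixesGerm (L : liftGroup φ) : Prop := ∀ᶠ p in 𝓝 (D.x₀, (0 : ℝ)), L.1 p.1 p.2 = p.2

theorem FixesGerm.locConstAt {L : liftGroup φ} (hg : D.FixesGerm L) (hL : L ∈ D.group)
    (p : X × ℝ) : LocConstAt L p := by
  by_cases hp : D.OffBase p
  · exact D.locConstAt_of_mem hL hp
  · unfold OffBase at hp
    push Not at hp
    obtain ⟨n, h1, h2⟩ := hp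
    obtain ⟨x, t⟩ := p
    simp only at h1 h2
    refine LocConstAt.of_shift n ?_
    rw [h1, h2, sub_self]
    have hc : Continuous fun q : X × ℝ => (D.x₀, q.2) := by fun_prop
    filter_upwards [hg, (hc.tendsto (D.x₀, (0 : ℝ))).eventually hg] with q h3 h4
    rw [h3, h4]

/-- Tube lemma: over a compact part of the fibre, local constancy becomes uniform in the fibre
direction. -/
theorem eventually_eq_on {L : liftGroup φ} (hL : ∀ p, LocConstAt L p) (x : X) {K : Set ℝ}
    (hK : IsCompact K) : ∀ᶠ x' in 𝓝 x, ∀ t ∈ K, L.1 x' t = L.1 x t :=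
  hK.eventually_forall_of_forall_eventually fun t _ => hL (x, t)

/-! ## Generic fibres -/

/-- The point `x` is not in the orbit of the base point. -/
def Generic (x : X) : Prop := ∀ n : ℤ, (φ ^ n) x ≠ D.x₀

theorem fibre_eq_of_generic {x : X} (hx : D.Generic x) (n : ℤ) :
    ∃ m, D.fibre ((φ ^ n) x) = D.v m := by
  obtain ⟨m, hm⟩ := D.exists_mem (hx n)
  exact ⟨m, D.fibre_of_mem hm⟩

/-- A generic fibre only sees the maps `v n`, never the limit `w`, which need not be piecewise
linear. -/
theorem mem_PLR_of_generic {x : X} (hx : D.Generic x) {L : liftGroup φ} (hL : L ∈ D.group) :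
    L.1 x ∈ PLR := by
  have hloc : ∀ (w : ℝ → ℝ) (t : ℝ), (∃ n : ℤ, ∃ u ∈ PLR, ∀ᶠ y in 𝓝 t, w y = u (y - n) + n) →
      LocPL w t := by
    rintro w t ⟨n, u, hu, h⟩
    have hn := intCast_mem_dyadicRing n
    have hmem : affIso 0 n * u * affIso 0 (-n) ∈ PLR :=
      mul_mem (mul_mem (affIso_mem hn) hu) (affIso_mem (neg_mem hn))
    refine (hmem t).congr ?_
    filter_upwards [h] with y hy
    rw [hy, OrderIso.mul_apply', OrderIso.mul_apply', affIso_apply, affIso_apply]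
    simp [sub_eq_add_neg]
  have hsub : ∀ n : ℤ, Continuous fun y : ℝ => y - n := fun n => by fun_prop
  refine D.group_induction (p := fun L => L.1 x ∈ PLR) (fun t => ?_) (fun u t => ?_) (one_mem _)
    (fun L M hL hM => mul_mem hL hM) (fun L hL => inv_mem hL) hL
  · obtain ⟨n, hn⟩ := exists_int_sub_mem t
    obtain ⟨m, hm⟩ := D.fibre_eq_of_generic hx n
    refine hloc _ t ⟨n, D.v m, (Subgroup.mem_inf.1 (D.approx.mem m)).1, ?_⟩
    filter_upwards [(hsub n).continuousAt.eventually (isOpen_Ioo.mem_nhds hn)] with y hy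
    rw [D.twistLift_of_mem hy, hm]
  · obtain ⟨n, hn⟩ := Suspension.exists_int_sub_mem t
    refine hloc _ t ⟨n, u.1, u.2.1, ?_⟩
    filter_upwards [(hsub n).continuousAt.eventually (isOpen_Ioo.mem_nhds hn)] with y hy
    rw [chartLift_of_mem u hy]

/-! ## Embedding finitely generated subgroups of the germ stabiliser -/

theorem glueIso_one_right {u : ℝ ≃o ℝ} {b : ℝ} (hb : u b = b) : u b = (1 : ℝ ≃o ℝ) b := hb

theorem glueIso_one_left {a b : ℝ} (hab : a ≤ b) {u : ℝ ≃o ℝ} (ha : u a = a) (hb : u b = b) :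
    (1 : ℝ ≃o ℝ) a = glueIso b u 1 (glueIso_one_right hb) a :=
  ((glueIso_of_le _ hab).trans ha).symm

/-- Restriction to `[a, b]`, extended by the identity. -/
noncomputable def cutIso (a b : ℝ) (hab : a ≤ b) (u : ℝ ≃o ℝ) (ha : u a = a) (hb : u b = b) :
    ℝ ≃o ℝ :=
  glueIso a 1 (glueIso b u 1 (glueIso_one_right hb)) (glueIso_one_left hab ha hb)

theorem cutIso_of_mem {a b : ℝ} (hab : a ≤ b) {u : ℝ ≃o ℝ} (ha : u a = a) (hb : u b = b) {t : ℝ}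
    (ht : t ∈ Icc a b) : cutIso a b hab u ha hb t = u t :=
  (glueIso_of_ge _ ht.1).trans (glueIso_of_le _ ht.2)

theorem cutIso_of_notMem {a b : ℝ} (hab : a ≤ b) {u : ℝ ≃o ℝ} (ha : u a = a) (hb : u b = b) {t : ℝ}
    (ht : t ∉ Ioo a b) : cutIso a b hab u ha hb t = t := by
  rw [mem_Ioo, not_and_or, not_lt, not_lt] at ht
  rcases ht with ht | ht
  · exact glueIso_of_le _ ht
  · exact (glueIso_of_ge _ (hab.trans ht)).trans (glueIso_of_ge _ ht)

theorem cutIso_mem {a b : ℝ} (hab : a ≤ b) {u : ℝ ≃o ℝ} (ha : u a = a) (hb : u b = b)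
    (hu : u ∈ PLR) (had : a ∈ dyadicRing) (hbd : b ∈ dyadicRing) :
    cutIso a b hab u ha hb ∈ PLS a b :=
  Subgroup.mem_inf.2 ⟨glueIso_mem _ had (one_mem _) (glueIso_mem _ hbd hu (one_mem _)),
    fun _ ht => cutIso_of_notMem hab ha hb ht⟩

theorem apply_mem_Icc {a b : ℝ} {u : ℝ ≃o ℝ} (ha : u a = a) (hb : u b = b) {t : ℝ}
    (ht : t ∈ Icc a b) : u t ∈ Icc a b :=
  ⟨ha.symm.le.trans (u.monotone ht.1), (u.monotone ht.2).trans hb.le⟩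

/-- If a group of lifts fixes the points `a < b` of the fibre of a generic point `x`, restriction
to `[a, b]` defines a homomorphism to a copy of Thompson's group. -/
noncomputable def restrictHom {x : X} (hx : D.Generic x) (K : Subgroup (liftGroup φ))
    (hK : K ≤ D.group) {a b : ℤ} (hab : (a : ℝ) ≤ b) (ha : ∀ L ∈ K, L.1 x a = a)
    (hb : ∀ L ∈ K, L.1 x b = b) : K →* PLS a b where
  toFun L := ⟨cutIso a b hab (L.1.1 x) (ha _ L.2) (hb _ L.2),
    cutIso_mem _ _ _ (D.mem_PLR_of_generic hx (hK L.2)) (intCast_mem_dyadicRing a)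
      (intCast_mem_dyadicRing b)⟩
  map_one' := by
    apply Subtype.ext
    ext t
    by_cases ht : t ∈ Icc (a : ℝ) b
    · exact cutIso_of_mem hab (ha 1 (one_mem K)) (hb 1 (one_mem K)) ht
    · exact cutIso_of_notMem hab (ha 1 (one_mem K)) (hb 1 (one_mem K))
        fun h => ht (Ioo_subset_Icc_self h)
  map_mul' L M := by
    apply Subtype.ext
    ext t
    have haL := ha _ L.2
    have hbL := hb _ L.2
    have haM := ha _ M.2
    have hbM := hb _ M.2
    have haP := ha _ (L * M).2
    have hbP := hb _ (L * M).2
    change cutIso _ _ hab ((L * M).1.1 x) haP hbP t =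
      cutIso _ _ hab (L.1.1 x) haL hbL (cutIso _ _ hab (M.1.1 x) haM hbM t)
    by_cases ht : t ∈ Icc (a : ℝ) b
    · rw [cutIso_of_mem hab haP hbP ht, cutIso_of_mem hab haM hbM ht,
        cutIso_of_mem hab haL hbL (apply_mem_Icc haM hbM ht)]
      rfl
    · have ht' : t ∉ Ioo (a : ℝ) b := fun h => ht (Ioo_subset_Icc_self h)
      rw [cutIso_of_notMem hab haP hbP ht', cutIso_of_notMem hab haM hbM ht',
        cutIso_of_notMem hab haL hbL ht']

/-- Because the generators preserve `[p, q]` on the fibre of `x`, a word never leaves the interval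
where the two fibres agree. -/
theorem apply_eq_on_of_generators {S : Set (liftGroup φ)} {x y : X} {p q : ℝ}
    (hp : ∀ L ∈ S, L.1 x p = p) (hq : ∀ L ∈ S, L.1 x q = q)
    (hxy : ∀ L ∈ S, ∀ t ∈ Icc p q, L.1 x t = L.1 y t) {L : liftGroup φ}
    (hL : L ∈ Subgroup.closure S) : ∀ t ∈ Icc p q, L.1 x t = L.1 y t := by
  have key : L.1 x p = p ∧ L.1 x q = q ∧ ∀ t ∈ Icc p q, L.1 x t = L.1 y t := by
    induction hL using Subgroup.closure_induction with
    | mem L hL => exact ⟨hp L hL, hq L hL, hxy L hL⟩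
    | one => exact ⟨rfl, rfl, fun t _ => rfl⟩
    | mul L M _ _ hL hM =>
      obtain ⟨h1, h2, h3⟩ := hL
      obtain ⟨h4, h5, h6⟩ := hM
      refine ⟨?_, ?_, fun t ht => ?_⟩
      · change L.1 x (M.1 x p) = p
        rw [h4, h1]
      · change L.1 x (M.1 x q) = q
        rw [h5, h2]
      · change L.1 x (M.1 x t) = L.1 y (M.1 y t)
        rw [h3 _ (apply_mem_Icc h4 h5 ht), h6 t ht]
    | inv L _ hL =>
      obtain ⟨h1, h2, h3⟩ := hL
      have h4 : (L.1 x)⁻¹ p = p := by rw [OrderIso.inv_apply_eq, h1]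
      have h5 : (L.1 x)⁻¹ q = q := by rw [OrderIso.inv_apply_eq, h2]
      refine ⟨h4, h5, fun t ht => ?_⟩
      change (L.1 x)⁻¹ t = (L.1 y)⁻¹ t
      rw [eq_comm, OrderIso.inv_apply_eq, ← h3 _ (apply_mem_Icc h4 h5 ht)]
      exact ((L.1 x).apply_symm_apply t).symm
  exact key.2.2

theorem apply_fixed_of_generators {S : Set (liftGroup φ)} {x : X} {p : ℝ}
    (hp : ∀ L ∈ S, L.1 x p = p) {L : liftGroup φ} (hL : L ∈ Subgroup.closure S) :
    L.1 x p = p := by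
  induction hL using Subgroup.closure_induction with
  | mem L hL => exact hp L hL
  | one => rfl
  | mul L M _ _ hL hM =>
    change L.1 x (M.1 x p) = p
    rw [hM, hL]
  | inv L _ hL =>
    change (L.1 x)⁻¹ p = p
    rw [OrderIso.inv_apply_eq, hL]

theorem apply_int_of_shift {L : liftGroup φ} {x : X} {n : ℤ} (h : L.1 ((φ ^ n) x) 0 = 0) :
    L.1 x n = n := by
  have := liftGroup_shift L n x n
  rw [sub_self, h] at this
  linarith

/-- Every local pattern of the generators recurs in a bounded interval `[a, b]` of the fibre of
`x₁`, cut at integers that they all fix, so an element trivial on this interval is trivial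
everywhere. -/
theorem exists_injective_of_fixesGerm [CompactSpace X] (hφ : IsMinimalHomeo φ) {x₁ : X}
    (hx₁ : D.Generic x₁) (S : Finset (liftGroup φ)) (hS : ∀ L ∈ S, L ∈ D.group)
    (hg : ∀ L ∈ S, D.FixesGerm L) :
    ∃ i : Subgroup.closure (S : Set (liftGroup φ)) →* ThompsonF, Function.Injective i := by
  have hK : Subgroup.closure (S : Set (liftGroup φ)) ≤ D.group := (Subgroup.closure_le _).2 hS
  have hlc : ∀ L ∈ S, ∀ p, LocConstAt L p := fun L hL => (hg L hL).locConstAt D (hS L hL)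
  have hev : ∀ᶠ x in 𝓝 D.x₀, ∀ L ∈ S, L.1 x 0 = 0 := by
    refine (Finset.eventually_all _).2 fun L hL => ?_
    exact (Continuous.prodMk_left (0 : ℝ)).continuousAt.eventually (hg L hL)
  -- A visit of the orbit of `x` to `U` at time `n` makes `n` a common fixed point of the generators
  -- on the fibre of `x`.
  obtain ⟨U, hUsub, hUo, hxU⟩ := mem_nhds_iff.1 hev
  have hfix : ∀ x (n : ℤ), (φ ^ n) x ∈ U → ∀ L ∈ S, L.1 x n = n :=
    fun x n hn L hL => apply_int_of_shift (hUsub hn L hL)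
  choose P hP0 hPU using fun x => hφ.exists_return_le hUo ⟨_, hxU⟩ x 0
  choose Q hQ1 hQU using fun x => hφ.exists_return_ge hUo ⟨_, hxU⟩ x 1
  -- Over `N x` the generators act alike on `[P x, Q x]`, an interval containing `[0, 1]` with
  -- endpoints at visits to `U`.
  let N : X → Set X := fun x => {x' | (φ ^ P x) x' ∈ U ∧ (φ ^ Q x) x' ∈ U ∧
    ∀ L ∈ S, ∀ t ∈ Icc (P x : ℝ) (Q x), L.1 x' t = L.1 x t}
  have hN : ∀ x, N x ∈ 𝓝 x := by
    intro x
    have h1 : ∀ᶠ x' in 𝓝 x, (φ ^ P x) x' ∈ U :=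
      (φ ^ P x).continuous.continuousAt.eventually (hUo.mem_nhds (hPU x))
    have h2 : ∀ᶠ x' in 𝓝 x, (φ ^ Q x) x' ∈ U :=
      (φ ^ Q x).continuous.continuousAt.eventually (hUo.mem_nhds (hQU x))
    have h3 : ∀ᶠ x' in 𝓝 x, ∀ L ∈ S, ∀ t ∈ Icc (P x : ℝ) (Q x), L.1 x' t = L.1 x t :=
      (Finset.eventually_all _).2 fun L hL => eventually_eq_on (hlc L hL) x isCompact_Icc
    filter_upwards [h1, h2, h3] with x' a b c using ⟨a, b, c⟩
  obtain ⟨T, -, hT⟩ := isCompact_univ.elim_nhds_subcover N fun x _ => hN x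
  have hvisit : ∀ x, ∃ j : ℤ, (φ ^ j) x₁ ∈ N x := by
    intro x
    obtain ⟨j, hj⟩ := hφ.exists_mem isOpen_interior
      ⟨x, mem_interior_iff_mem_nhds.2 (hN x)⟩ x₁
    exact ⟨j, interior_subset hj⟩
  choose J hJ using hvisit
  -- Each of the finitely many patterns appears on the fibre of `x₁`, shifted by `J x`; all these
  -- copies lie in `[-B, B]`.
  let B : ℤ := ∑ x ∈ T, (|J x + P x| + |J x + Q x|)
  have hB : ∀ x ∈ T, -B ≤ J x + P x ∧ J x + Q x ≤ B := by
    intro x hx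
    have h1 : |J x + P x| + |J x + Q x| ≤ B :=
      Finset.single_le_sum (f := fun x => |J x + P x| + |J x + Q x|)
        (fun _ _ => by positivity) hx
    have h2 := neg_abs_le (J x + P x)
    have h3 := le_abs_self (J x + Q x)
    have h4 := abs_nonneg (J x + P x)
    have h5 := abs_nonneg (J x + Q x)
    constructor <;> lia
  have hB0 : 0 ≤ B := Finset.sum_nonneg fun _ _ => by positivity
  obtain ⟨a, haB, haU⟩ := hφ.exists_return_le hUo ⟨_, hxU⟩ x₁ (-B)
  obtain ⟨b, hbB, hbU⟩ := hφ.exists_return_ge hUo ⟨_, hxU⟩ x₁ B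
  have hab : a ≤ b := by lia
  obtain ⟨i, hi⟩ := exists_injective_PLS_int a b
  have hab' : (a : ℝ) ≤ b := by exact_mod_cast hab
  let r := D.restrictHom hx₁ _ hK hab'
    (fun L hL => apply_fixed_of_generators (hfix x₁ a haU) hL)
    (fun L hL => apply_fixed_of_generators (hfix x₁ b hbU) hL)
  refine ⟨i.comp r, hi.comp ?_⟩
  rw [injective_iff_map_eq_one]
  intro L hL
  have hL1 : ∀ t ∈ Icc (a : ℝ) b, L.1.1 x₁ t = t := by
    intro t ht
    have h1 : (r L).1 t = t := by rw [hL]; rfl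
    have h2 : (r L).1 t = L.1.1 x₁ t := cutIso_of_mem hab'
      (apply_fixed_of_generators (hfix x₁ a haU) L.2)
      (apply_fixed_of_generators (hfix x₁ b hbU) L.2) ht
    exact h2.symm.trans h1
  -- The action on `[0, 1]` over any `x` is a translate of the action on a part of `[a, b]` over
  -- `x₁`. Equivariance then covers the whole fibre.
  have hunit : ∀ x, ∀ t ∈ Icc (0 : ℝ) 1, L.1.1 x t = t := by
    intro x t ht
    obtain ⟨x', hx'T, hx'⟩ := mem_iUnion₂.1 (hT (mem_univ x))
    obtain ⟨h1, h2, h3⟩ := hx'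
    obtain ⟨h4, h5, h6⟩ := hJ x'
    have hP : ((P x' : ℤ) : ℝ) ≤ 0 := by exact_mod_cast hP0 x'
    have hQ : (1 : ℝ) ≤ Q x' := by exact_mod_cast hQ1 x'
    rw [apply_eq_on_of_generators (S := (S : Set (liftGroup φ))) (y := (φ ^ J x') x₁)
      (fun M hM => hfix x _ h1 M hM) (fun M hM => hfix x _ h2 M hM)
      (fun M hM t ht => (h3 M hM t ht).trans (h6 M hM t ht).symm) L.2 t
      ⟨hP.trans ht.1, ht.2.trans hQ⟩]
    have h7 := liftGroup_shift L.1 (J x') x₁ (t + J x')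
    rw [add_sub_cancel_right] at h7
    obtain ⟨h8, h9⟩ := hB x' hx'T
    have h8' : (a : ℝ) ≤ J x' + P x' := by exact_mod_cast haB.trans h8
    have h9' : (J x' : ℝ) + Q x' ≤ b := by exact_mod_cast h9.trans hbB
    rw [h7, hL1 _ ⟨by linarith [ht.1], by linarith [ht.2]⟩, add_sub_cancel_right]
  apply Subtype.ext
  apply Subtype.ext
  funext x
  ext t
  have h1 := liftGroup_shift L.1 ⌊t⌋ x t
  rw [hunit _ _ ⟨sub_nonneg.2 (Int.floor_le t), by linarith [Int.lt_floor_add_one t]⟩] at h1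
  change L.1.1 x t = t
  linarith

/-! ## The germ stabiliser -/

theorem exists_zpow_mul_fixesGerm {L : liftGroup φ} (hL : L ∈ D.group) :
    ∃ k : ℤ, D.FixesGerm ((D.twistLift ^ k)⁻¹ * L) := by
  obtain ⟨k, hk⟩ := D.exists_zpow_near_base hL
  refine ⟨k, ?_⟩
  filter_upwards [hk] with p hp
  change ((D.twistLift ^ k).1 p.1)⁻¹ (L.1 p.1 p.2) = p.2
  rw [OrderIso.inv_apply_eq, hp]

/-- The group generated by the twist and `F_{X,J}` is isomorphic to its group of lifts. -/
noncomputable def groupEquiv (hφ : IsAperiodicHomeo φ) :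
    D.group ≃* twistGroup φ (descendHom D.twistLift) :=
  (D.group.equivMapOfInjective descendHom (descendHom_injective hφ)).trans
    (MulEquiv.subgroupCongr D.map_group)

theorem groupEquiv_apply (hφ : IsAperiodicHomeo φ) (L : D.group) :
    (D.groupEquiv hφ L).1 = descendHom L.1 := rfl

theorem groupEquiv_mem_germStabilizer_iff (hφ : IsAperiodicHomeo φ) (L : D.group) :
    D.groupEquiv hφ L ∈ germStabilizer φ (twistGroup φ (descendHom D.twistLift))
      (proj φ D.x₀ 0) ↔ D.FixesGerm L.1 := by
  change (∀ᶠ y in 𝓝 (proj φ D.x₀ 0), (descendHom L.1).1 y = y) ↔ _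
  rw [← map_proj_nhds, eventually_map]
  simp only [descendHom_proj, proj_injective_right hφ]
  rfl

theorem apply_proj_base (hφ : IsAperiodicHomeo φ)
    (g : twistGroup φ (descendHom D.twistLift)) : g.1.1 (proj φ D.x₀ 0) = proj φ D.x₀ 0 := by
  obtain ⟨L, rfl⟩ := (D.groupEquiv hφ).surjective g
  rw [groupEquiv_apply, descendHom_proj, D.apply_base L.2]

theorem germStabilizer_normal (hφ : IsAperiodicHomeo φ) :
    (germStabilizer φ (twistGroup φ (descendHom D.twistLift)) (proj φ D.x₀ 0)).Normal := by
  refine ⟨fun n hn g => ?_⟩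
  have hn' : ∀ᶠ y in 𝓝 (proj φ D.x₀ 0), n.1.1 y = y := hn
  have h1 : Tendsto (g⁻¹).1.1 (𝓝 (proj φ D.x₀ 0)) (𝓝 (proj φ D.x₀ 0)) := by
    have := (g⁻¹).1.1.continuous.tendsto (proj φ D.x₀ 0)
    rwa [D.apply_proj_base hφ] at this
  change ∀ᶠ y in 𝓝 (proj φ D.x₀ 0), g.1.1 (n.1.1 ((g⁻¹).1.1 y)) = y
  filter_upwards [h1.eventually hn'] with y hy
  rw [hy]
  exact g.1.1.apply_symm_apply y

theorem groupEquiv_twistLift (hφ : IsAperiodicHomeo φ) :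
    D.groupEquiv hφ ⟨D.twistLift, D.twistLift_mem⟩ = twistGen φ (descendHom D.twistLift) := rfl

theorem exists_zpow_mul_mem (hφ : IsAperiodicHomeo φ)
    (g : twistGroup φ (descendHom D.twistLift)) :
    ∃ k : ℤ, ∃ n ∈ germStabilizer φ (twistGroup φ (descendHom D.twistLift)) (proj φ D.x₀ 0),
      g = twistGen φ (descendHom D.twistLift) ^ k * n := by
  obtain ⟨L, rfl⟩ := (D.groupEquiv hφ).surjective g
  obtain ⟨k, hk⟩ := D.exists_zpow_mul_fixesGerm L.2
  have hT : ∃ T : D.group, T.1 = D.twistLift ∧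
      D.groupEquiv hφ T = twistGen φ (descendHom D.twistLift) := ⟨_, rfl, D.groupEquiv_twistLift hφ⟩
  obtain ⟨T, hT, hT'⟩ := hT
  refine ⟨k, D.groupEquiv hφ ((T ^ k)⁻¹ * L),
    (D.groupEquiv_mem_germStabilizer_iff hφ _).2 ?_, ?_⟩
  · rw [← hT] at hk
    exact hk
  · rw [map_mul, map_inv, map_zpow, hT', mul_inv_cancel_left]

theorem eq_zero_of_zpow_mem (hφ : IsAperiodicHomeo φ) {k : ℤ}
    (h : twistGen φ (descendHom D.twistLift) ^ k ∈
      germStabilizer φ (twistGroup φ (descendHom D.twistLift)) (proj φ D.x₀ 0)) : k = 0 := by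
  have hT : ∃ T : D.group, T.1 = D.twistLift ∧
      D.groupEquiv hφ T = twistGen φ (descendHom D.twistLift) := ⟨_, rfl, D.groupEquiv_twistLift hφ⟩
  obtain ⟨T, hT, hT'⟩ := hT
  rw [← hT', ← map_zpow, groupEquiv_mem_germStabilizer_iff] at h
  refine D.eq_zero_of_zpow_near_base ?_
  rw [← hT]
  exact h

theorem isComplement'_germStabilizer (hφ : IsAperiodicHomeo φ) :
    Subgroup.IsComplement'
      (germStabilizer φ (twistGroup φ (descendHom D.twistLift)) (proj φ D.x₀ 0))
      (Subgroup.zpowers (twistGen φ (descendHom D.twistLift))) := by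
  refine Subgroup.isComplement'_of_disjoint_and_mul_eq_univ ?_ ?_
  · rw [Subgroup.disjoint_def]
    rintro _ hx ⟨k, rfl⟩
    simp only at hx
    rw [D.eq_zero_of_zpow_mem hφ hx]
    exact zpow_zero _
  · refine eq_univ_of_forall fun g => ?_
    -- The available factorisation has the power of `f` first; applying it to `g⁻¹` reverses the
    -- order.
    obtain ⟨k, n, hn, h⟩ := D.exists_zpow_mul_mem hφ g⁻¹
    refine ⟨n⁻¹, inv_mem hn, (twistGen φ (descendHom D.twistLift)) ^ (-k), ⟨-k, rfl⟩, ?_⟩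
    rw [← inv_inv g, h]
    simp

theorem not_isOfFinOrder_twistGen (hφ : IsAperiodicHomeo φ) :
    ¬ IsOfFinOrder (twistGen φ (descendHom D.twistLift)) := by
  rw [isOfFinOrder_iff_pow_eq_one]
  rintro ⟨n, hn, h⟩
  have := D.eq_zero_of_zpow_mem hφ (k := n) (by
    rw [zpow_natCast, h]
    exact one_mem _)
  lia

theorem exists_injective_thompsonF [CompactSpace X] (hφ : IsMinimalHomeo φ)
    (hφ' : IsAperiodicHomeo φ) {x₁ : X} (hx₁ : D.Generic x₁)
    (K : Subgroup (twistGroup φ (descendHom D.twistLift)))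
    (hK : K ≤ germStabilizer φ (twistGroup φ (descendHom D.twistLift)) (proj φ D.x₀ 0))
    (hfg : K.FG) : ∃ i : K →* ThompsonF, Function.Injective i := by
  classical
  obtain ⟨S, rfl⟩ := hfg
  let e := D.groupEquiv hφ'
  let S' : Finset (liftGroup φ) := S.image fun g => (e.symm g).1
  obtain ⟨i, hi⟩ := D.exists_injective_of_fixesGerm hφ hx₁ S' (fun L hL => by
      obtain ⟨g, -, rfl⟩ := Finset.mem_image.1 hL
      exact (e.symm g).2) (fun L hL => by
      obtain ⟨g, hg, rfl⟩ := Finset.mem_image.1 hL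
      rw [← D.groupEquiv_mem_germStabilizer_iff hφ']
      change e (e.symm g) ∈ _
      rw [e.apply_symm_apply]
      exact hK (Subgroup.subset_closure hg))
  let j : twistGroup φ (descendHom D.twistLift) →* liftGroup φ :=
    D.group.subtype.comp e.symm.toMonoidHom
  have hj : Function.Injective j := Subtype.val_injective.comp e.symm.injective
  have hjmem : ∀ g ∈ Subgroup.closure (S : Set (twistGroup φ (descendHom D.twistLift))),
      j g ∈ Subgroup.closure (S' : Set (liftGroup φ)) := by
    intro g hg
    have := Subgroup.mem_map_of_mem j hg
    rw [MonoidHom.map_closure] at this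
    refine Subgroup.closure_mono ?_ this
    rintro _ ⟨h, hh, rfl⟩
    exact Finset.mem_coe.2 (Finset.mem_image.2 ⟨h, hh, rfl⟩)
  let j' := (j.comp (Subgroup.subtype _)).codRestrict
    (Subgroup.closure (S' : Set (liftGroup φ))) fun g => hjmem g.1 g.2
  refine ⟨i.comp j', hi.comp fun g h hgh => ?_⟩
  have hval : j g.1 = j h.1 := congrArg (fun a => a.1) hgh
  exact Subtype.ext (hj hval)

end TwistData

/-! ## Dynamics of dyadic piecewise linear homeomorphisms -/

theorem OrderIso.one_apply' {α : Type*} [LE α] (t : α) : (1 : α ≃o α) t = t := rfl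

theorem exists_dyadic_between {c d : ℝ} (h : c < d) : ∃ q ∈ dyadicRing, c < q ∧ q < d := by
  obtain ⟨k, hk⟩ := exists_two_pow_lt (sub_pos.2 h)
  have h2 : (0 : ℝ) < 2 ^ (k + 1) := by positivity
  have h3 := Int.floor_le (c * 2 ^ (k + 1))
  have h4 := Int.lt_floor_add_one (c * 2 ^ (k + 1))
  refine ⟨((⌊c * 2 ^ (k + 1)⌋ + 1 : ℤ) : ℝ) / 2 ^ (k + 1), div_two_pow_mem_dyadicRing _ _, ?_, ?_⟩
  · rw [lt_div_iff₀ h2]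
    push_cast
    exact h4
  · rw [div_lt_iff₀ h2]
    rw [div_lt_iff₀ h2, sub_mul] at hk
    push_cast
    linarith

theorem half_mul_mem_dyadicRing {q : ℝ} (hq : q ∈ dyadicRing) : q / 2 ∈ dyadicRing := by
  rw [div_eq_mul_one_div]
  exact mul_mem hq half_mem_dyadicRing

/-- A bump with slopes `2`, `1`, `1 / 2` and breakpoints `p`, `p + e`, `q - 2 * e`, `q`, which
translates by `e` in the middle. The dyadic number `e` is taken below `(q - p) / 4` so that the
breakpoints are in order. -/
theorem exists_lt_apply {p q : ℝ} (hp : p ∈ dyadicRing) (hq : q ∈ dyadicRing) (hpq : p < q) :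
    ∃ u ∈ PLS p q, ∀ t ∈ Ioo p q, t < u t := by
  obtain ⟨k, hk⟩ := exists_two_pow_lt (show 0 < (q - p) / 4 by linarith)
  obtain ⟨e, he⟩ : ∃ e : ℝ, e = 1 / 2 ^ (k + 1) := ⟨_, rfl⟩
  rw [← he] at hk
  have he0 : 0 < e := by rw [he]; positivity
  have hed : e ∈ dyadicRing := mem_dyadicRing_of_eq 1 (k + 1) (by rw [he]; norm_num)
  have e1 : affIso (-1) (q / 2) q = (1 : ℝ ≃o ℝ) q := by
    rw [affIso_apply, OrderIso.one_apply']; norm_num; ring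
  have e2 : affIso 0 e (q - 2 * e) = glueIso q (affIso (-1) (q / 2)) 1 e1 (q - 2 * e) := by
    rw [glueIso_of_le _ (by linarith), affIso_apply, affIso_apply]; norm_num; ring
  have e3 : affIso 1 (-p) (p + e) = glueIso (q - 2 * e) (affIso 0 e) _ e2 (p + e) := by
    rw [glueIso_of_le _ (by linarith), affIso_apply, affIso_apply]; norm_num; ring
  have e4 : (1 : ℝ ≃o ℝ) p = glueIso (p + e) (affIso 1 (-p)) _ e3 p := by
    rw [glueIso_of_le _ (by linarith), affIso_apply, OrderIso.one_apply']; norm_num; ring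
  refine ⟨glueIso p 1 _ e4, Subgroup.mem_inf.2 ⟨?_, fun t ht => ?_⟩, fun t ht => ?_⟩
  · have h2e : q - 2 * e ∈ dyadicRing := sub_mem hq (mul_mem (ofNat_mem dyadicRing 2) hed)
    exact glueIso_mem _ hp (one_mem _) (glueIso_mem _ (add_mem hp hed) (affIso_mem (neg_mem hp))
      (glueIso_mem _ h2e (affIso_mem hed) (glueIso_mem _ hq
        (affIso_mem (half_mul_mem_dyadicRing hq)) (one_mem _))))
  · rw [mem_Ioo, not_and_or, not_lt, not_lt] at ht
    rcases ht with ht | ht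
    · rw [glueIso_of_le _ ht, OrderIso.one_apply']
    · rw [glueIso_of_ge _ (by linarith), glueIso_of_ge _ (by linarith),
        glueIso_of_ge _ (by linarith), glueIso_of_ge _ ht, OrderIso.one_apply']
  · rw [glueIso_of_ge _ ht.1.le]
    rcases le_total t (p + e) with h1 | h1
    · rw [glueIso_of_le _ h1, affIso_apply]
      norm_num
      linarith [ht.1]
    rw [glueIso_of_ge _ h1]
    rcases le_total t (q - 2 * e) with h2 | h2
    · rw [glueIso_of_le _ h2, affIso_apply]
      norm_num
      exact he0
    · rw [glueIso_of_ge _ h2, glueIso_of_le _ ht.2.le, affIso_apply]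
      norm_num
      linarith [ht.2]

theorem iterate_mem_of_suppIn {a b : ℝ} {u : ℝ ≃o ℝ} (hu : u ∈ suppIn a b) {t : ℝ}
    (ht : t ∈ Ioo a b) (N : ℕ) : u^[N] t ∈ Ioo a b := by
  induction N with
  | zero => exact ht
  | succ N ih =>
    rw [Function.iterate_succ_apply']
    exact (suppIn_apply_mem hu).2 ih

/-- The iterates of a homeomorphism moving points to the right accumulate at the right end. -/
theorem exists_lt_iterate {a b : ℝ} {u : ℝ ≃o ℝ} (hu : u ∈ suppIn a b)
    (hlt : ∀ t ∈ Ioo a b, t < u t) {t s : ℝ} (ht : t ∈ Ioo a b) (hs : s < b) :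
    ∃ N : ℕ, s < u^[N] t := by
  by_contra! hcon
  have hmem := iterate_mem_of_suppIn hu ht
  have hmono : Monotone fun N : ℕ => u^[N] t := monotone_nat_of_le_succ fun N => by
    rw [Function.iterate_succ_apply']
    exact (hlt _ (hmem N)).le
  have hbdd : BddAbove (range fun N : ℕ => u^[N] t) := ⟨s, by rintro _ ⟨N, rfl⟩; exact hcon N⟩
  have hlim := tendsto_atTop_ciSup hmono hbdd
  have hfix := isFixedPt_of_tendsto_iterate hlim u.continuous.continuousAt
  have h1 : t ≤ ⨆ N : ℕ, u^[N] t := le_ciSup hbdd 0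
  have h2 : (⨆ N : ℕ, u^[N] t) ≤ s := ciSup_le hcon
  exact (hlt _ ⟨ht.1.trans_le h1, h2.trans_lt hs⟩).ne' hfix

theorem OrderIso.coe_pow_eq_iterate {α : Type*} [LE α] (u : α ≃o α) (N : ℕ) :
    ⇑(u ^ N) = u^[N] := by
  induction N with
  | zero => rfl
  | succ N ih => rw [pow_succ', Function.iterate_succ', ← ih]; rfl

theorem PLS_mono {a b c d : ℝ} (hac : c ≤ a) (hbd : b ≤ d) : PLS a b ≤ PLS c d := fun _ hu =>
  Subgroup.mem_inf.2 ⟨hu.1, fun t ht => hu.2 t fun h => ht ⟨hac.trans_lt h.1, h.2.trans_le hbd⟩⟩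

/-- The orbits of the group of dyadic piecewise linear homeomorphisms of an interval are dense. -/
theorem exists_PLS_apply_mem {a b : ℝ} (ha : a ∈ dyadicRing) (hb : b ∈ dyadicRing) {t s : ℝ}
    (ht : t ∈ Ioo a b) (hs : s ∈ Ioo a b) {U : Set ℝ} (hU : U ∈ 𝓝 s) :
    ∃ u ∈ PLS a b, u t ∈ U := by
  rcases lt_trichotomy t s with h | rfl | h
  · obtain ⟨c, hc, hcU⟩ := exists_Ico_subset_of_mem_nhds hU ⟨b, hs.2⟩
    -- A bump supported up to a dyadic `q` just beyond `s` pushes `t` past `s` but never past `q`.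
    -- In the opposite case the inverse of such a bump pulls `t` back below `s`, staying above a
    -- dyadic `p`.
    obtain ⟨q, hq, hsq, hqc⟩ := exists_dyadic_between (lt_min hc hs.2)
    obtain ⟨u, hu, hlt⟩ := exists_lt_apply ha hq (hs.1.trans hsq)
    obtain ⟨N, hN⟩ := exists_lt_iterate hu.2 hlt ⟨ht.1, h.trans hsq⟩ hsq
    have h1 := iterate_mem_of_suppIn hu.2 ⟨ht.1, h.trans hsq⟩ N
    refine ⟨u ^ N, PLS_mono le_rfl (hqc.le.trans (min_le_right _ _)) (pow_mem hu N), hcU ?_⟩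
    rw [OrderIso.coe_pow_eq_iterate]
    exact ⟨hN.le, h1.2.trans (hqc.trans_le (min_le_left _ _))⟩
  · exact ⟨1, one_mem _, mem_of_mem_nhds hU⟩
  · obtain ⟨c, hc, hcU⟩ := exists_Ioc_subset_of_mem_nhds hU ⟨a, hs.1⟩
    obtain ⟨p, hp, hcp, hps⟩ := exists_dyadic_between (max_lt hc hs.1)
    obtain ⟨u, hu, hlt⟩ := exists_lt_apply hp hb (hps.trans hs.2)
    obtain ⟨N, hN⟩ := exists_lt_iterate hu.2 hlt ⟨hps, hs.2⟩ ht.2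
    have hN' : (u ^ N) ∈ PLS p b := pow_mem hu N
    have hinv : u ^ N * (u ^ N)⁻¹ = 1 := mul_inv_cancel _
    have h0 : (u ^ N) ((u ^ N)⁻¹ t) = t := congrArg (fun w : ℝ ≃o ℝ => w t) hinv
    refine ⟨(u ^ N)⁻¹, inv_mem (PLS_mono ((le_max_right _ _).trans hcp.le) le_rfl hN'), hcU ?_⟩
    have h1 := (suppIn_apply_mem (inv_mem hN'.2)).2 (show t ∈ Ioo p b from ⟨hps.trans h, ht.2⟩)
    refine ⟨(le_max_left _ _).trans_lt (hcp.trans h1.1), ?_⟩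
    rw [← OrderIso.coe_pow_eq_iterate] at hN
    rw [← (u ^ N).le_iff_le, h0]
    exact hN.le

/-! ## The intervals supporting the chart group -/

/-- The union of the translates of `J = (1/16, 1 - 1/16)` by integers. -/
def chartSet : Set ℝ := {t | t - ⌊t⌋ ∈ Ioo (1 / 16 : ℝ) (1 - 1 / 16)}

theorem floor_eq_of_mem_chart {t : ℝ} {n : ℤ} (h : t - n ∈ Ioo (1 / 16 : ℝ) (1 - 1 / 16)) :
    ⌊t⌋ = n :=
  Int.floor_eq_iff.2 ⟨by linarith [h.1], by linarith [h.2]⟩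

theorem mem_chartSet_of_sub {t : ℝ} {n : ℤ} (h : t - n ∈ Ioo (1 / 16 : ℝ) (1 - 1 / 16)) :
    t ∈ chartSet := by
  rw [chartSet, mem_ofPred_eq, floor_eq_of_mem_chart h]
  exact h

theorem intCast_notMem_chartSet (n : ℤ) : (n : ℝ) ∉ chartSet := by
  rw [chartSet, mem_ofPred_eq, Int.floor_intCast, sub_self]
  exact fun h => absurd h.1 (by norm_num)

/-- Integers separate the translates of `J`. Lying in the same translate is thus expressed by the
order and the set alone, and is preserved by any increasing homeomorphism preserving the set. -/
theorem floor_eq_iff_Icc_subset {s t : ℝ} (hs : s ∈ chartSet) (ht : t ∈ chartSet) (hst : s ≤ t) :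
    ⌊s⌋ = ⌊t⌋ ↔ Icc s t ⊆ chartSet := by
  constructor
  · intro h r hr
    refine mem_chartSet_of_sub (n := ⌊s⌋) ⟨by linarith [hs.1, hr.1], ?_⟩
    rw [h]
    linarith [ht.2, hr.2]
  · intro h
    refine le_antisymm (Int.floor_mono hst) (not_lt.1 fun hlt => ?_)
    exact intCast_notMem_chartSet ⌊t⌋ (h ⟨(Int.floor_lt.1 hlt).le, Int.floor_le t⟩)

theorem add_half_mem_chart (n : ℤ) : (n + 1 / 2 : ℝ) - n ∈ Ioo (1 / 16 : ℝ) (1 - 1 / 16) := by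
  rw [add_sub_cancel_left]
  norm_num

theorem int_eq_add_of_strictMono_surjective {σ : ℤ → ℤ} (hm : StrictMono σ)
    (hs : Function.Surjective σ) (n : ℤ) : σ n = n + σ 0 := by
  have hstep : ∀ n, σ (n + 1) = σ n + 1 := by
    intro n
    obtain ⟨m, hm'⟩ := hs (σ n + 1)
    have h1 : n < m := hm.lt_iff_lt.1 (by lia)
    have h2 : σ (n + 1) ≤ σ m := hm.monotone (by lia)
    have h3 : σ n < σ (n + 1) := hm (by lia)
    lia
  induction n with
  | zero => simp
  | succ n ih => rw [hstep, ih]; ring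
  | pred n ih =>
    have := hstep (-n - 1)
    rw [sub_add_cancel] at this
    lia

/-- A homeomorphism of the line preserving the union of the translates of `J` shifts them. -/
theorem exists_floor_apply_eq (h : ℝ ≃o ℝ) (hA : ∀ t, h t ∈ chartSet ↔ t ∈ chartSet) :
    ∃ k : ℤ, ∀ t ∈ chartSet, ⌊h t⌋ = ⌊t⌋ + k := by
  have key : ∀ s ∈ chartSet, ∀ t ∈ chartSet, s ≤ t → (⌊s⌋ = ⌊t⌋ ↔ ⌊h s⌋ = ⌊h t⌋) := by
    intro s hs t ht hst
    rw [floor_eq_iff_Icc_subset hs ht hst,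
      floor_eq_iff_Icc_subset ((hA s).2 hs) ((hA t).2 ht) (h.monotone hst)]
    constructor
    · intro hsub r hr
      obtain ⟨r, rfl⟩ := h.surjective r
      exact (hA r).2 (hsub ⟨h.le_iff_le.1 hr.1, h.le_iff_le.1 hr.2⟩)
    · intro hsub r hr
      exact (hA r).1 (hsub ⟨h.monotone hr.1, h.monotone hr.2⟩)
  have key' : ∀ s ∈ chartSet, ∀ t ∈ chartSet, (⌊s⌋ = ⌊t⌋ ↔ ⌊h s⌋ = ⌊h t⌋) := by
    intro s hs t ht
    rcases le_total s t with hst | hst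
    · exact key s hs t ht hst
    · rw [eq_comm, key t ht s hs hst, eq_comm]
  have hmid : ∀ n : ℤ, (n + 1 / 2 : ℝ) ∈ chartSet := fun n =>
    mem_chartSet_of_sub (add_half_mem_chart n)
  have hfl : ∀ n : ℤ, ⌊(n + 1 / 2 : ℝ)⌋ = n := fun n => floor_eq_of_mem_chart (add_half_mem_chart n)
  let σ : ℤ → ℤ := fun n => ⌊h (n + 1 / 2)⌋
  have hσ : ∀ t ∈ chartSet, ⌊h t⌋ = σ ⌊t⌋ := fun t ht =>
    (key' t ht _ (hmid ⌊t⌋)).1 (hfl _).symm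
  have hmono : StrictMono σ := by
    refine Monotone.strictMono_of_injective (fun m n hmn => ?_) fun m n hmn => ?_
    · have : (m : ℝ) ≤ n := by exact_mod_cast hmn
      exact Int.floor_mono (h.monotone (by linarith))
    · have := (key' _ (hmid m) _ (hmid n)).2 hmn
      rwa [hfl, hfl] at this
  have hsurj : Function.Surjective σ := by
    intro m
    have h1 : h (h.symm (m + 1 / 2)) = m + 1 / 2 := h.apply_symm_apply _
    refine ⟨⌊h.symm (m + 1 / 2)⌋, ?_⟩
    rw [← hσ _ ((hA _).1 (by rw [h1]; exact hmid m)), h1, hfl]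
  exact ⟨σ 0, fun t ht => by rw [hσ t ht, int_eq_add_of_strictMono_surjective hmono hsurj]⟩

namespace TwistData

open Suspension

variable {X : Type u} [TopologicalSpace X] {φ : X ≃ₜ X} (D : TwistData φ)

/-! ## Minimality of the actions on generic fibres -/

/-- The point `s` of the fibre of `x` is in the closure of the orbit of `t`. -/
def Reaches (x : X) (t s : ℝ) : Prop := ∀ U ∈ 𝓝 s, ∃ L ∈ D.group, L.1 x t ∈ U

variable {D}

theorem Reaches.trans {x : X} {t s r : ℝ} (h1 : D.Reaches x t s) (h2 : D.Reaches x s r) :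
    D.Reaches x t r := by
  intro U hU
  obtain ⟨V, hVU, hVo, hrV⟩ := mem_nhds_iff.1 hU
  obtain ⟨L, hL, hLs⟩ := h2 V (hVo.mem_nhds hrV)
  obtain ⟨M, hM, hMt⟩ := h1 _ ((L.1 x).continuous.continuousAt.preimage_mem_nhds (hVo.mem_nhds hLs))
  exact ⟨L * M, mul_mem hL hM, hVU hMt⟩

variable (D)

theorem reaches_apply (x : X) (t : ℝ) {L : liftGroup φ} (hL : L ∈ D.group) :
    D.Reaches x t (L.1 x t) := fun _ hU => ⟨L, hL, mem_of_mem_nhds hU⟩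

theorem apply_reaches (x : X) (t : ℝ) {L : liftGroup φ} (hL : L ∈ D.group) :
    D.Reaches x (L.1 x t) t := fun _ hU => ⟨L⁻¹, inv_mem hL, by
  have : (L.1 x)⁻¹ (L.1 x t) = t := (L.1 x).symm_apply_apply t
  change (L.1 x)⁻¹ (L.1 x t) ∈ _
  rw [this]
  exact mem_of_mem_nhds hU⟩

theorem reaches_of_mem_chart {x : X} {t s : ℝ} {n : ℤ}
    (ht : t - n ∈ Ioo (1 / 16 : ℝ) (1 - 1 / 16)) (hs : s - n ∈ Ioo (1 / 16 : ℝ) (1 - 1 / 16)) :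
    D.Reaches x t s := by
  intro U hU
  have hc : Continuous fun r : ℝ => r + n := by fun_prop
  have hU' : (fun r : ℝ => r + n) ⁻¹' U ∈ 𝓝 (s - n) :=
    hc.continuousAt.preimage_mem_nhds (by rwa [sub_add_cancel])
  obtain ⟨u, hu, hut⟩ := exists_PLS_apply_mem sixteenth_mem_dyadicRing
    one_sub_sixteenth_mem_dyadicRing ht hs hU'
  refine ⟨chartLift φ ⟨u, hu⟩, D.chartLift_mem _, ?_⟩
  rw [chartLift_of_mem (n := n) _ ⟨by linarith [ht.1], by linarith [ht.2]⟩]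
  exact hut

theorem twistLift_pow_apply {x : X} {t : ℝ} {n : ℤ} (ht : t - n ∈ Ioo (-1 / 4 : ℝ) (1 / 4))
    (N : ℕ) : (D.twistLift ^ N).1 x t = (D.fibre ((φ ^ n) x))^[N] (t - n) + n := by
  rw [coe_pow_apply]
  induction N with
  | zero => simp
  | succ N ih =>
    have := iterate_mem_of_suppIn (D.fibre_mem ((φ ^ n) x)) ht N
    rw [Function.iterate_succ_apply', Function.iterate_succ_apply', ih,
      D.twistLift_of_mem (n := n), add_sub_cancel_right]
    rw [add_sub_cancel_right]
    exact ⟨by linarith [this.1], by linarith [this.2]⟩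

/-- Off the base point the twist acts on this translate of `I` by some `v m` without fixed points,
so iterates approach the right end `1 / 4` and enter `J`. -/
theorem exists_twistLift_pow_mem {x : X} {t : ℝ} {n : ℤ} (hx : (φ ^ n) x ≠ D.x₀)
    (ht : t - n ∈ Ioo (-1 / 4 : ℝ) (1 / 4)) :
    ∃ N : ℕ, (D.twistLift ^ N).1 x t - n ∈ Ioo (1 / 16 : ℝ) (1 - 1 / 16) := by
  obtain ⟨m, hm⟩ := D.exists_mem hx
  have hf := D.fibre_of_mem hm
  obtain ⟨N, hN⟩ := exists_lt_iterate (D.approx.mem m).2 (D.approx.lt_apply m) ht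
    (show (1 / 16 : ℝ) < 1 / 4 by norm_num)
  have h1 := iterate_mem_of_suppIn (D.approx.mem m).2 ht N
  refine ⟨N, ?_⟩
  rw [D.twistLift_pow_apply ht, add_sub_cancel_right, hf]
  exact ⟨hN, h1.2.trans (by norm_num)⟩

variable {D}

theorem exists_reaches_half {x : X} (hx : D.Generic x) (t : ℝ) :
    ∃ n : ℤ, D.Reaches x t (n + 1 / 2) ∧ D.Reaches x (n + 1 / 2) t := by
  obtain ⟨n, h⟩ : ∃ n : ℤ, t - n ∈ Ioo (1 / 16 : ℝ) (1 - 1 / 16) ∨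
      t - n ∈ Ioo (-1 / 4 : ℝ) (1 / 4) := by
    have h0 := Int.floor_le t
    have h1 := Int.lt_floor_add_one t
    rcases le_or_gt (t - ⌊t⌋) (1 / 16) with h2 | h2
    · exact ⟨⌊t⌋, Or.inr ⟨by linarith, by linarith⟩⟩
    rcases lt_or_ge (t - ⌊t⌋) (1 - 1 / 16) with h3 | h3
    · exact ⟨⌊t⌋, Or.inl ⟨h2, h3⟩⟩
    · exact ⟨⌊t⌋ + 1, Or.inr ⟨by push_cast; linarith, by push_cast; linarith⟩⟩
  refine ⟨n, ?_⟩
  rcases h with h | h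
  · exact ⟨D.reaches_of_mem_chart h (add_half_mem_chart n),
      D.reaches_of_mem_chart (add_half_mem_chart n) h⟩
  · obtain ⟨N, hN⟩ := D.exists_twistLift_pow_mem (hx n) h
    have hmem : D.twistLift ^ N ∈ D.group := pow_mem D.twistLift_mem N
    exact ⟨(D.reaches_apply x t hmem).trans (D.reaches_of_mem_chart hN (add_half_mem_chart n)),
      (D.reaches_of_mem_chart (add_half_mem_chart n) hN).trans (D.apply_reaches x t hmem)⟩

/-- The point `n - 1 / 8` lies both in the translate of `J` before `n` and in the translate of `I`
around `n`, so the twist carries it across `n`. The number `N` of iterations is what distinguishes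
fibres later. -/
theorem exists_jump {x : X} {n : ℤ} (hx : (φ ^ n) x ≠ D.x₀) : ∃ (N : ℕ) (t : ℝ),
    t - (n - 1 : ℤ) ∈ Ioo (1 / 16 : ℝ) (1 - 1 / 16) ∧
    (D.twistLift ^ N).1 x t - n ∈ Ioo (1 / 16 : ℝ) (1 - 1 / 16) := by
  obtain ⟨N, hN⟩ := D.exists_twistLift_pow_mem (t := n - 1 / 8) hx
    ⟨by linarith, by linarith⟩
  refine ⟨N, n - 1 / 8, ?_, hN⟩
  push_cast
  constructor <;> linarith

theorem reaches_half_succ {x : X} (hx : D.Generic x) (n : ℤ) :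
    D.Reaches x ((n - 1 : ℤ) + 1 / 2) (n + 1 / 2) ∧
      D.Reaches x (n + 1 / 2) ((n - 1 : ℤ) + 1 / 2) := by
  obtain ⟨N, t, h1, h2⟩ := exists_jump (hx n)
  have hmem : D.twistLift ^ N ∈ D.group := pow_mem D.twistLift_mem N
  have h3 := add_half_mem_chart (n - 1)
  have h4 := add_half_mem_chart n
  exact ⟨((D.reaches_of_mem_chart h3 h1).trans (D.reaches_apply x t hmem)).trans
      (D.reaches_of_mem_chart h2 h4),
    ((D.reaches_of_mem_chart h4 h2).trans (D.apply_reaches x t hmem)).trans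
      (D.reaches_of_mem_chart h1 h3)⟩

theorem reaches_half_zero {x : X} (hx : D.Generic x) (n : ℤ) :
    D.Reaches x ((0 : ℤ) + 1 / 2) (n + 1 / 2) ∧ D.Reaches x (n + 1 / 2) ((0 : ℤ) + 1 / 2) := by
  have h0 := D.reaches_of_mem_chart (x := x) (add_half_mem_chart 0) (add_half_mem_chart 0)
  induction n with
  | zero => exact ⟨h0, h0⟩
  | succ n ih =>
    have h := reaches_half_succ hx (n + 1)
    rw [add_sub_cancel_right] at h
    exact ⟨ih.1.trans h.1, h.2.trans ih.2⟩
  | pred n ih =>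
    have h := reaches_half_succ hx (-n)
    exact ⟨ih.1.trans h.2, h.1.trans ih.2⟩

/-- The action on a generic fibre is minimal. -/
theorem reaches_of_generic {x : X} (hx : D.Generic x) (t s : ℝ) : D.Reaches x t s := by
  obtain ⟨n, h1, -⟩ := exists_reaches_half hx t
  obtain ⟨m, -, h2⟩ := exists_reaches_half hx s
  exact ((h1.trans (reaches_half_zero hx n).2).trans (reaches_half_zero hx m).1).trans h2

/-! ## Conjugacies between fibres -/

/-- This describes the translates of `J` by the action only, so that conjugacies have to preserve
them. -/
theorem mem_chartSet_iff {x : X} {t : ℝ} :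
    t ∈ chartSet ↔ ∃ u, (chartLift φ u).1 x t ≠ t := by
  constructor
  · intro ht
    obtain ⟨u, hu, hlt⟩ := exists_lt_apply sixteenth_mem_dyadicRing
      one_sub_sixteenth_mem_dyadicRing (by norm_num)
    refine ⟨⟨u, hu⟩, ?_⟩
    rw [chartLift_of_mem (n := ⌊t⌋) _ ⟨by linarith [ht.1], by linarith [ht.2]⟩]
    have := hlt _ ht
    exact ne_of_gt (by linarith)
  · rintro ⟨u, hu⟩
    by_contra ht
    refine hu (chartLift_of_notMem u fun n hn => ht (mem_chartSet_of_sub hn))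

/-- A conjugacy shifts the translates of `J` by a constant `k` and commutes with powers of the
twist, so crossings at `n` become crossings at `n + k` with the same number of iterations. -/
theorem jump_of_conj {x x' : X} (h : ℝ ≃o ℝ)
    (hc : ∀ L ∈ D.group, ∀ t, h (L.1 x t) = L.1 x' (h t)) :
    ∃ k : ℤ, ∀ (n : ℤ) (N : ℕ), (∃ t : ℝ, t - (n - 1 : ℤ) ∈ Ioo (1 / 16 : ℝ) (1 - 1 / 16) ∧
        (D.twistLift ^ N).1 x t - n ∈ Ioo (1 / 16 : ℝ) (1 - 1 / 16)) →
      ∃ t : ℝ, t - (n + k - 1 : ℤ) ∈ Ioo (1 / 16 : ℝ) (1 - 1 / 16) ∧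
        (D.twistLift ^ N).1 x' t - (n + k : ℤ) ∈ Ioo (1 / 16 : ℝ) (1 - 1 / 16) := by
  have hA : ∀ t, h t ∈ chartSet ↔ t ∈ chartSet := by
    intro t
    rw [mem_chartSet_iff (x := x') (φ := φ), mem_chartSet_iff (x := x) (φ := φ)]
    simp only [← hc _ (D.chartLift_mem _), h.injective.ne_iff]
  obtain ⟨k, hk⟩ := exists_floor_apply_eq h hA
  have hk' : ∀ (t : ℝ) (n : ℤ), t - n ∈ Ioo (1 / 16 : ℝ) (1 - 1 / 16) →
      h t - (n + k : ℤ) ∈ Ioo (1 / 16 : ℝ) (1 - 1 / 16) := by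
    intro t n ht
    have h1 : h t ∈ chartSet := (hA t).2 (mem_chartSet_of_sub ht)
    rw [← floor_eq_of_mem_chart ht, ← hk t (mem_chartSet_of_sub ht)]
    exact h1
  refine ⟨k, fun n N => ?_⟩
  rintro ⟨t, h1, h2⟩
  refine ⟨h t, ?_, ?_⟩
  · have := hk' _ _ h1
    rwa [show n - 1 + k = n + k - 1 by ring] at this
  · rw [← hc _ (pow_mem D.twistLift_mem N)]
    exact hk' _ _ h2

/-- By monotonicity, a crossing is detected at the right end `-1 / 16` of the left interval. This
weakens it to a closed condition on the fibre. -/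
theorem le_apply_of_jump {x : X} {n : ℤ} {N : ℕ}
    (h : ∃ t : ℝ, t - (n - 1 : ℤ) ∈ Ioo (1 / 16 : ℝ) (1 - 1 / 16) ∧
      (D.twistLift ^ N).1 x t - n ∈ Ioo (1 / 16 : ℝ) (1 - 1 / 16)) :
    1 / 16 ≤ (D.twistLift ^ N).1 ((φ ^ n) x) (-1 / 16) := by
  obtain ⟨t, h1, h2⟩ := h
  have h3 := liftGroup_shift (D.twistLift ^ N) n x (n - 1 / 16)
  rw [show (n - 1 / 16 : ℝ) - n = -1 / 16 by ring] at h3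
  rw [h3]
  have h4 : t ≤ n - 1 / 16 := by
    have := h1.2
    push_cast at this
    linarith
  linarith [((D.twistLift ^ N).1 x).monotone h4, h2.1]

theorem pow_apply_base_neg (N : ℕ) : (D.twistLift ^ N).1 D.x₀ (-1 / 16) < 0 := by
  have h := D.apply_base (pow_mem D.twistLift_mem N)
  conv_rhs => rw [← h]
  exact ((D.twistLift ^ N).1 D.x₀).strictMono (by norm_num)

theorem isClosed_le_apply (L : liftGroup φ) (ψ : X ≃ₜ X) (c t : ℝ) :
    IsClosed {x | c ≤ L.1 (ψ x) t} :=
  isClosed_le continuous_const ((L.2.1 t).comp ψ.continuous)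

/-- The set of fibres conjugate to a given generic fibre is meagre. -/
theorem isMeagre_conj (hφ : IsMinimalHomeo φ) {x : X} (hx : D.Generic x) :
    IsMeagre {x' | ∃ h : ℝ ≃o ℝ, ∀ L ∈ D.group, ∀ t, h (L.1 x t) = L.1 x' (h t)} := by
  choose N hN using fun n : ℤ => exists_jump (hx n)
  let Z : ℤ → Set X := fun k => {x' | ∀ n : ℤ,
    1 / 16 ≤ (D.twistLift ^ N n).1 ((φ ^ (n + k)) x') (-1 / 16)}
  have hZc : ∀ k, IsClosed (Z k) := fun k => by
    have : Z k = ⋂ n : ℤ, {x' | 1 / 16 ≤ (D.twistLift ^ N n).1 ((φ ^ (n + k)) x') (-1 / 16)} := by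
      ext; simp [Z]
    rw [this]
    exact isClosed_iInter fun n => isClosed_le_apply (D.twistLift ^ N n) (φ ^ (n + k)) _ _
  have hZi : ∀ k, interior (Z k) = ∅ := by
    intro k
    by_contra hne
    -- The orbit of `x₀` would enter the interior. At the index `-m - k` the condition concerns `x₀`
    -- itself, where no iterate can carry `-1 / 16` across the fixed point `0`.
    obtain ⟨m, hm⟩ := hφ.exists_mem isOpen_interior (nonempty_iff_ne_empty.2 hne) D.x₀
    have h1 := interior_subset hm (-m - k)
    rw [zpow_apply_zpow_apply, show -m - k + k + m = 0 by ring, zpow_zero] at h1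
    have h2 := D.pow_apply_base_neg (N (-m - k))
    have h3 : (1 / 16 : ℝ) ≤ (D.twistLift ^ N (-m - k)).1 D.x₀ (-1 / 16) := h1
    linarith
  have hmeagre : IsMeagre (⋃ k, Z k) := isMeagre_iUnion fun k =>
    ((hZc k).isNowhereDense_iff.2 (hZi k)).isMeagre
  refine hmeagre.mono ?_
  rintro x' ⟨h, hh⟩
  obtain ⟨k, hk⟩ := jump_of_conj h hh
  exact mem_iUnion.2 ⟨k, fun n => le_apply_of_jump (hk n _ (hN n))⟩

end TwistData

/-! ## Generic ergodicity of minimal homeomorphisms -/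

/-- An invariant Borel set of a minimal homeomorphism is meagre or comeagre. -/
theorem IsMinimalHomeo.mem_residual_or_compl {X : Type u} [TopologicalSpace X] [MeasurableSpace X]
    [BorelSpace X] {φ : X ≃ₜ X} (hφ : IsMinimalHomeo φ) {A : Set X} (hA : MeasurableSet A)
    (hinv : ∀ (n : ℤ) x, (φ ^ n) x ∈ A ↔ x ∈ A) : A ∈ residual X ∨ Aᶜ ∈ residual X := by
  -- Borel sets have the Baire property. If `U` is nonempty, every orbit meets it, and discarding
  -- countably many meagre sets transfers this to `A`.
  obtain ⟨U, hU, hAU⟩ := hA.residualEq_isOpen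
  rcases U.eq_empty_or_nonempty with rfl | hne
  · right
    filter_upwards [hAU.mem_iff] with x hx
    exact fun h => hx.1 h
  · left
    have h1 : ∀ n : ℤ, ∀ᶠ x in residual X, (φ ^ n) x ∈ A ↔ (φ ^ n) x ∈ U := fun n =>
      (tendsto_residual_of_isOpenMap (φ ^ n).continuous (φ ^ n).isOpenMap).eventually hAU.mem_iff
    filter_upwards [eventually_countable_forall.2 h1] with x hx
    obtain ⟨n, hn⟩ := hφ.exists_mem hU hne x
    exact (hinv n x).1 ((hx n).2 hn)

/-- An equivalence relation is not smooth if it pulls back, under a measurable map defined on a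
comeagre invariant Borel set of a minimal homeomorphism, to a relation which contains the orbit
relation and has meagre classes. -/
theorem IsMinimalHomeo.not_isSmoothRel {X : Type u} [TopologicalSpace X] [MeasurableSpace X]
    [BorelSpace X] [BaireSpace X] [Nonempty X] {φ : X ≃ₜ X} (hφ : IsMinimalHomeo φ) {P : X → Prop}
    (hPm : MeasurableSet {x | P x}) (hPr : {x | P x} ∈ residual X)
    (hPi : ∀ (n : ℤ) x, P x → P ((φ ^ n) x)) {A : Type u} [MeasurableSpace A] {E : A → A → Prop}
    (Θ : {x // P x} → A) (hΘ : Measurable Θ)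
    (hinv : ∀ (n : ℤ) (x : {x // P x}), E (Θ x) (Θ ⟨(φ ^ n) x, hPi n x x.2⟩))
    (hmeagre : ∀ x : {x // P x}, IsMeagre (Subtype.val '' {x' | E (Θ x) (Θ x')})) :
    ¬ IsSmoothRel E := by
  rintro ⟨Z, _, _, e, he, hE⟩
  -- The comeagre filter, restricted to the points where the map is defined.
  let l : Filter {x // P x} := comap Subtype.val (residual X)
  have hl : l.NeBot := by
    refine comap_neBot_iff.2 fun t ht => ?_
    obtain ⟨x, hx, hxP⟩ := (dense_of_mem_residual (inter_mem ht hPr)).nonempty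
    exact ⟨⟨x, hxP⟩, hx⟩
  have hbot : Nonempty Z := by
    obtain ⟨x⟩ : Nonempty {x // P x} := hl.nonempty
    exact ⟨e (Θ x)⟩
  have hsep : ∀ U : Set Z, MeasurableSet U →
      (∀ᶠ x in l, e (Θ x) ∈ U) ∨ ∀ᶠ x in l, e (Θ x) ∉ U := by
    intro U hU
    let B : Set X := Subtype.val '' {x : {x // P x} | e (Θ x) ∈ U}
    have hB : MeasurableSet B := MeasurableSet.subtype_image hPm ((he.comp hΘ) hU)
    have hmem : ∀ x : {x // P x}, x.1 ∈ B ↔ e (Θ x) ∈ U := by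
      intro x
      constructor
      · rintro ⟨y, hy, hxy⟩
        rwa [Subtype.ext hxy] at hy
      · exact fun h => ⟨x, h, rfl⟩
    have hBi' : ∀ (n : ℤ) x, x ∈ B → (φ ^ n) x ∈ B := by
      rintro n _ ⟨y, hy, rfl⟩
      refine (hmem ⟨(φ ^ n) y, hPi n y y.2⟩).2 ?_
      rw [← (hE _ _).1 (hinv n y)]
      exact hy
    have hBi : ∀ (n : ℤ) x, (φ ^ n) x ∈ B ↔ x ∈ B := by
      refine fun n x => ⟨fun h => ?_, hBi' n x⟩
      have := hBi' (-n) _ h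
      rwa [Suspension.zpow_apply_zpow_apply, neg_add_cancel, zpow_zero] at this
    rcases hφ.mem_residual_or_compl hB hBi with h | h
    · exact Or.inl (mem_of_superset (preimage_mem_comap h) fun x hx => (hmem x).1 hx)
    · exact Or.inr (mem_of_superset (preimage_mem_comap h) fun x hx h' => hx ((hmem x).2 h'))
  -- Measurable sets of a standard Borel space are countably separating, so the zero-one law makes
  -- the invariant constant on a comeagre set. That set lies in one class, which is meagre.
  obtain ⟨z, hz⟩ := exists_eventuallyEq_const_of_forall_separating MeasurableSet hsep
  have hz' : ∀ᶠ x in l, e (Θ x) = z := hz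
  obtain ⟨x, hx⟩ := hz'.exists
  have hM : ∀ᶠ x' in l, x'.1 ∉ Subtype.val '' {x' | E (Θ x) (Θ x')} :=
    preimage_mem_comap (hmeagre x)
  obtain ⟨x', h1, h2⟩ := (hz'.and hM).exists
  exact h2 ⟨x', (hE _ _).2 (hx.trans h1.symm), rfl⟩

namespace TwistData

open Suspension

variable {X : Type u} [TopologicalSpace X] {φ : X ≃ₜ X} {D : TwistData φ}

/-! ## The space of minimal actions of the group -/

/-- The action of the lifts on a fibre. -/
noncomputable def fibreHom (φ : X ≃ₜ X) (x : X) : liftGroup φ →* HomeoPlus where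
  toFun L := ⟨(L.1 x).toHomeomorph, (L.1 x).strictMono⟩
  map_one' := rfl
  map_mul' _ _ := rfl

/-- Joint continuity of a lift, once curried, is continuity into the compact-open topology. -/
theorem continuous_fibreHom (L : liftGroup φ) : Continuous fun x => fibreHom φ x L :=
  continuous_induced_rng.2 (ContinuousMap.continuous_of_continuous_uncurry _ (continuous_lift L))

theorem Generic.zpow {x : X} (hx : D.Generic x) (n : ℤ) : D.Generic ((φ ^ n) x) := fun m => by
  rw [zpow_apply_zpow_apply]
  exact hx _

/-- The action of the twist group on the fibre of a generic point. -/
noncomputable def fibreRep (hφ : IsAperiodicHomeo φ) (x : {x // D.Generic x}) :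
    RepMin (twistGroup φ (descendHom D.twistLift)) :=
  ⟨((fibreHom φ x.1).comp D.group.subtype).comp (D.groupEquiv hφ).symm.toMonoidHom, fun t => by
    rw [dense_iff_closure_eq]
    refine eq_univ_of_forall fun s => mem_closure_iff_nhds.2 fun U hU => ?_
    obtain ⟨L, hL, hLt⟩ := reaches_of_generic x.2 t s U hU
    refine ⟨_, hLt, D.groupEquiv hφ ⟨L, hL⟩, ?_⟩
    change ((D.groupEquiv hφ).symm (D.groupEquiv hφ ⟨L, hL⟩)).1.1 x.1 t = _
    rw [MulEquiv.symm_apply_apply]⟩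

theorem fibreRep_apply (hφ : IsAperiodicHomeo φ) (x : {x // D.Generic x})
    (g : twistGroup φ (descendHom D.twistLift)) :
    (fibreRep hφ x).1 g = fibreHom φ x.1 ((D.groupEquiv hφ).symm g).1 := rfl

theorem measurable_fibreRep [MeasurableSpace X] [BorelSpace X] (hφ : IsAperiodicHomeo φ) :
    Measurable (fibreRep (D := D) hφ) := by
  have : BorelSpace (RepMin (twistGroup φ (descendHom D.twistLift))) := ⟨rfl⟩
  refine Continuous.measurable (continuous_induced_rng.2 (continuous_pi fun g => ?_))
  exact (continuous_fibreHom _).comp continuous_subtype_val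

/-- Equivariance of lifts under `ℤ` is exactly conjugation by the translation by `-n`. -/
theorem fibreRep_conj_zpow (hφ : IsAperiodicHomeo φ) (x : {x // D.Generic x}) (n : ℤ) :
    RepMin.Conj (fibreRep hφ x) (fibreRep hφ ⟨(φ ^ n) x.1, x.2.zpow n⟩) := by
  refine ⟨⟨Homeomorph.addRight (-n : ℝ), fun a b h => ?_⟩, fun g => ?_⟩
  · change a + -(n : ℝ) < b + -(n : ℝ)
    linarith
  · rw [mul_inv_eq_iff_eq_mul]
    apply Subtype.ext
    ext t
    change ((D.groupEquiv hφ).symm g).1.1 x.1 t + -(n : ℝ) =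
      ((D.groupEquiv hφ).symm g).1.1 ((φ ^ n) x.1) (t + -(n : ℝ))
    rw [← sub_eq_add_neg, ← sub_eq_add_neg, liftGroup_shift]

theorem exists_orderIso_of_conj (hφ : IsAperiodicHomeo φ) {x x' : {x // D.Generic x}}
    (h : RepMin.Conj (fibreRep hφ x) (fibreRep hφ x')) :
    ∃ h : ℝ ≃o ℝ, ∀ L ∈ D.group, ∀ t, h (L.1 x.1 t) = L.1 x'.1 (h t) := by
  obtain ⟨h, hh⟩ := h
  have hm : StrictMono h.1 := h.2
  refine ⟨⟨h.1.toEquiv, hm.le_iff_le⟩, fun L hL t => ?_⟩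
  have h1 := hh (D.groupEquiv hφ ⟨L, hL⟩)
  rw [mul_inv_eq_iff_eq_mul, fibreRep_apply, fibreRep_apply, MulEquiv.symm_apply_apply] at h1
  exact congrArg (fun f : HomeoPlus => f.1 t) h1

theorem isClosed_singleton_of_zpow_eq [T1Space X] (x₀ : X) (n : ℤ) :
    IsClosed {x | (φ ^ n) x = x₀} :=
  isClosed_singleton.preimage (φ ^ n).continuous

theorem setOf_generic : {x | D.Generic x} = ⋂ n : ℤ, {x | (φ ^ n) x = D.x₀}ᶜ := by
  ext x
  simp [Generic]

theorem measurableSet_generic [T1Space X] [MeasurableSpace X] [BorelSpace X] :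
    MeasurableSet {x | D.Generic x} := by
  rw [setOf_generic]
  exact MeasurableSet.iInter fun n => (isClosed_singleton_of_zpow_eq D.x₀ n).measurableSet.compl

/-- The orbit of the base point is countable and, without isolated points, each of its points is
nowhere dense. -/
theorem generic_mem_residual [T1Space X] (hX : ∀ x : X, ¬ IsOpen {x}) :
    {x | D.Generic x} ∈ residual X := by
  rw [setOf_generic, countable_iInter_mem]
  intro n
  refine residual_of_dense_open (isClosed_singleton_of_zpow_eq D.x₀ n).isOpen_compl ?_
  rw [← interior_eq_empty_iff_dense_compl]
  by_contra hne
  obtain ⟨x, hx⟩ := nonempty_iff_ne_empty.2 hne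
  refine hX x ?_
  have : interior {x | (φ ^ n) x = D.x₀} = {x} := by
    refine Subset.antisymm (fun y hy => ?_) (singleton_subset_iff.2 hx)
    have h1 : x ∈ {x | (φ ^ n) x = D.x₀} := interior_subset hx
    have h2 : y ∈ {x | (φ ^ n) x = D.x₀} := interior_subset hy
    exact (φ ^ n).injective (Eq.trans h2 (Eq.symm h1))
  rw [← this]
  exact isOpen_interior

theorem exists_generic [T1Space X] [BaireSpace X] [Nonempty X] (hX : ∀ x : X, ¬ IsOpen {x}) :
    ∃ x, D.Generic x :=
  (dense_of_mem_residual (generic_mem_residual (D := D) hX)).nonempty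

variable (D)

/-- The conjugacy relation on minimal actions of the twist group is not smooth. -/
theorem not_inClassC [T1Space X] [BaireSpace X] [Nonempty X] (hX : ∀ x : X, ¬ IsOpen {x})
    (hφ : IsMinimalHomeo φ) (hφ' : IsAperiodicHomeo φ) :
    ¬ InClassC (twistGroup φ (descendHom D.twistLift)) := by
  rintro ⟨-, hsmooth⟩
  borelize X
  refine hφ.not_isSmoothRel (P := D.Generic) measurableSet_generic (generic_mem_residual hX)
    (fun n x hx => hx.zpow n) (fibreRep hφ') (measurable_fibreRep hφ')
    (fun n x => fibreRep_conj_zpow hφ' x n) (fun x => ?_) hsmooth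
  refine (isMeagre_conj hφ x.2).mono ?_
  rintro _ ⟨x', hx', rfl⟩
  exact exists_orderIso_of_conj hφ' hx'

end TwistData

/-! ### Finite generation and amenability of the group -/

namespace TwistData

open Suspension

variable {X : Type u} [TopologicalSpace X] {φ : X ≃ₜ X} (D : TwistData φ)

theorem fg_twistGroup (e : Nonempty (ThompsonF ≃* chartGroup φ univ (1 / 16) (1 - 1 / 16))) :
    Group.FG (twistGroup φ (descendHom D.twistLift)) := by
  classical
  obtain ⟨e⟩ := e
  have hF : Group.FG ThompsonF := fg_thompsonF
  have h1 : (chartGroup φ univ (1 / 16) (1 - 1 / 16)).FG :=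
    (Group.fg_iff_subgroup_fg _).1 (Group.fg_of_surjective (f := e.toMonoidHom) e.surjective)
  obtain ⟨S, hS⟩ := h1
  rw [Group.fg_iff_subgroup_fg]
  refine ⟨insert (descendHom D.twistLift) S, ?_⟩
  rw [Finset.coe_insert, insert_eq, Subgroup.closure_union, hS, twistGroup, Subgroup.closure_union,
    Subgroup.closure_eq]

theorem isAmenable_iff [CompactSpace X] (hφ : IsMinimalHomeo φ) (hφ' : IsAperiodicHomeo φ)
    {x₁ : X} (hx₁ : D.Generic x₁)
    (e : Nonempty (ThompsonF ≃* chartGroup φ univ (1 / 16) (1 - 1 / 16))) :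
    IsAmenable (twistGroup φ (descendHom D.twistLift)) ↔ IsAmenable ThompsonF := by
  rw [isAmenable_iff_hasInvariantMean, isAmenable_iff_hasInvariantMean]
  constructor
  · intro h
    obtain ⟨e⟩ := e
    have hle : chartGroup φ univ (1 / 16) (1 - 1 / 16) ≤ twistGroup φ (descendHom D.twistLift) :=
      fun g hg => Subgroup.subset_closure (Or.inr hg)
    exact .of_injective ((Subgroup.inclusion hle).comp e.toMonoidHom)
      ((Subgroup.inclusion_injective hle).comp e.injective) h
  · intro h
    have := D.germStabilizer_normal hφ'
    -- The germ stabiliser is normal with cyclic quotient, and its finitely generated subgroups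
    -- embed in Thompson's group.
    refine .of_cyclic_extension
      (germStabilizer φ (twistGroup φ (descendHom D.twistLift)) (proj φ D.x₀ 0)) _
      (D.exists_zpow_mul_mem hφ') (.of_fg fun K hK => ?_)
    have hK' : (K.map (Subgroup.subtype _)).FG := by
      classical
      obtain ⟨S, rfl⟩ := hK
      exact ⟨S.image (Subgroup.subtype _), by rw [Finset.coe_image, MonoidHom.map_closure]⟩
    obtain ⟨i, hi⟩ := D.exists_injective_thompsonF hφ hφ' hx₁ _ (Subgroup.map_subtype_le K) hK'
    have hj := (Subgroup.equivMapOfInjective K (Subgroup.subtype _) Subtype.val_injective)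
    exact .of_injective (i.comp hj.toMonoidHom) (hi.comp hj.injective) h

end TwistData

/-! ### The theorem for given data -/

/-- The twist data defined by a partition and an approximating sequence. -/
noncomputable def IsApproxSequence.twistData {X : Type u} [TopologicalSpace X] (φ : X ≃ₜ X) {x₀ : X}
    {C : ℕ → Set X} (hC : IsClopenPartition x₀ C) {s : ℕ → PLDyadic (-1 / 4) (1 / 4)}
    {sInf : Ioo (-1 / 4 : ℝ) (1 / 4) ≃ₜ Ioo (-1 / 4 : ℝ) (1 / 4)} (h : IsApproxSequence s sInf) :
    TwistData φ :=
  ⟨x₀, C, _, _, hC, h.isLineApprox⟩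

open Suspension in
theorem IsApproxSequence.isTwist {X : Type u} [TopologicalSpace X] (φ : X ≃ₜ X) {x₀ : X}
    {C : ℕ → Set X} (hC : IsClopenPartition x₀ C) {s : ℕ → PLDyadic (-1 / 4) (1 / 4)}
    {sInf : Ioo (-1 / 4 : ℝ) (1 / 4) ≃ₜ Ioo (-1 / 4 : ℝ) (1 / 4)} (h : IsApproxSequence s sInf) :
    IsTwist φ x₀ C s sInf (descendHom (h.twistData φ hC).twistLift) where
  apply_of_mem n x hx t := by
    rw [descendHom_proj, (h.twistData φ hC).twistLift_of_mem'
      ⟨by linarith [t.2.1], by linarith [t.2.2]⟩, (h.twistData φ hC).fibre_of_mem hx]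
    exact congrArg _
      (extEquiv_apply neg_quarter_mem_dyadicRing quarter_mem_dyadicRing (s n) t)
  apply_base t := by
    rw [descendHom_proj, (h.twistData φ hC).twistLift_of_mem'
      ⟨by linarith [t.2.1], by linarith [t.2.2]⟩]
    have h1 : (h.twistData φ hC).fibre x₀ = extIso sInf h.strictMono_limit :=
      (h.twistData φ hC).fibre_base
    rw [h1, extIso_of_mem]
  apply_of_notMem y hy := by
    obtain ⟨x, t, rfl⟩ := exists_proj_eq φ y
    rw [descendHom_proj, (h.twistData φ hC).twistLift_of_notMem (notMem_chart_proj.1 hy)]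

/-- Adding `1` at the digit `k` changes a sequence only from that digit on, so every point is a
limit of points different from it. -/
theorem not_isOpen_singleton_of_homeomorph {X : Type u} [TopologicalSpace X]
    (e : X ≃ₜ (ℕ → Bool)) (x : X) : ¬ IsOpen {x} := by
  intro h
  have h1 : IsOpen {e x} := by
    rw [← image_singleton]
    exact e.isOpenMap _ h
  have h2 : Tendsto (fun k => addDigit k (e x)) atTop (𝓝 (e x)) := by
    rw [tendsto_pi_nhds]
    intro n
    refine tendsto_const_nhds.congr' ?_
    filter_upwards [eventually_gt_atTop n] with k hk
    rw [addDigit_of_lt hk]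
  obtain ⟨k, hk⟩ := (h2.eventually (h1.mem_nhds rfl)).exists
  have h3 := congrFun (show addDigit k (e x) = e x from hk) k
  rw [addDigit_self] at h3
  simp at h3

section

open Suspension

theorem twistGroup_properties {X : Type u} [TopologicalSpace X] (e : X ≃ₜ (ℕ → Bool)) {φ : X ≃ₜ X}
    (hφ : IsMinimalHomeo φ) {x₀ : X} {C : ℕ → Set X} (hC : IsClopenPartition x₀ C)
    {s : ℕ → PLDyadic (-1 / 4) (1 / 4)}
    {sInf : Ioo (-1 / 4 : ℝ) (1 / 4) ≃ₜ Ioo (-1 / 4 : ℝ) (1 / 4)} (hs : IsApproxSequence s sInf) :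
    ∃ f : flowGroup φ, IsTwist φ x₀ C s sInf f ∧
      Nonempty (chartGroup φ univ (1 / 16) (1 - 1 / 16) ≃* ThompsonF) ∧
      Group.FG (twistGroup φ f) ∧
      ¬ InClassC (twistGroup φ f) ∧
      (germStabilizer φ (twistGroup φ f) (proj φ x₀ 0)).Normal ∧
      Subgroup.IsComplement' (germStabilizer φ (twistGroup φ f) (proj φ x₀ 0))
        (Subgroup.zpowers (twistGen φ f)) ∧
      ¬ IsOfFinOrder (twistGen φ f) ∧
      (∀ K : Subgroup (twistGroup φ f), K ≤ germStabilizer φ (twistGroup φ f) (proj φ x₀ 0) →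
        K.FG → ∃ ι : K →* ThompsonF, Function.Injective ι) ∧
      (IsAmenable (twistGroup φ f) ↔ IsAmenable ThompsonF) := by
  have : CompactSpace X := e.symm.compactSpace
  have : T2Space X := e.symm.t2Space
  have : Nonempty X := ⟨x₀⟩
  have hX := not_isOpen_singleton_of_homeomorph e
  have : Infinite X := by
    by_contra hfin
    rw [not_infinite_iff_finite] at hfin
    have : DiscreteTopology X := inferInstance
    exact hX x₀ (isOpen_discrete _)
  have hφ' := hφ.isAperiodicHomeo
  let D := hs.twistData φ hC
  obtain ⟨e1⟩ := nonempty_chartGroup_mulEquiv hφ'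
  obtain ⟨e2⟩ := exists_mulEquiv_PLS_chart
  obtain ⟨x₁, hx₁⟩ := TwistData.exists_generic (D := D) hX
  have e3 := e2.symm.trans e1
  exact ⟨descendHom D.twistLift, hs.isTwist φ hC, ⟨e3.symm⟩, D.fg_twistGroup ⟨e3⟩,
    D.not_inClassC hX hφ hφ', D.germStabilizer_normal hφ', D.isComplement'_germStabilizer hφ',
    D.not_isOfFinOrder_twistGen hφ', fun K => D.exists_injective_thompsonF hφ hφ' hx₁ K,
    D.isAmenable_iff hφ hφ' hx₁ ⟨e3⟩⟩

end

theorem theoremC :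
    -- the headline statement
    (∃ (G : Type) (_ : Group G), Group.FG G ∧ ¬ InClassC G ∧
      (IsAmenable G ↔ IsAmenable ThompsonF)) ∧
    -- the ingredients of the construction exist
    (∃ φ : (ℕ → Bool) ≃ₜ (ℕ → Bool), IsMinimalHomeo φ) ∧
    (∃ s sInf, IsApproxSequence s sInf) ∧
    -- the construction, for every minimal homeomorphism of a Cantor space
    ∀ (X : Type u) [TopologicalSpace X], Nonempty (X ≃ₜ (ℕ → Bool)) →
      ∀ φ : X ≃ₜ X, IsMinimalHomeo φ → ∀ x₀ : X,
        (∃ C : ℕ → Set X, IsClopenPartition x₀ C) ∧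
        ∀ C : ℕ → Set X, IsClopenPartition x₀ C → ∀ s sInf, IsApproxSequence s sInf →
          ∃ f : Suspension.flowGroup φ, IsTwist φ x₀ C s sInf f ∧
            Nonempty (Suspension.chartGroup φ univ (1 / 16) (1 - 1 / 16) ≃* ThompsonF) ∧
            -- `G` is finitely generated
            Group.FG (twistGroup φ f) ∧
            -- `G` is not in the class
            ¬ InClassC (twistGroup φ f) ∧
            -- `G` is the semidirect product of the germ stabiliser `G⁰` of `z = π (x₀, 0)` and
            -- the infinite cyclic group generated by `f`
            (Suspension.germStabilizer φ (twistGroup φ f) (Suspension.proj φ x₀ 0)).Normal ∧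
            Subgroup.IsComplement'
              (Suspension.germStabilizer φ (twistGroup φ f) (Suspension.proj φ x₀ 0))
              (Subgroup.zpowers (twistGen φ f)) ∧
            ¬ IsOfFinOrder (twistGen φ f) ∧
            -- finitely generated subgroups of `G⁰` embed in Thompson's group
            (∀ K : Subgroup (twistGroup φ f),
              K ≤ Suspension.germStabilizer φ (twistGroup φ f) (Suspension.proj φ x₀ 0) →
              K.FG → ∃ ι : K →* ThompsonF, Function.Injective ι) ∧
            -- amenability
            (IsAmenable (twistGroup φ f) ↔ IsAmenable ThompsonF) := by
  refine ⟨?_, ⟨odometer, isMinimalHomeo_odometer⟩, exists_isApproxSequence, ?_⟩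
  · obtain ⟨s, sInf, hs⟩ := exists_isApproxSequence
    obtain ⟨C, hC⟩ := exists_isClopenPartition (Homeomorph.refl (ℕ → Bool)) fun _ => false
    obtain ⟨f, -, -, h1, h2, -, -, -, -, h3⟩ :=
      twistGroup_properties (Homeomorph.refl (ℕ → Bool)) isMinimalHomeo_odometer hC hs
    exact ⟨twistGroup odometer f, inferInstance, h1, h2, h3⟩
  · rintro X _ ⟨e⟩ φ hφ x₀
    exact ⟨exists_isClopenPartition e x₀, fun C hC s sInf hs => twistGroup_properties e hφ hC hs⟩
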